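/- **Language.** Let $\mathcal L$ be the first-order language with relation symbols $=,<$ and a function symbol for each elementary recursive function (presented by a derivation from $0$, successor, projections, $+$, $\dot-$, $\cdot$, $2^x$ by composition and limited recursion). $\mathsf{EA}$ is the $\mathcal L$-theory consisting of the axioms for $=,<$, the defining axioms of the function symbols, and complete induction for bounded $\mathcal L$-formulas. An $\mathsf{Acc}$-operator is a formula $\varphi(X,x)\equiv\forall y(\theta_0(x,y)\to t_0(x,y)\in X)$ with $\theta_0$ a bounded $\mathcal L$-formula and $t_0$ an $\mathcal L$-term. $\mathcal L(\mathsf{Acc})$ adds to $\mathcal L$ a unary predicate constant $R_\varphi$ for every $\mathsf{Acc}$-operator $\varphi$. An $\mathcal L(\mathsf{Acc})$-formula is positive (negative) if all predicate constants $R_\varphi$ occur only positively (negatively) in it. **Theory.** $(Acc,\mathrm N\lor\mathrm P)\text{-}\mathrm{ID}(\mathsf{Acc})$ is the theory in classical first-order logic extending $\mathsf{EA}$ by 1. $\theta(0)\land\forall x(\theta(x)\to\theta(x+1))\to\forall y\,\theta(y)$ for every $\theta(x)\equiv\forall y(\theta_0(x,y)\to t_0(x,y)\in R_\varphi)$ with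 $\theta_0$ a bounded $\mathcal L$-formula, $t_0$ an $\mathcal L$-term (both possibly with further parameters) and $\varphi$ an $\mathsf{Acc}$-operator; 2. $\forall x[\varphi(R_\varphi,x)\to R_\varphi(x)]$ for every $\mathsf{Acc}$-operator $\varphi$; 3. $\forall u[R_\varphi(u)\to\forall x(\varphi(\sigma,x)\to\sigma(x))\to\sigma(u)]$ for every $\mathsf{Acc}$-operator $\varphi$ and every formula $\sigma(x)\equiv D(x)\lor C(x)$ with $D$ negative and $C$ positive, possibly with parameters. **Notations.** The set $OT'(\vartheta)$ of notations, its ordering $<$, and finite sets $K(\alpha)\subset OT'(\vartheta)$ are defined simultaneously. The elements are: $0$; $\vartheta(\alpha)$ for $\alpha\in OT'(\vartheta)$; sums $\vartheta(\alpha_1)+\dots+\vartheta(\alpha_m)$ with $m\ge2$ and $\vartheta(\alpha_1)\ge\dots\ge\vartheta(\alpha_m)$ (these elements and $0$ are the elements $<\Omega$); and $\Omega^{\alpha_1}\beta_1+\dots+\Omega^{\alpha_n}\beta_n$ with $n\ge1$, $\alpha_1>\dots>\alpha_n$, $\alpha_1>0$, $0\ne\beta_i<\Omega$. Put $K(0)=\emptyset$,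 $K(\vartheta(\alpha_1)+\dots+\vartheta(\alpha_m))=\{\vartheta(\alpha_1),\dots,\vartheta(\alpha_m)\}$ for $m\ge1$, and $K(\Omega^{\alpha_1}\beta_1+\dots+\Omega^{\alpha_n}\beta_n)=\bigcup_i(K(\alpha_i)\cup\{\beta_i\})$. The element $0$ is least, the elements $<\Omega$ precede all others, sums are compared lexicographically, and $$\vartheta(\alpha)<\vartheta(\beta)\iff[\alpha<\beta\land\forall\gamma\in K(\alpha)\,(\gamma<\vartheta(\beta))]\lor\exists\delta\in K(\beta)\,(\vartheta(\alpha)\le\delta).$$ Write $1=\vartheta(0)$, $\ell=1+\dots+1$ ($\ell$ summands), $\Omega^0=1$. Elements of $OT'(\vartheta)$ are coded by natural numbers in the usual structural way (nested pairing of the codes of the immediate subterms), so that $<$ becomes an elementary recursive relation on $\mathbb N$. Let $W$ be the predicate constant $R_\varphi$ for $\varphi(X,x)\equiv\forall y(y<x\to y\in X)$, that is, the accessible part of $<$. **Lemma.** For each $\ell<\omega$, $$(Acc,\mathrm N\lor\mathrm P)\text{-}\mathrm{ID}(\mathsf{Acc})\vdash\vartheta(\Omega^\ell)\in W .$$ 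-/

import Mathlib

/-! ## Elementary recursive functions

Function symbols of the arithmetical language: one symbol for each derivation of an elementary
recursive function from zero, successor, projections, `+`, cut-off subtraction, `*`, `2 ^ x` by
composition and limited (bounded) recursion. -/

namespace WeakID

inductive ElemFun : ℕ → Type
  | zero : ElemFun 0
  | succ : ElemFun 1
  | add : ElemFun 2
  | sub : ElemFun 2
  | mul : ElemFun 2
  | exp : ElemFun 1
  | proj {n : ℕ} (i : Fin n) : ElemFun n
  | comp {m n : ℕ} (f : ElemFun m) (g : Fin m → ElemFun n) : ElemFun n
  /-- Limited recursion on the first argument: `f(0,x) = min (g(x), b(0,x))` and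
  `f(y+1,x) = min (h(y,f(y,x),x), b(y+1,x))`. -/
  | brec {n : ℕ} (g : ElemFun n) (h : ElemFun (n + 2)) (b : ElemFun (n + 1)) : ElemFun (n + 1)

namespace ElemFun

/-- The function on the natural numbers denoted by a symbol. -/
def eval : {n : ℕ} → ElemFun n → (Fin n → ℕ) → ℕ
  | _, zero, _ => 0
  | _, succ, x => x 0 + 1
  | _, add, x => x 0 + x 1
  | _, sub, x => x 0 - x 1
  | _, mul, x => x 0 * x 1
  | _, exp, x => 2 ^ x 0
  | _, proj i, x => x i
  | _, comp f g, x => f.eval (fun i => (g i).eval x)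
  | _, brec g h b, x =>
      Nat.rec (min (g.eval (Matrix.vecTail x)) (b.eval (Matrix.vecCons 0 (Matrix.vecTail x))))
        (fun y r => min (h.eval (Matrix.vecCons y (Matrix.vecCons r (Matrix.vecTail x))))
          (b.eval (Matrix.vecCons (y + 1) (Matrix.vecTail x))))
        (Matrix.vecHead x)

/-! Combinators. A symbol of arity `n` is read as an expression in the variables
`proj 0, …, proj (n-1)`; as a truth value, `0` is false and every other value is true. -/

variable {n : ℕ}

def cst (n : ℕ) : ℕ → ElemFun n
  | 0 => comp zero ![]
  | k + 1 => comp succ ![cst n k]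
instance : Add (ElemFun n) := ⟨fun a b => comp add ![a, b]⟩
instance : Sub (ElemFun n) := ⟨fun a b => comp sub ![a, b]⟩
instance : Mul (ElemFun n) := ⟨fun a b => comp mul ![a, b]⟩
def two_pow (a : ElemFun n) : ElemFun n := comp exp ![a]
/-- Weakening: the new variable is `proj 0`. -/
def wk (a : ElemFun n) : ElemFun (n + 1) := comp a (fun i => proj i.succ)
def not (a : ElemFun n) : ElemFun n := cst n 1 - a
def and (a b : ElemFun n) : ElemFun n := a * b
def or (a b : ElemFun n) : ElemFun n := a + b
def eq (a b : ElemFun n) : ElemFun n := not ((a - b) + (b - a))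
def lt (a b : ElemFun n) : ElemFun n := b - a
/-- Bounded quantifier `∃ i ≤ b, P i`, the bound variable being `proj 0` in `P`. -/
def bex (b : ElemFun n) (P : ElemFun (n + 1)) : ElemFun n :=
  comp (brec (comp P (Matrix.vecCons (cst n 0) proj))
      (or (proj 1)
        (comp P (Matrix.vecCons (proj 0 + cst (n + 2) 1) (fun i => proj i.succ.succ))))
      (cst (n + 1) 1))
    (Matrix.vecCons b proj)
/-- Bounded quantifier `∀ i ≤ b, P i`. -/
def ball (b : ElemFun n) (P : ElemFun (n + 1)) : ElemFun n := not (bex b (not P))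
/-- `∃ i j ≤ b, P`; `i` is `proj 1` and `j` is `proj 0`. -/
def bex2 (b : ElemFun n) (P : ElemFun (n + 2)) : ElemFun n := bex b (bex (wk b) P)
/-- `∃ i j k ≤ b, P`; `i` is `proj 2`, `j` is `proj 1` and `k` is `proj 0`. -/
def bex3 (b : ElemFun n) (P : ElemFun (n + 3)) : ElemFun n := bex b (bex2 (wk b) P)
/-- The `k`-th binary digit of `t` is `1`: `∃ q r ≤ t, r < 2^k ∧ t = (2q+1) 2^k + r`. -/
def bit (t k : ElemFun n) : ElemFun n :=
  bex2 t (and (lt (proj 0) (two_pow (wk (wk k))))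
    (eq (wk (wk t)) (((proj 1 + proj 1) + cst (n + 2) 1) * two_pow (wk (wk k)) + proj 0)))
/-- Course-of-values recursion for predicates. In `h` the variables are `y, t, x`, where the
`i`-th binary digit of `t` (`i < y`) is the truth value of the predicate at `i, x`. -/
def tab (h : ElemFun (n + 2)) : ElemFun (n + 1) :=
  brec (cst n 0) (proj 1 + two_pow (proj 0) * not (not h)) (two_pow (proj 0))
def cov (h : ElemFun (n + 2)) : ElemFun (n + 1) :=
  comp h (Matrix.vecCons (proj 0) (Matrix.vecCons (tab h) (fun i => proj i.succ)))

end ElemFun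

/-! ## The notation system `OT'(ϑ)` -/

/-- Terms. `th a r` is `ϑ(a) + r` (`r` a countable sum, possibly `0`), and `om a b c` is
`Ω^a b + c` (`c` the remaining, smaller summands, possibly `0`). -/
inductive OTerm : Type
  | zero : OTerm
  | th (a r : OTerm) : OTerm
  | om (a b c : OTerm) : OTerm

namespace OTerm

def theta (a : OTerm) : OTerm := th a zero

/-- Terms below `Ω`. -/
def IsCtbl : OTerm → Prop
  | zero => True
  | th _ _ => True
  | om _ _ _ => False

/-- `K(0) = ∅`, `K(ϑ(a₁) + ⋯ + ϑ(aₘ)) = {ϑ(a₁), …, ϑ(aₘ)}`, and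
`K(Ω^a₁ b₁ + ⋯ + Ω^aₙ bₙ) = ⋃ K(aₖ) ∪ {bₖ}`; a countable nonzero tail `c` of `Ω^a b + c` is the
coefficient of `Ω^0`. -/
def K : OTerm → Set OTerm
  | zero => ∅
  | th a r => {theta a} ∪ K r
  | om a b c => K a ∪ {b} ∪ {g | (c ≠ zero ∧ c.IsCtbl ∧ g = c) ∨ (¬ c.IsCtbl ∧ g ∈ K c)}

/-- The ordering. Sums are compared lexicographically, and `ϑ(a) < ϑ(b)` iff
`a < b` and `K(a) < ϑ(b)`, or `ϑ(a) ≤ d` for some `d ∈ K(b)`. -/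
inductive Lt : OTerm → OTerm → Prop
  | zero_th (a r : OTerm) : Lt zero (th a r)
  | zero_om (a b c : OTerm) : Lt zero (om a b c)
  | th_om (a r a' b' c' : OTerm) : Lt (th a r) (om a' b' c')
  | th_arg (a r a' r' : OTerm) :
      Lt a a' → (∀ g ∈ K a, Lt g (theta a')) → Lt (th a r) (th a' r')
  | th_K_eq (a r a' r' : OTerm) : theta a ∈ K a' → Lt (th a r) (th a' r')
  | th_K_lt (a r a' r' d : OTerm) : d ∈ K a' → Lt (theta a) d → Lt (th a r) (th a' r')
  | th_tail (a r r' : OTerm) : Lt r r' → Lt (th a r) (th a r')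
  | om_exp (a b c a' b' c' : OTerm) : Lt a a' → Lt (om a b c) (om a' b' c')
  | om_coeff (a b c b' c' : OTerm) : Lt b b' → Lt (om a b c) (om a b' c')
  | om_tail (a b c c' : OTerm) : Lt c c' → Lt (om a b c) (om a b c')

/-- Membership in `OT'(ϑ)`: countable sums have weakly decreasing summands, the exponents in
`Ω^a b + c` are strictly decreasing, the coefficients are nonzero and countable, and the leading
exponent is not `0`. -/
def NF : OTerm → Prop
  | zero => True
  | th a r => NF a ∧ NF r ∧
      (r = zero ∨ ∃ b s, r = th b s ∧ (b = a ∨ Lt (theta b) (theta a)))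
  | om a b c => NF a ∧ NF b ∧ NF c ∧ a ≠ zero ∧ b ≠ zero ∧ b.IsCtbl ∧
      (c.IsCtbl ∨ ∃ a' b' c', c = om a' b' c' ∧ Lt a' a)

/-- The finite ordinals: `k = ϑ(0) + ⋯ + ϑ(0)`. -/
def ofNat : ℕ → OTerm
  | 0 => zero
  | k + 1 => th zero (ofNat k)

/-- `Ω^k`. -/
def omegaPow : ℕ → OTerm
  | 0 => ofNat 1
  | k + 1 => om (ofNat (k + 1)) (ofNat 1) zero

def pr (a b : ℕ) : ℕ := (a + b) * (a + b) + a

/-- Encoding of terms by natural numbers. -/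
def code : OTerm → ℕ
  | zero => 0
  | th a r => 2 * pr a.code r.code + 1
  | om a b c => 2 * pr a.code (pr b.code c.code) + 2

end OTerm

/-! ## The ordering on codes as an elementary recursive relation -/

namespace ElemFun

variable {n : ℕ}

def pr (a b : ElemFun n) : ElemFun n := (a + b) * (a + b) + a
def th (a r : ElemFun n) : ElemFun n := cst n 2 * pr a r + cst n 1
def om (a b c : ElemFun n) : ElemFun n := cst n 2 * pr a (pr b c) + cst n 2

def isCtbl (c : ElemFun n) : ElemFun n :=
  or (eq c (cst n 0)) (bex2 c (eq (wk (wk c)) (th (proj 1) (proj 0))))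

def inKStep : ElemFun 3 := -- x, t, g
    or (bex2 (proj 0) <| -- r, a, x, t, g
        and (eq (proj 2) (th (proj 1) (proj 0)))
          (or (eq (proj 4) (th (proj 1) (cst 5 0))) (bit (proj 3) (proj 0))))
      (bex3 (proj 0) <| -- c, b, a, x, t, g
        and (eq (proj 3) (om (proj 2) (proj 1) (proj 0)))
          (or (or (bit (proj 4) (proj 2)) (eq (proj 5) (proj 1)))
            (or (and (not (eq (proj 0) (cst 6 0))) (and (isCtbl (proj 0)) (eq (proj 5) (proj 0))))
              (and (not (isCtbl (proj 0))) (bit (proj 4) (proj 0))))))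

/-- Arguments `x, g`: the predicate `g ∈ K x`. -/
def inK : ElemFun 2 := cov inKStep

/-- `ϑ(a) < ϑ(a')`, where `t` is a table for the ordering at smaller arguments. -/
def thLt (t a a' : ElemFun n) : ElemFun n :=
  or
    (and (bit t (pr a a'))
      (ball a (or (not (comp inK ![wk a, proj 0]))
        (bit (wk t) (pr (proj 0) (th (wk a') (cst (n + 1) 0)))))))
    (bex a' (and (comp inK ![wk a', proj 0])
      (or (eq (th (wk a) (cst (n + 1) 0)) (proj 0))
        (bit (wk t) (pr (th (wk a) (cst (n + 1) 0)) (proj 0))))))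

def ltStep : ElemFun 2 := -- z, t
  bex2 (proj 0) <| -- y, x, z, t
    and (eq (proj 2) (pr (proj 1) (proj 0))) <|
      or (and (eq (proj 1) (cst 4 0)) (not (eq (proj 0) (cst 4 0)))) <|
      or (bex2 (proj 1) <| -- r, a, y, x, z, t
          and (eq (proj 3) (th (proj 1) (proj 0))) <|
            or (bex2 (proj 2) <| -- r', a', r, a, y, x, z, t
                and (eq (proj 4) (th (proj 1) (proj 0)))
                  (or (thLt (proj 7) (proj 3) (proj 1))
                    (and (eq (proj 3) (proj 1)) (bit (proj 7) (pr (proj 2) (proj 0))))))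
              (bex3 (proj 2) <| -- c', b', a', r, a, y, x, z, t
                eq (proj 5) (om (proj 2) (proj 1) (proj 0))))
        (bex3 (proj 1) <| -- c, b, a, y, x, z, t
          and (eq (proj 4) (om (proj 2) (proj 1) (proj 0))) <|
            bex3 (proj 3) <| -- c', b', a', c, b, a, y, x, z, t
              and (eq (proj 6) (om (proj 2) (proj 1) (proj 0))) <|
                or (bit (proj 9) (pr (proj 5) (proj 2))) <|
                  and (eq (proj 5) (proj 2)) <|
                    or (bit (proj 9) (pr (proj 4) (proj 1))) <|
                      and (eq (proj 4) (proj 1)) (bit (proj 9) (pr (proj 3) (proj 0))))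

/-- The ordering of the terms with codes `x` and `y`, as a predicate of `z = pr x y`. -/
def ltPr : ElemFun 1 := cov ltStep

def ltTerm (x y : ElemFun n) : ElemFun n := comp ltPr ![pr x y]

def isNFStep : ElemFun 2 := -- x, t
    or (eq (proj 0) (cst 2 0)) <|
    or (bex2 (proj 0) <| -- r, a, x, t
        and (eq (proj 2) (th (proj 1) (proj 0))) <|
        and (and (bit (proj 3) (proj 1)) (bit (proj 3) (proj 0))) <|
          or (eq (proj 0) (cst 4 0)) <|
            bex2 (proj 0) <| -- s, b, r, a, x, t
              and (eq (proj 2) (th (proj 1) (proj 0)))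
                (or (eq (proj 1) (proj 3))
                  (ltTerm (th (proj 1) (cst 6 0)) (th (proj 3) (cst 6 0)))))
      (bex3 (proj 0) <| -- c, b, a, x, t
        and (eq (proj 3) (om (proj 2) (proj 1) (proj 0))) <|
        and (and (bit (proj 4) (proj 2)) (and (bit (proj 4) (proj 1)) (bit (proj 4) (proj 0)))) <|
        and (and (not (eq (proj 2) (cst 5 0))) (not (eq (proj 1) (cst 5 0)))) <|
        and (isCtbl (proj 1)) <|
          or (isCtbl (proj 0)) <|
            bex3 (proj 0) <| -- c', b', a', c, b, a, x, t
              and (eq (proj 3) (om (proj 2) (proj 1) (proj 0))) (ltTerm (proj 2) (proj 5)))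

/-- Membership in `OT'(ϑ)` of the term with code `x`. -/
def isNF : ElemFun 1 := cov isNFStep

/-- Arguments `y, x`: both are codes of elements of `OT'(ϑ)`, and the first element is smaller
than the second. -/
def otLt : ElemFun 2 :=
  and (and (comp isNF ![proj 0]) (comp isNF ![proj 1])) (ltTerm (proj 0) (proj 1))

end ElemFun

/-! ### Correctness of the encoding in the standard model -/

namespace ElemFun

variable {n : ℕ}

/-- Truth in the standard model. -/
def Tr (a : ElemFun n) (x : Fin n → ℕ) : Prop := a.eval x ≠ 0

section
variable (a b c : ElemFun n) (x : Fin n → ℕ)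

@[simp] theorem eval_proj (i : Fin n) : (proj i).eval x = x i := rfl
@[simp] theorem eval_cst (k : ℕ) : (cst n k).eval x = k := by
  induction k with
  | zero => rfl
  | succ k ih => simpa [cst, eval] using ih
@[simp] theorem eval_add : (a + b).eval x = a.eval x + b.eval x := rfl
@[simp] theorem eval_sub : (a - b).eval x = a.eval x - b.eval x := rfl
@[simp] theorem eval_mul : (a * b).eval x = a.eval x * b.eval x := rfl
@[simp] theorem eval_two_pow : (two_pow a).eval x = 2 ^ a.eval x := rfl
@[simp] theorem eval_wk (i : ℕ) : (wk a).eval (Matrix.vecCons i x) = a.eval x := by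
  simp [wk, eval]
@[simp] theorem eval_pr : (pr a b).eval x = OTerm.pr (a.eval x) (b.eval x) := rfl
@[simp] theorem eval_th : (th a b).eval x = 2 * OTerm.pr (a.eval x) (b.eval x) + 1 := by
  simp [th]
@[simp] theorem eval_om :
    (om a b c).eval x = 2 * OTerm.pr (a.eval x) (OTerm.pr (b.eval x) (c.eval x)) + 2 := by
  simp [om]
@[simp] theorem tr_not : Tr (not a) x ↔ ¬ Tr a x := by simp [Tr, not]; omega
@[simp] theorem tr_and : Tr (and a b) x ↔ Tr a x ∧ Tr b x := by simp [Tr, and]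
@[simp] theorem tr_or : Tr (or a b) x ↔ Tr a x ∨ Tr b x := by simp [Tr, or]; omega
@[simp] theorem tr_eq : Tr (eq a b) x ↔ a.eval x = b.eval x := by simp [Tr, eq, not]; omega
@[simp] theorem tr_lt : Tr (lt a b) x ↔ a.eval x < b.eval x := by simp [Tr, lt]; omega

theorem eval_brec_zero (g : ElemFun n) (h : ElemFun (n + 2)) (b : ElemFun (n + 1)) :
    (brec g h b).eval (Matrix.vecCons 0 x) = min (g.eval x) (b.eval (Matrix.vecCons 0 x)) := rfl
theorem eval_brec_succ (g : ElemFun n) (h : ElemFun (n + 2)) (b : ElemFun (n + 1)) (y : ℕ) :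
    (brec g h b).eval (Matrix.vecCons (y + 1) x) =
      min (h.eval (Matrix.vecCons y (Matrix.vecCons ((brec g h b).eval (Matrix.vecCons y x)) x)))
        (b.eval (Matrix.vecCons (y + 1) x)) := rfl

theorem comp_cons (m : ℕ) (f : ElemFun (m + 1)) (g : ElemFun n) (gs : Fin m → ElemFun n) :
    (comp f (Matrix.vecCons g gs)).eval x =
      f.eval (Matrix.vecCons (g.eval x) (fun i => (gs i).eval x)) := by
  simp only [eval]
  congr 1
  funext i
  refine Fin.cases ?_ (fun i => ?_) i <;> simp

@[simp] theorem tr_bex (P : ElemFun (n + 1)) :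
    Tr (bex a P) x ↔ ∃ i ≤ a.eval x, Tr P (Matrix.vecCons i x) := by
  rw [Tr, bex, comp_cons]
  simp only [eval_proj]
  generalize a.eval x = k
  induction k with
  | zero => simp [eval_brec_zero, comp_cons, Tr]
  | succ k ih =>
    rw [eval_brec_succ]
    simp only [eval_cst]
    have : ∀ u : ℕ, min u 1 ≠ 0 ↔ u ≠ 0 := by omega
    rw [this, ← Tr, tr_or]
    simp only [Tr, comp_cons, eval_proj, eval_add, eval_cst, Matrix.cons_val_zero,
      Matrix.cons_val_succ] at ih ⊢
    simp only [Matrix.cons_val_one, Matrix.cons_val_zero]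
    rw [ih]
    constructor
    · rintro (⟨i, hi, h⟩ | h)
      · exact ⟨i, by omega, h⟩
      · exact ⟨k + 1, le_rfl, h⟩
    · rintro ⟨i, hi, h⟩
      rcases Nat.lt_or_ge k i with h' | h'
      · obtain rfl : i = k + 1 := by omega
        exact Or.inr h
      · exact Or.inl ⟨i, h', h⟩

@[simp] theorem tr_ball (P : ElemFun (n + 1)) :
    Tr (ball a P) x ↔ ∀ i ≤ a.eval x, Tr P (Matrix.vecCons i x) := by
  simp [ball]
@[simp] theorem tr_bex2 (P : ElemFun (n + 2)) : Tr (bex2 a P) x ↔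
    ∃ i ≤ a.eval x, ∃ j ≤ a.eval x, Tr P (Matrix.vecCons j (Matrix.vecCons i x)) := by
  simp [bex2]
@[simp] theorem tr_bex3 (P : ElemFun (n + 3)) : Tr (bex3 a P) x ↔
    ∃ i ≤ a.eval x, ∃ j ≤ a.eval x, ∃ k ≤ a.eval x,
      Tr P (Matrix.vecCons k (Matrix.vecCons j (Matrix.vecCons i x))) := by
  simp [bex3]

@[simp] theorem tr_bit : Tr (bit a b) x ↔ (a.eval x).testBit (b.eval x) = true := by
  simp only [bit, tr_bex2, tr_and, tr_lt, tr_eq, eval_wk, eval_two_pow, eval_add, eval_mul,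
    eval_proj, eval_cst, Matrix.cons_val_zero, Matrix.cons_val_one]
  generalize a.eval x = t
  generalize b.eval x = k
  rw [Nat.testBit_eq_decide_div_mod_eq, decide_eq_true_iff]
  constructor
  · rintro ⟨q, -, r, -, hr, h⟩
    rw [h, mul_comm, Nat.mul_add_div (by positivity), Nat.div_eq_of_lt hr]
    omega
  · intro h
    have h1 := Nat.div_add_mod t (2 ^ k)
    have h2 := Nat.mod_lt t (y := 2 ^ k) (by positivity)
    refine ⟨t / 2 ^ k / 2, ?_, t % 2 ^ k, Nat.mod_le _ _, h2, ?_⟩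
    · exact (Nat.div_le_self _ _).trans (Nat.div_le_self _ _)
    · have : t / 2 ^ k / 2 + t / 2 ^ k / 2 + 1 = t / 2 ^ k := by omega
      rw [this, mul_comm]; exact h1.symm

theorem eval_cov (h : ElemFun (n + 2)) (y : ℕ) :
    (cov h).eval (Matrix.vecCons y x) =
      h.eval (Matrix.vecCons y (Matrix.vecCons ((tab h).eval (Matrix.vecCons y x)) x)) := by
  rw [cov, comp_cons]
  congr 2
  funext i
  refine Fin.cases ?_ (fun i => ?_) i <;> simp

open Classical in
theorem tr_cov_aux (h : ElemFun (n + 2)) (y : ℕ) :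
    (tab h).eval (Matrix.vecCons y x) < 2 ^ y ∧
    ∀ i < y, (((tab h).eval (Matrix.vecCons y x)).testBit i = true ↔
      Tr (cov h) (Matrix.vecCons i x)) := by
  induction y with
  | zero => simp [tab, eval_brec_zero]
  | succ y ih =>
    obtain ⟨ih1, ih2⟩ := ih
    have e : (tab h).eval (Matrix.vecCons (y + 1) x) = (tab h).eval (Matrix.vecCons y x) +
        2 ^ y * (if Tr (cov h) (Matrix.vecCons y x) then 1 else 0) := by
      have e1 : Tr (cov h) (Matrix.vecCons y x) ↔
          h.eval (Matrix.vecCons y (Matrix.vecCons ((tab h).eval (Matrix.vecCons y x)) x)) ≠ 0 := by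
        simp [Tr, eval_cov]
      rw [e1]
      conv_lhs => rw [tab, eval_brec_succ, ← tab]
      have : ∀ u : ℕ, 1 - (1 - u) = if u ≠ 0 then 1 else 0 := by intro u; split_ifs <;> omega
      simp only [eval_add, eval_proj, eval_mul, eval_two_pow, not, eval_sub, eval_cst, this,
        Matrix.cons_val_zero, Matrix.cons_val_one]
      rw [pow_succ]
      split_ifs <;> omega
    rw [e]
    refine ⟨by rw [pow_succ]; split_ifs <;> omega, fun i hi => ?_⟩
    rcases Nat.lt_or_ge i y with h' | h'
    · rw [← ih2 i h', add_comm, Nat.testBit_two_pow_mul_add _ ih1, if_pos h']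
    · obtain rfl : i = y := by omega
      rw [add_comm, Nat.testBit_two_pow_mul_add _ ih1, if_neg (lt_irrefl _)]
      split_ifs with h2 <;> simp [h2]

theorem tr_cov (h : ElemFun (n + 2)) (y : ℕ) :
    ∃ t : ℕ, (∀ i < y, (t.testBit i = true ↔ Tr (cov h) (Matrix.vecCons i x))) ∧
      (Tr (cov h) (Matrix.vecCons y x) ↔ Tr h (Matrix.vecCons y (Matrix.vecCons t x))) :=
  ⟨_, (tr_cov_aux x h y).2, by simp [Tr, eval_cov]⟩

end

end ElemFun

namespace OTerm

theorem nf_ofNat (k : ℕ) : (ofNat k).NF := by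
  induction k with
  | zero => trivial
  | succ k ih =>
    refine ⟨trivial, ih, ?_⟩
    cases k with
    | zero => exact .inl rfl
    | succ k => exact .inr ⟨_, _, rfl, .inl rfl⟩
theorem nf_theta_omegaPow (k : ℕ) : (theta (omegaPow k)).NF := by
  refine ⟨?_, trivial, .inl rfl⟩
  cases k with
  | zero => exact nf_ofNat 1
  | succ k =>
    exact ⟨nf_ofNat _, nf_ofNat _, trivial, OTerm.noConfusion, OTerm.noConfusion, trivial,
      .inl trivial⟩

theorem le_pr_left (a b : ℕ) : a ≤ pr a b := by unfold pr; omega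
theorem le_pr_right (a b : ℕ) : b ≤ pr a b := by unfold pr; nlinarith
theorem pr_lt {a b a' b' : ℕ} (h : a ≤ a') (h' : b ≤ b') (h2 : a < a' ∨ b < b') :
    pr a b < pr a' b' := by
  unfold pr; rcases h2 with h2 | h2 <;> nlinarith
theorem pr_le {a b a' b' : ℕ} (h : a ≤ a') (h' : b ≤ b') : pr a b ≤ pr a' b' := by
  unfold pr; nlinarith
@[simp] theorem pr_inj {a b a' b' : ℕ} : pr a b = pr a' b' ↔ a = a' ∧ b = b' := by
  refine ⟨fun h => ?_, by rintro ⟨rfl, rfl⟩; rfl⟩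
  unfold pr at h
  have : a + b = a' + b' := by
    rcases lt_trichotomy (a + b) (a' + b') with h1 | h1 | h1
    · nlinarith
    · exact h1
    · nlinarith
  rw [this] at h
  omega

theorem code_injective : Function.Injective code := by
  intro s
  induction s with
  | zero => intro t h; cases t <;> simp [code] at h ⊢
  | th a r iha ihr =>
    intro t h
    cases t with
    | zero => simp [code] at h
    | th a' r' => simp [code] at h; rw [iha h.1, ihr h.2]
    | om a' b' c' => simp only [code] at h; omega
  | om a b c iha ihb ihc =>
    intro t h
    cases t with
    | zero => simp [code] at h
    | th a' r' => simp only [code] at h; omega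
    | om a' b' c' => simp [code] at h; rw [iha h.1, ihb h.2.1, ihc h.2.2]

@[simp] theorem code_inj {s t : OTerm} : s.code = t.code ↔ s = t := code_injective.eq_iff
@[simp] theorem code_eq_zero {s : OTerm} : s.code = 0 ↔ s = zero := code_inj (t := zero)

theorem code_th_left (a r : OTerm) : a.code < (th a r).code := by
  have := le_pr_left a.code r.code; simp only [code]; omega
theorem code_th_right (a r : OTerm) : r.code < (th a r).code := by
  have := le_pr_right a.code r.code; simp only [code]; omega
theorem code_om_one (a b c : OTerm) : a.code < (om a b c).code := by
  have := le_pr_left a.code (pr b.code c.code); simp only [code]; omega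
theorem code_om_two (a b c : OTerm) : b.code < (om a b c).code := by
  have := le_pr_right a.code (pr b.code c.code)
  have := le_pr_left b.code c.code; simp only [code]; omega
theorem code_om_three (a b c : OTerm) : c.code < (om a b c).code := by
  have := le_pr_right a.code (pr b.code c.code)
  have := le_pr_right b.code c.code; simp only [code]; omega

theorem code_eq_th {s : OTerm} {a r : ℕ} :
    s.code = 2 * pr a r + 1 ↔ ∃ u v, s = th u v ∧ u.code = a ∧ v.code = r := by
  cases s with
  | zero => simp [code]
  | th u v => simp [code]
  | om u v w => simp [code]; omega
theorem code_eq_om {s : OTerm} {a b c : ℕ} : s.code = 2 * pr a (pr b c) + 2 ↔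
    ∃ u v w, s = om u v w ∧ u.code = a ∧ v.code = b ∧ w.code = c := by
  cases s with
  | zero => simp [code]
  | th u v => simp [code]; omega
  | om u v w => simp [code]

/-- Bounded search for the immediate subterms of a term. -/
theorem ex_th {s : OTerm} {P : ℕ → ℕ → Prop} :
    (∃ a ≤ s.code, ∃ r ≤ s.code, s.code = 2 * pr a r + 1 ∧ P a r) ↔
      ∃ u v, s = th u v ∧ P u.code v.code := by
  constructor
  · rintro ⟨a, -, r, -, h, hP⟩
    obtain ⟨u, v, rfl, rfl, rfl⟩ := code_eq_th.1 h
    exact ⟨u, v, rfl, hP⟩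
  · rintro ⟨u, v, rfl, hP⟩
    exact ⟨_, (code_th_left u v).le, _, (code_th_right u v).le, rfl, hP⟩
theorem ex_om {s : OTerm} {P : ℕ → ℕ → ℕ → Prop} :
    (∃ a ≤ s.code, ∃ b ≤ s.code, ∃ c ≤ s.code, s.code = 2 * pr a (pr b c) + 2 ∧ P a b c) ↔
      ∃ u v w, s = om u v w ∧ P u.code v.code w.code := by
  constructor
  · rintro ⟨a, -, b, -, c, -, h, hP⟩
    obtain ⟨u, v, w, rfl, rfl, rfl, rfl⟩ := code_eq_om.1 h
    exact ⟨u, v, w, rfl, hP⟩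
  · rintro ⟨u, v, w, rfl, hP⟩
    exact ⟨_, (code_om_one u v w).le, _, (code_om_two u v w).le, _, (code_om_three u v w).le,
      rfl, hP⟩

theorem ex_om_iff {s : OTerm} :
    (∃ a ≤ s.code, ∃ b ≤ s.code, ∃ c ≤ s.code, s.code = 2 * pr a (pr b c) + 2) ↔
      ∃ u v w, s = om u v w := by
  simpa using ex_om (s := s) (P := fun _ _ _ => True)

theorem code_le_of_mem_K {g s : OTerm} (h : g ∈ K s) : g.code ≤ s.code := by
  induction s with
  | zero => simp [K] at h
  | th a r iha ihr =>
    rcases h with h | h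
    · cases h
      have : pr a.code 0 ≤ pr a.code r.code := pr_le le_rfl (Nat.zero_le _)
      simp only [theta, code]; omega
    · exact (ihr h).trans (code_th_right a r).le
  | om a b c iha ihb ihc =>
    rcases h with (h | h) | ⟨-, -, h⟩ | ⟨-, h⟩
    · exact (iha h).trans (code_om_one a b c).le
    · rw [Set.mem_singleton_iff.1 h]; exact (code_om_two a b c).le
    · rw [h]; exact (code_om_three a b c).le
    · exact (ihc h).trans (code_om_three a b c).le

end OTerm

namespace ElemFun

open OTerm

variable {n : ℕ}

theorem tr_isCtbl (c : ElemFun n) (x : Fin n → ℕ) (s : OTerm) (h : c.eval x = s.code) :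
    Tr (isCtbl c) x ↔ s.IsCtbl := by
  have := ex_th (s := s) (P := fun _ _ => True)
  simp only [and_true] at this
  simp [isCtbl, h, this]
  cases s <;> simp [IsCtbl]


theorem tr_inK (s : OTerm) (m : ℕ) : Tr inK ![s.code, m] ↔ ∃ g ∈ K s, g.code = m := by
  induction s with
  | zero =>
    obtain ⟨t, ht, h⟩ := tr_cov ![m] inKStep (OTerm.code .zero)
    rw [inK, h]
    simp [inKStep, K, code]
  | th a r iha ihr =>
    obtain ⟨t, ht, h⟩ := tr_cov ![m] inKStep (OTerm.code (.th a r))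
    rw [inK, h]
    have h1 := ht _ (code_th_right a r)
    rw [← inK, ihr] at h1
    simp [inKStep, ex_th, ex_om, h1, K, theta]
    rw [eq_comm]; rfl
  | om a b c iha ihb ihc =>
    obtain ⟨t, ht, h⟩ := tr_cov ![m] inKStep (OTerm.code (.om a b c))
    rw [inK, h]
    have h1 := ht _ (code_om_one a b c)
    have h2 := ht _ (code_om_three a b c)
    rw [← inK, iha] at h1
    rw [← inK, ihc] at h2
    simp [inKStep, ex_th, ex_om, h1, h2, K]
    rw [tr_isCtbl _ _ c (by simp)]
    constructor
    · rintro ((⟨g, hg, rfl⟩ | rfl) | ⟨h3, h4, rfl⟩ | ⟨h3, g, hg, rfl⟩)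
      · exact ⟨g, .inl (.inr hg), rfl⟩
      · exact ⟨b, .inl (.inl rfl), rfl⟩
      · exact ⟨c, .inr (.inl ⟨h3, h4, rfl⟩), rfl⟩
      · exact ⟨g, .inr (.inr ⟨h3, hg⟩), rfl⟩
    · rintro ⟨g, (rfl | hg) | ⟨h3, h4, rfl⟩ | ⟨h3, hg⟩, rfl⟩
      · exact .inl (.inr rfl)
      · exact .inl (.inl ⟨g, hg, rfl⟩)
      · exact .inr (.inl ⟨h3, h4, rfl⟩)
      · exact .inr (.inr ⟨h3, g, hg, rfl⟩)

theorem tr_comp_inK (a b : ElemFun n) (x : Fin n → ℕ) :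
    Tr (comp inK ![a, b]) x ↔ Tr inK ![a.eval x, b.eval x] := by
  simp only [Tr, comp_cons]
  rw [show (fun i => (![b] i).eval x) = ![b.eval x] by ext i; fin_cases i; rfl]

theorem code_theta_le (a r : OTerm) : 2 * OTerm.pr a.code 0 + 1 ≤ (OTerm.th a r).code := by
  have : OTerm.pr a.code 0 ≤ OTerm.pr a.code r.code := pr_le le_rfl (Nat.zero_le _)
  simp only [code]; omega

theorem tr_ltPr (s t : OTerm) : Tr ltPr ![OTerm.pr s.code t.code] ↔ Lt s t := by
  generalize hz : OTerm.pr s.code t.code = z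
  induction z using Nat.strong_induction_on generalizing s t with
  | _ z ih =>
  obtain ⟨T, hT, h⟩ := tr_cov ![] ltStep z
  rw [ltPr, h]
  have key : ∀ u v : OTerm, u.code ≤ s.code → v.code ≤ t.code →
      (u.code < s.code ∨ v.code < t.code) →
      (T.testBit (OTerm.pr u.code v.code) = true ↔ Lt u v) := by
    intro u v h1 h2 h3
    have h4 : OTerm.pr u.code v.code < z := hz ▸ pr_lt h1 h2 h3
    rw [hT _ h4, ← ltPr]
    exact ih _ h4 u v rfl
  have e : ∀ P : ℕ → ℕ → Prop,
      (∃ i ≤ z, ∃ j ≤ z, z = OTerm.pr i j ∧ P i j) ↔ P s.code t.code := by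
    intro P
    constructor
    · rintro ⟨i, -, j, -, h1, h2⟩
      rw [← hz, pr_inj] at h1
      obtain ⟨rfl, rfl⟩ := h1
      exact h2
    · intro h1
      exact ⟨_, hz ▸ le_pr_left _ _, _, hz ▸ le_pr_right _ _, hz.symm, h1⟩
  simp only [ltStep, tr_bex2, tr_and, tr_eq, eval_proj, eval_pr, Matrix.cons_val, e, tr_or,
    tr_bex3, eval_th, eval_om, tr_not, eval_cst]
  cases s with
  | zero =>
    cases t with
    | zero => simp [ex_th, ex_om]; rintro ⟨⟩
    | th a' r' => simp; exact .zero_th _ _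
    | om a' b' c' => simp; exact .zero_om _ _ _
  | th a r =>
    cases t with
    | zero => simp [ex_th, ex_om, ex_om_iff]; rintro ⟨⟩
    | th a' r' =>
      have k1 := key a a' (code_th_left a r).le (code_th_left a' r').le (.inl (code_th_left a r))
      have k2 := key r r' (code_th_right a r).le (code_th_right a' r').le
        (.inl (code_th_right a r))
      have k3 : ∀ g, g.code ≤ a.code →
          (T.testBit (OTerm.pr g.code (2 * OTerm.pr a'.code 0 + 1)) = true ↔ Lt g (theta a')) := by
        intro g hg
        have := hg.trans_lt (code_th_left a r)
        exact key g (theta a') this.le (code_theta_le a' r') (.inl this)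
      have k4 : ∀ g, g.code ≤ a'.code →
          (T.testBit (OTerm.pr (2 * OTerm.pr a.code 0 + 1) g.code) = true ↔ Lt (theta a) g) := by
        intro g hg
        have := hg.trans_lt (code_th_left a' r')
        exact key (theta a) g (code_theta_le a r) this.le (.inr this)
      simp [ex_th, ex_om, ex_om_iff, thLt, tr_comp_inK, tr_inK, k1, k2]
      constructor
      · rintro ((⟨h1, h2⟩ | ⟨g, hg, hK, h1 | h1⟩) | ⟨rfl, h1⟩)
        · refine .th_arg _ _ _ _ h1 (fun g hg => ?_)
          have hle := code_le_of_mem_K hg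
          rcases h2 _ hle with h3 | h3
          · exact absurd rfl (h3 g hg)
          · exact (k3 g hle).1 h3
        · have : theta a = g := code_injective h1
          exact .th_K_eq _ _ _ _ (this ▸ hK)
        · exact .th_K_lt _ _ _ _ g hK ((k4 g hg).1 h1)
        · exact .th_tail _ _ _ h1
      · intro h1
        cases h1 with
        | th_arg _ _ _ _ h1 h2 =>
          refine .inl (.inl ⟨h1, fun i hi => ?_⟩)
          by_cases h3 : ∃ g ∈ K a, g.code = i
          · obtain ⟨g, hg, rfl⟩ := h3
            exact .inr ((k3 g hi).2 (h2 g hg))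
          · exact .inl (fun g hg h4 => h3 ⟨g, hg, h4⟩)
        | th_K_eq _ _ _ _ h1 => exact .inl (.inr ⟨_, code_le_of_mem_K h1, h1, .inl rfl⟩)
        | th_K_lt _ _ _ _ d h1 h2 =>
          exact .inl (.inr ⟨d, code_le_of_mem_K h1, h1,
            .inr ((k4 d (code_le_of_mem_K h1)).2 h2)⟩)
        | th_tail _ _ _ h1 => exact .inr ⟨rfl, h1⟩
    | om a' b' c' =>
      simp [ex_th, ex_om, ex_om_iff]
      exact ⟨fun _ => .th_om _ _ _ _ _,
        fun _ => ⟨_, (code_th_left a r).le, _, (code_th_right a r).le, rfl⟩⟩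
  | om a b c =>
    cases t with
    | zero => simp [ex_th, ex_om]; rintro ⟨⟩
    | th a' r' => simp [ex_th, ex_om]; rintro ⟨⟩
    | om a' b' c' =>
      have k1 := key a a' (code_om_one a b c).le (code_om_one a' b' c').le
        (.inl (code_om_one a b c))
      have k2 := key b b' (code_om_two a b c).le (code_om_two a' b' c').le
        (.inl (code_om_two a b c))
      have k3 := key c c' (code_om_three a b c).le (code_om_three a' b' c').le
        (.inl (code_om_three a b c))
      simp [ex_th, ex_om, k1, k2, k3]
      constructor
      · rintro (h1 | ⟨rfl, h1 | ⟨rfl, h1⟩⟩)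
        · exact .om_exp _ _ _ _ _ _ h1
        · exact .om_coeff _ _ _ _ _ h1
        · exact .om_tail _ _ _ _ h1
      · intro h1
        cases h1 with
        | om_exp _ _ _ _ _ _ h1 => exact .inl h1
        | om_coeff _ _ _ _ _ h1 => exact .inr ⟨rfl, .inl h1⟩
        | om_tail _ _ _ _ h1 => exact .inr ⟨rfl, .inr ⟨rfl, h1⟩⟩

theorem tr_ltTerm (a b : ElemFun n) (x : Fin n → ℕ) (s t : OTerm)
    (hs : a.eval x = s.code) (ht : b.eval x = t.code) : Tr (ltTerm a b) x ↔ Lt s t := by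
  rw [← tr_ltPr]
  simp only [Tr, ltTerm, comp_cons, eval_pr, hs, ht]
  rw [show (fun i => (![] i : ElemFun n).eval x) = ![] from Subsingleton.elim _ _]

theorem tr_isNF (s : OTerm) : Tr isNF ![s.code] ↔ s.NF := by
  induction s with
  | zero =>
    obtain ⟨T, hT, h⟩ := tr_cov ![] isNFStep (OTerm.code .zero)
    rw [isNF, h]
    simp [isNFStep, NF, code]
  | th a r iha ihr =>
    obtain ⟨T, hT, h⟩ := tr_cov ![] isNFStep (OTerm.code (.th a r))
    rw [isNF, h]
    have k1 := hT _ (code_th_left a r)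
    have k2 := hT _ (code_th_right a r)
    rw [← isNF, iha] at k1
    rw [← isNF, ihr] at k2
    have k3 : ∀ u v : OTerm, Tr (ltTerm (th (proj 1) (cst 6 0)) (th (proj 3) (cst 6 0)))
        ![v.code, u.code, r.code, a.code, (OTerm.th a r).code, T] ↔ Lt (theta u) (theta a) :=
      fun u v => tr_ltTerm _ _ _ _ _ (by simp [theta, code]) (by simp [theta, code])
    simp [isNFStep, NF, ex_th, ex_om, k1, k2, k3, and_assoc]
  | om a b c iha ihb ihc =>
    obtain ⟨T, hT, h⟩ := tr_cov ![] isNFStep (OTerm.code (.om a b c))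
    rw [isNF, h]
    have k1 := hT _ (code_om_one a b c)
    have k2 := hT _ (code_om_two a b c)
    have k3 := hT _ (code_om_three a b c)
    rw [← isNF, iha] at k1
    rw [← isNF, ihb] at k2
    rw [← isNF, ihc] at k3
    have k4 : ∀ u v w : OTerm, Tr (ltTerm (proj 2) (proj 5))
        ![w.code, v.code, u.code, c.code, b.code, a.code, (OTerm.om a b c).code, T] ↔ Lt u a :=
      fun u v w => tr_ltTerm _ _ _ _ _ (by simp) (by simp)
    simp [isNFStep, NF, ex_th, ex_om, k1, k2, k3, k4, and_assoc]
    rw [tr_isCtbl _ _ b (by simp), tr_isCtbl _ _ c (by simp)]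
    intros; exact Iff.rfl

theorem exists_of_tr_isNF (m : ℕ) (hm : Tr isNF ![m]) : ∃ s : OTerm, s.code = m := by
  induction m using Nat.strong_induction_on with
  | _ m ih =>
  obtain ⟨T, hT, h⟩ := tr_cov ![] isNFStep m
  rw [isNF, h] at hm
  have key : ∀ i < m, T.testBit i = true → ∃ s : OTerm, s.code = i := fun i hi h1 =>
    ih i hi ((hT i hi).1 h1)
  simp only [isNFStep, tr_or, tr_eq, tr_bex2, tr_bex3, tr_and, tr_bit, eval_proj, eval_cst,
    eval_th, eval_om, Matrix.cons_val] at hm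
  rcases hm with rfl | ⟨a, -, r, -, h1, ⟨h2, h3⟩, -⟩ | ⟨a, -, b, -, c, -, h1, ⟨h2, h3, h4⟩, -⟩
  · exact ⟨.zero, rfl⟩
  · have := le_pr_left a r
    have := le_pr_right a r
    obtain ⟨u, rfl⟩ := key a (by omega) h2
    obtain ⟨v, rfl⟩ := key r (by omega) h3
    exact ⟨.th u v, h1.symm⟩
  · have := le_pr_left a (OTerm.pr b c)
    have := le_pr_right a (OTerm.pr b c)
    have := le_pr_left b c
    have := le_pr_right b c
    obtain ⟨u, rfl⟩ := key a (by omega) h2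
    obtain ⟨v, rfl⟩ := key b (by omega) h3
    obtain ⟨w, rfl⟩ := key c (by omega) h4
    exact ⟨.om u v w, h1.symm⟩

/-- `otLt` is the ordering of `OT'(ϑ)` transported along the encoding. -/
theorem tr_otLt (l m : ℕ) : Tr otLt ![l, m] ↔
    ∃ s t : OTerm, s.code = l ∧ t.code = m ∧ s.NF ∧ t.NF ∧ Lt s t := by
  have e : ∀ i : Fin 2, Tr (comp isNF ![proj i]) ![l, m] ↔ Tr isNF ![(![l, m] i)] := by
    intro i
    simp only [Tr, comp_cons, eval_proj]
    rw [show (fun i => (![] i : ElemFun 2).eval ![l, m]) = ![] from Subsingleton.elim _ _]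
  simp only [otLt, tr_and, e]
  constructor
  · rintro ⟨⟨h1, h2⟩, h3⟩
    simp only [Matrix.cons_val] at h1 h2
    obtain ⟨s, rfl⟩ := exists_of_tr_isNF _ h1
    obtain ⟨t, rfl⟩ := exists_of_tr_isNF _ h2
    exact ⟨s, t, rfl, rfl, (tr_isNF s).1 h1, (tr_isNF t).1 h2,
      (tr_ltTerm _ _ _ s t rfl rfl).1 h3⟩
  · rintro ⟨s, t, rfl, rfl, h1, h2, h3⟩
    exact ⟨⟨(tr_isNF s).2 h1, (tr_isNF t).2 h2⟩, (tr_ltTerm _ _ _ s t rfl rfl).2 h3⟩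

end ElemFun

/-! ## First-order formulas

Terms and formulas in negation normal form, with de Bruijn indices: under a quantifier, `var 0` is
the bound variable and `var (i + 1)` is the variable `var i` from outside. `P` is the type of the
unary predicate constants. -/

inductive Tm : Type
  | var (i : ℕ) : Tm
  | fn {k : ℕ} (f : ElemFun k) (ts : Fin k → Tm) : Tm

namespace Tm

def subst (σ : ℕ → Tm) : Tm → Tm
  | var i => σ i
  | fn f ts => fn f (fun i => (ts i).subst σ)

def shift (t : Tm) : Tm := t.subst (fun i => var (i + 1))

/-- Only the variables `var i` with `i < k` occur. -/
def Below (k : ℕ) : Tm → Prop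
  | var i => i < k
  | fn _ ts => ∀ i, (ts i).Below k

def zero : Tm := fn .zero ![]
def succ (s : Tm) : Tm := fn .succ ![s]
def add (s t : Tm) : Tm := fn .add ![s, t]
def sub (s t : Tm) : Tm := fn .sub ![s, t]
def mul (s t : Tm) : Tm := fn .mul ![s, t]
def exp (s : Tm) : Tm := fn .exp ![s]
/-- `min(s, t) = s ∸ (s ∸ t)`. -/
def min (s t : Tm) : Tm := sub s (sub s t)

def numeral : ℕ → Tm
  | 0 => zero
  | n + 1 => succ (numeral n)

end Tm

/-- The substitution `0 ↦ t`, `i + 1 ↦ σ i`. -/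
def scons (t : Tm) (σ : ℕ → Tm) : ℕ → Tm
  | 0 => t
  | i + 1 => σ i

/-- A substitution under one more quantifier. -/
def up (σ : ℕ → Tm) : ℕ → Tm := scons (.var 0) (fun i => (σ i).shift)

inductive Fml (P : Type) : Type
  | eq (s t : Tm) : Fml P
  | ne (s t : Tm) : Fml P
  | lt (s t : Tm) : Fml P
  | nlt (s t : Tm) : Fml P
  | rel (p : P) (t : Tm) : Fml P
  | nrel (p : P) (t : Tm) : Fml P
  | and (A B : Fml P) : Fml P
  | or (A B : Fml P) : Fml P
  | all (A : Fml P) : Fml P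
  | ex (A : Fml P) : Fml P

namespace Fml

variable {P : Type}

def neg : Fml P → Fml P
  | eq s t => ne s t
  | ne s t => eq s t
  | lt s t => nlt s t
  | nlt s t => lt s t
  | rel p t => nrel p t
  | nrel p t => rel p t
  | and A B => or A.neg B.neg
  | or A B => and A.neg B.neg
  | all A => ex A.neg
  | ex A => all A.neg

def imp (A B : Fml P) : Fml P := or A.neg B

def subst (σ : ℕ → Tm) : Fml P → Fml P
  | eq s t => eq (s.subst σ) (t.subst σ)
  | ne s t => ne (s.subst σ) (t.subst σ)
  | lt s t => lt (s.subst σ) (t.subst σ)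
  | nlt s t => nlt (s.subst σ) (t.subst σ)
  | rel p t => rel p (t.subst σ)
  | nrel p t => nrel p (t.subst σ)
  | and A B => and (A.subst σ) (B.subst σ)
  | or A B => or (A.subst σ) (B.subst σ)
  | all A => all (A.subst (up σ))
  | ex A => ex (A.subst (up σ))

def shift (A : Fml P) : Fml P := A.subst (fun i => .var (i + 1))

/-- `A(t)`, for `A` with distinguished variable `var 0`. -/
def inst (A : Fml P) (t : Tm) : Fml P := A.subst (scons t .var)

/-- Only the variables `var i` with `i < k` occur free. -/
def Below (k : ℕ) : Fml P → Prop
  | eq s t => s.Below k ∧ t.Below k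
  | ne s t => s.Below k ∧ t.Below k
  | lt s t => s.Below k ∧ t.Below k
  | nlt s t => s.Below k ∧ t.Below k
  | rel _ t => t.Below k
  | nrel _ t => t.Below k
  | and A B => A.Below k ∧ B.Below k
  | or A B => A.Below k ∧ B.Below k
  | all A => A.Below (k + 1)
  | ex A => A.Below (k + 1)

/-- Positive formulas: no predicate constant occurs negatively. -/
def IsPos : Fml P → Prop
  | nrel _ _ => False
  | and A B => A.IsPos ∧ B.IsPos
  | or A B => A.IsPos ∧ B.IsPos
  | all A => A.IsPos
  | ex A => A.IsPos
  | _ => True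

/-- Negative formulas: no predicate constant occurs positively. -/
def IsNeg : Fml P → Prop
  | rel _ _ => False
  | and A B => A.IsNeg ∧ B.IsNeg
  | or A B => A.IsNeg ∧ B.IsNeg
  | all A => A.IsNeg
  | ex A => A.IsNeg
  | _ => True

/-- Bounded formulas, with quantifiers `∀ x < t` and `∃ x < t` only. -/
inductive IsBounded : Fml P → Prop
  | eq (s t : Tm) : IsBounded (eq s t)
  | ne (s t : Tm) : IsBounded (ne s t)
  | lt (s t : Tm) : IsBounded (lt s t)
  | nlt (s t : Tm) : IsBounded (nlt s t)
  | rel (p : P) (t : Tm) : IsBounded (rel p t)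
  | nrel (p : P) (t : Tm) : IsBounded (nrel p t)
  | and {A B : Fml P} : IsBounded A → IsBounded B → IsBounded (and A B)
  | or {A B : Fml P} : IsBounded A → IsBounded B → IsBounded (or A B)
  | ball (t : Tm) {A : Fml P} : IsBounded A → IsBounded (all (imp (lt (.var 0) t.shift) A))
  | bex (t : Tm) {A : Fml P} : IsBounded A → IsBounded (ex (and (lt (.var 0) t.shift) A))

/-- An arithmetical formula as a formula of an extended language. -/
def ofArith : Fml Empty → Fml P
  | eq s t => eq s t
  | ne s t => ne s t
  | lt s t => lt s t
  | nlt s t => nlt s t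
  | and A B => and (ofArith A) (ofArith B)
  | or A B => or (ofArith A) (ofArith B)
  | all A => all (ofArith A)
  | ex A => ex (ofArith A)

end Fml

/-! ## Provability -/

/-- Derivations from the axioms `T` in the one-sided sequent calculus for classical first-order
logic with cut. A sequent is a finite list of formulas, read disjunctively. Free variables in
axioms are read universally, so every substitution instance of an axiom may be used. -/
inductive Deriv {P : Type} (T : Set (Fml P)) : List (Fml P) → Prop
  | init (A : Fml P) (Γ : List (Fml P)) : A ∈ Γ → A.neg ∈ Γ → Deriv T Γ
  | ax (A : Fml P) (σ : ℕ → Tm) (Γ : List (Fml P)) : A ∈ T → A.subst σ ∈ Γ → Deriv T Γ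
  | and (A B : Fml P) (Γ : List (Fml P)) :
      Fml.and A B ∈ Γ → Deriv T (A :: Γ) → Deriv T (B :: Γ) → Deriv T Γ
  | or (A B : Fml P) (Γ : List (Fml P)) :
      Fml.or A B ∈ Γ → Deriv T (A :: B :: Γ) → Deriv T Γ
  | all (A : Fml P) (Γ : List (Fml P)) :
      Fml.all A ∈ Γ → Deriv T (A :: Γ.map Fml.shift) → Deriv T Γ
  | ex (A : Fml P) (t : Tm) (Γ : List (Fml P)) :
      Fml.ex A ∈ Γ → Deriv T (A.inst t :: Γ) → Deriv T Γ
  | cut (A : Fml P) (Γ : List (Fml P)) :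
      Deriv T (A :: Γ) → Deriv T (A.neg :: Γ) → Deriv T Γ

def Provable {P : Type} (T : Set (Fml P)) (A : Fml P) : Prop := Deriv T [A]

/-! ## Elementary recursive arithmetic -/

section
variable {P : Type}
open Tm Fml

/-- `θ(0) ∧ ∀ x (θ(x) → θ(x+1)) → ∀ y θ(y)`, where `x` is `var 0` in `θ` and the other variables
are parameters. -/
def indAx (θ : Fml P) : Fml P :=
  imp (and (θ.inst zero)
      (all (imp θ (θ.subst (scons (succ (var 0)) (fun i => var (i + 1)))))))
    (all θ)

inductive EqAx : Fml P → Prop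
  | refl : EqAx (eq (var 0) (var 0))
  | leibniz (s t : Tm) (A : Fml P) : EqAx (imp (eq s t) (imp (A.inst s) (A.inst t)))

inductive LtAx : Fml P → Prop
  | not_lt_zero : LtAx (nlt (var 0) zero)
  | lt_succ : LtAx (imp (lt (var 0) (succ (var 1))) (or (lt (var 0) (var 1)) (eq (var 0) (var 1))))
  | lt_succ_of : LtAx
      (imp (or (lt (var 0) (var 1)) (eq (var 0) (var 1))) (lt (var 0) (succ (var 1))))

/-- Defining axioms of the function symbols. -/
inductive FunAx : Fml P → Prop
  | succ_ne_zero : FunAx (ne (succ (var 0)) zero)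
  | succ_inj : FunAx (imp (eq (succ (var 0)) (succ (var 1))) (eq (var 0) (var 1)))
  | add_zero : FunAx (eq (add (var 0) zero) (var 0))
  | add_succ : FunAx (eq (add (var 0) (succ (var 1))) (succ (add (var 0) (var 1))))
  | sub_zero : FunAx (eq (sub (var 0) zero) (var 0))
  | zero_sub : FunAx (eq (sub zero (var 0)) zero)
  | succ_sub : FunAx (eq (sub (succ (var 0)) (succ (var 1))) (sub (var 0) (var 1)))
  | mul_zero : FunAx (eq (mul (var 0) zero) zero)
  | mul_succ : FunAx (eq (mul (var 0) (succ (var 1))) (add (mul (var 0) (var 1)) (var 0)))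
  | exp_zero : FunAx (eq (exp zero) (succ zero))
  | exp_succ : FunAx (eq (exp (succ (var 0))) (add (exp (var 0)) (exp (var 0))))
  | proj {n : ℕ} (i : Fin n) : FunAx (eq (fn (.proj i) (fun j => var j)) (var i))
  | comp {m n : ℕ} (f : ElemFun m) (g : Fin m → ElemFun n) :
      FunAx (eq (fn (.comp f g) (fun j => var j)) (fn f (fun i => fn (g i) (fun j => var j))))
  | brec_zero {n : ℕ} (g : ElemFun n) (h : ElemFun (n + 2)) (b : ElemFun (n + 1)) :
      FunAx (eq (fn (.brec g h b) (Matrix.vecCons zero (fun j => var j)))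
        (min (fn g (fun j => var j)) (fn b (Matrix.vecCons zero (fun j => var j)))))
  | brec_succ {n : ℕ} (g : ElemFun n) (h : ElemFun (n + 2)) (b : ElemFun (n + 1)) :
      FunAx (eq (fn (.brec g h b) (Matrix.vecCons (succ (var 0)) (fun j => var (j + 1))))
        (min
          (fn h (Matrix.vecCons (var 0) (Matrix.vecCons
            (fn (.brec g h b) (Matrix.vecCons (var 0) (fun j => var (j + 1))))
            (fun j => var (j + 1)))))
          (fn b (Matrix.vecCons (succ (var 0)) (fun j => var (j + 1))))))

/-- Axioms of `EA`; induction is restricted to bounded arithmetical formulas. -/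
inductive EAAx : Fml P → Prop
  | ofEq (A : Fml P) : EqAx A → EAAx A
  | ofLt (A : Fml P) : LtAx A → EAAx A
  | ofFun (A : Fml P) : FunAx A → EAAx A
  | ind (θ : Fml Empty) : θ.IsBounded → EAAx (indAx (ofArith θ))

end

/-! ## Inductive definitions by accessibility operators -/

/-- An operator `φ(X, x) ≡ ∀ y (θ(x, y) → t(x, y) ∈ X)` with `θ` a bounded arithmetical formula;
`y` is `var 0` and `x` is `var 1` in `θ` and `t`. -/
structure AccOp : Type where
  θ : Fml Empty
  t : Tm
  bounded : θ.IsBounded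
  θ_below : θ.Below 2
  t_below : t.Below 2

/-- Formulas of the language with a unary predicate constant `R_φ` for every operator `φ`. -/
abbrev IDFml : Type := Fml AccOp

section
open Tm Fml

/-- `φ(σ, x)`, with `x` as `var 0`, for a formula `σ(x)` with `x` as `var 0`. -/
def AccOp.app (φ : AccOp) (σ : IDFml) : IDFml :=
  all (imp (ofArith φ.θ) (σ.subst (scons φ.t (fun i => var (i + 2)))))

/-- `∀ x (φ(σ, x) → σ(x))`. -/
def AccOp.closed (φ : AccOp) (σ : IDFml) : IDFml := all (imp (φ.app σ) σ)

/-- Axioms of `(Θ, Γ)-ID(Acc)`: those of `EA`, complete induction for the formulas in `Θ`,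
closure of `R_φ` under `φ`, and induction on `R_φ` for the formulas `σ` in `Γ`:
`∀ u (R_φ(u) → ∀ x (φ(σ, x) → σ(x)) → σ(u))`. -/
inductive IDAx (Θ Γ : Set IDFml) : IDFml → Prop
  | ea (A : IDFml) : EAAx A → IDAx Θ Γ A
  | ind (θ : IDFml) : θ ∈ Θ → IDAx Θ Γ (indAx θ)
  | fix (φ : AccOp) : IDAx Θ Γ (φ.closed (rel φ (var 0)))
  | least (φ : AccOp) (σ : IDFml) : σ ∈ Γ →
      IDAx Θ Γ (all (imp (rel φ (var 0)) (imp (φ.closed σ).shift σ)))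

/-- The formulas `∀ y (θ(x, y) → t(x, y) ∈ R)`, `θ` bounded arithmetical, possibly with further
parameters. -/
def AccFml : Set IDFml :=
  {A | ∃ (θ : Fml Empty) (t : Tm) (φ : AccOp), θ.IsBounded ∧ A = all (imp (ofArith θ) (rel φ t))}

/-- Disjunctions of a negative and a positive formula. -/
def NegOrPos : Set IDFml := {A | ∃ D C : IDFml, D.IsNeg ∧ C.IsPos ∧ A = or D C}

/-- The theory `(Acc, N ∨ P)-ID(Acc)`. -/
def accIDTheory : Set IDFml := {A | IDAx AccFml NegOrPos A}

/-- The operator `∀ y (y < x → y ∈ X)` for the ordering `<` of `OT'(ϑ)`. -/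
def otAcc : AccOp where
  θ := ne (fn ElemFun.otLt ![var 0, var 1]) zero
  t := var 0
  bounded := .ne _ _
  θ_below := by
    refine ⟨fun i => ?_, fun i => i.elim0⟩
    fin_cases i
    · exact Nat.zero_lt_two
    · exact Nat.one_lt_two
  t_below := Nat.zero_lt_two

/-- `s ∈ W`, for the accessible part `W` of the ordering of `OT'(ϑ)`. -/
def inW (s : OTerm) : IDFml := rel otAcc (numeral s.code)

end

end WeakID

/-! Derivability is replaced by truth in models. A completeness theorem for the sequent calculus
(`provable_of_sat`), with equality interpreted as identity, reduces the claim to showing that every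
model of the theory satisfies it. The models may be nonstandard, so nothing about actual terms can
be used inside them. Instead, bounded induction yields the recursion equations of `K`, `<` and
normality for arbitrary elements of the model (`memK_iff`, `tLt_iff`, `isNF_iff`).

For a standard number `k`, let `S k` be the class of normal forms `Ω^k b_k + ⋯ + Ω b_1 + b_0` whose
coefficients lie in `W`. The claim follows from `ϑ(x) ∈ W` for all `x` in `S k`, and this rests on
two facts.

(1) Transfinite induction along `S k` (`S.induction`). It is proved by induction on `k` in the
metatheory: to pass from `k` to `k + 1`, one does induction along `W` on the leading coefficient `b`
of `Ω^(k+1) b + c`, quantifying over all tails `c`, and inside it induction along `S k` on the tail.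
The quantifier over tails leads out of the class `N ∨ P`, but not out of the class `AllNP` of
predicates `∀ y (D(x, y) ∨ C(x, y))` with `D` negative and `C` positive. This class is closed under
the operations needed: quantifiers are contracted by pairing, and the guard `x ∈ S k`, being
positive, goes into `D` when it is a premise. Hence the complexity does not grow with `k`. Induction
along `W` for `AllNP` is obtained in `AllNP.w_ind` by moving the quantifier `∀ y` into an inductive
definition. If pairs are compared by their first components only, then every pair `(x, y)` with `x ∈
W` is accessible, by induction for a positive formula, and induction on accessible pairs is needed
only for the matrix `D ∨ C`.

(2) Progressivity of `ϑ(x) ∈ W` along `S k` (`w_theta_of_forall`). All `z < ϑ(x)` are put into `W`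
by complete induction on the code of `z`, which is available because "all `z < ϑ(x)` with code below
`y` are in `W`" is an accessibility formula (`w_strong_induction`). Let `ϑ(b)` be the leading
summand of `z`. If `b < x` and `K(b) < ϑ(x)`, the members of `K(b)` have smaller codes, so they are
in `W`; as `b < x` bounds the exponents of `b`, it follows that `b` is in `S k`, and the hypothesis
on `x` applies. Otherwise `ϑ(b)` is at most a member of `K(x)`, and `K(x) ⊆ W`. Closure of `W` under
sums finishes the argument. Neither transitivity nor linearity of the ordering of notations is used.
-/

namespace WeakID

/-! ## Substitution -/

namespace Tm

theorem subst_subst (σ τ : ℕ → Tm) (t : Tm) :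
    (t.subst σ).subst τ = t.subst (fun i => (σ i).subst τ) := by
  induction t with
  | var i => rfl
  | fn f ts ih => simp only [subst, ih]

theorem subst_var (t : Tm) : t.subst var = t := by
  induction t with
  | var i => rfl
  | fn f ts ih => simp only [subst, ih]

theorem subst_congr {k : ℕ} {σ τ : ℕ → Tm} (t : Tm) (ht : t.Below k)
    (h : ∀ i < k, σ i = τ i) : t.subst σ = t.subst τ := by
  induction t with
  | var i => exact h i ht
  | fn f ts ih => simp only [subst, ih _ (ht _)]

theorem Below.mono {k k' : ℕ} (h : k ≤ k') {t : Tm} (ht : t.Below k) : t.Below k' := by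
  induction t with
  | var i => exact lt_of_lt_of_le (show i < k from ht) h
  | fn f ts ih => exact fun i => ih i (ht i)

theorem exists_below (t : Tm) : ∃ k, t.Below k := by
  induction t with
  | var i => exact ⟨i + 1, Nat.lt_succ_self i⟩
  | fn f ts ih =>
    choose k hk using ih
    exact ⟨Finset.univ.sup k, fun i => (hk i).mono (Finset.le_sup (Finset.mem_univ i))⟩

end Tm

theorem up_subst_up (σ τ : ℕ → Tm) :
    (fun i => (up σ i).subst (up τ)) = up (fun i => (σ i).subst τ) := by
  funext i
  cases i with
  | zero => rfl
  | succ i => simp only [up, scons, Tm.shift, Tm.subst_subst, Tm.subst]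

theorem up_var : up Tm.var = Tm.var := by
  funext i; cases i <;> rfl

namespace Fml

variable {P : Type}

theorem subst_subst (A : Fml P) (σ τ : ℕ → Tm) :
    (A.subst σ).subst τ = A.subst (fun i => (σ i).subst τ) := by
  induction A generalizing σ τ <;>
    simp_all only [subst, Tm.subst_subst, up_subst_up]

theorem subst_var (A : Fml P) : A.subst .var = A := by
  induction A <;> simp_all only [subst, Tm.subst_var, up_var]

theorem subst_neg (A : Fml P) (σ : ℕ → Tm) : A.neg.subst σ = (A.subst σ).neg := by
  induction A generalizing σ <;> simp_all only [subst, neg]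

theorem neg_neg (A : Fml P) : A.neg.neg = A := by
  induction A <;> simp_all only [neg]

theorem subst_congr {k : ℕ} {σ τ : ℕ → Tm} (A : Fml P) (hA : A.Below k)
    (h : ∀ i < k, σ i = τ i) : A.subst σ = A.subst τ := by
  have key : ∀ {k : ℕ} {σ τ : ℕ → Tm}, (∀ i < k, σ i = τ i) → ∀ i < k + 1, up σ i = up τ i := by
    intro k σ τ h i hi
    cases i with
    | zero => rfl
    | succ i => simp only [up, scons, h i (by omega)]
  induction A generalizing k σ τ with
  | eq s t => simp only [subst, s.subst_congr hA.1 h, t.subst_congr hA.2 h]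
  | ne s t => simp only [subst, s.subst_congr hA.1 h, t.subst_congr hA.2 h]
  | lt s t => simp only [subst, s.subst_congr hA.1 h, t.subst_congr hA.2 h]
  | nlt s t => simp only [subst, s.subst_congr hA.1 h, t.subst_congr hA.2 h]
  | rel p t => simp only [subst, t.subst_congr hA h]
  | nrel p t => simp only [subst, t.subst_congr hA h]
  | and A B ihA ihB => simp only [subst, ihA hA.1 h, ihB hA.2 h]
  | or A B ihA ihB => simp only [subst, ihA hA.1 h, ihB hA.2 h]
  | all A ih => simp only [subst, ih hA (key h)]
  | ex A ih => simp only [subst, ih hA (key h)]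

theorem Below.mono {k k' : ℕ} (h : k ≤ k') {A : Fml P} (hA : A.Below k) : A.Below k' := by
  induction A generalizing k k' with
  | eq s t => exact ⟨hA.1.mono h, hA.2.mono h⟩
  | ne s t => exact ⟨hA.1.mono h, hA.2.mono h⟩
  | lt s t => exact ⟨hA.1.mono h, hA.2.mono h⟩
  | nlt s t => exact ⟨hA.1.mono h, hA.2.mono h⟩
  | rel p t => exact Tm.Below.mono h hA
  | nrel p t => exact Tm.Below.mono h hA
  | and A B ihA ihB => exact ⟨ihA h hA.1, ihB h hA.2⟩
  | or A B ihA ihB => exact ⟨ihA h hA.1, ihB h hA.2⟩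
  | all A ih => exact ih (Nat.succ_le_succ h) hA
  | ex A ih => exact ih (Nat.succ_le_succ h) hA

theorem exists_below (A : Fml P) : ∃ k, A.Below k := by
  have two : ∀ s t : Tm, ∃ k, s.Below k ∧ t.Below k := fun s t => by
    obtain ⟨k, hk⟩ := s.exists_below
    obtain ⟨l, hl⟩ := t.exists_below
    exact ⟨max k l, hk.mono (le_max_left _ _), hl.mono (le_max_right _ _)⟩
  induction A with
  | eq s t => exact two s t
  | ne s t => exact two s t
  | lt s t => exact two s t
  | nlt s t => exact two s t
  | rel p t => exact t.exists_below
  | nrel p t => exact t.exists_below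
  | and A B ihA ihB =>
    obtain ⟨k, hk⟩ := ihA
    obtain ⟨l, hl⟩ := ihB
    exact ⟨max k l, hk.mono (le_max_left _ _), hl.mono (le_max_right _ _)⟩
  | or A B ihA ihB =>
    obtain ⟨k, hk⟩ := ihA
    obtain ⟨l, hl⟩ := ihB
    exact ⟨max k l, hk.mono (le_max_left _ _), hl.mono (le_max_right _ _)⟩
  | all A ih =>
    obtain ⟨k, hk⟩ := ih
    exact ⟨k, Below.mono (Nat.le_succ k) hk⟩
  | ex A ih =>
    obtain ⟨k, hk⟩ := ih
    exact ⟨k, Below.mono (Nat.le_succ k) hk⟩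

/-- Instantiating `var 0` cancels the shift that `up` applies to `σ`. The quantifier cases of the
truth lemma depend on this. -/
theorem subst_scons_subst (A : Fml P) (σ : ℕ → Tm) (t : Tm) :
    (A.subst (up σ)).inst t = A.subst (scons t σ) := by
  rw [inst, subst_subst]
  congr 1
  funext i
  cases i with
  | zero => rfl
  | succ i =>
    simp only [up, scons, Tm.shift, Tm.subst_subst, Tm.subst, Tm.subst_var]

theorem inst_subst (A : Fml P) (σ : ℕ → Tm) (t : Tm) :
    (A.inst t).subst σ = (A.subst (up σ)).inst (t.subst σ) := by
  rw [subst_scons_subst, inst, subst_subst]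
  congr 1
  funext i
  cases i <;> rfl

theorem shift_subst_up (A : Fml P) (σ : ℕ → Tm) :
    A.shift.subst (up σ) = (A.subst σ).shift := by
  rw [shift, shift, subst_subst, subst_subst]
  rfl

end Fml

/-! ## Structural rules -/

namespace Deriv

variable {P : Type} {T : Set (Fml P)}

/-- Every rule keeps its principal formula and asks only for membership, so sequents behave as sets;
exchange and contraction are included here. -/
theorem weaken {Γ Δ : List (Fml P)} (h : Deriv T Γ) (hs : Γ ⊆ Δ) : Deriv T Δ := by
  induction h generalizing Δ with
  | init A Γ h1 h2 => exact .init A Δ (hs h1) (hs h2)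
  | ax A σ Γ h1 h2 => exact .ax A σ Δ h1 (hs h2)
  | and A B Γ h _ _ ih1 ih2 =>
    exact .and A B Δ (hs h) (ih1 (List.cons_subset_cons _ hs)) (ih2 (List.cons_subset_cons _ hs))
  | or A B Γ h _ ih =>
    exact .or A B Δ (hs h) (ih (List.cons_subset_cons _ (List.cons_subset_cons _ hs)))
  | all A Γ h _ ih =>
    exact .all A Δ (hs h) (ih (List.cons_subset_cons _ (List.map_subset _ hs)))
  | ex A t Γ h _ ih => exact .ex A t Δ (hs h) (ih (List.cons_subset_cons _ hs))
  | cut A Γ _ _ ih1 ih2 =>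
    exact .cut A Δ (ih1 (List.cons_subset_cons _ hs)) (ih2 (List.cons_subset_cons _ hs))

theorem subst {Γ : List (Fml P)} (h : Deriv T Γ) (τ : ℕ → Tm) :
    Deriv T (Γ.map (Fml.subst τ)) := by
  induction h generalizing τ with
  | init A Γ h1 h2 =>
    refine .init (A.subst τ) _ (List.mem_map_of_mem h1) ?_
    rw [← Fml.subst_neg]
    exact List.mem_map_of_mem h2
  | ax A σ Γ h1 h2 =>
    refine .ax A (fun i => (σ i).subst τ) _ h1 ?_
    rw [← Fml.subst_subst]
    exact List.mem_map_of_mem h2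
  | and A B Γ h _ _ ih1 ih2 => exact .and _ _ _ (List.mem_map_of_mem h) (ih1 τ) (ih2 τ)
  | or A B Γ h _ ih => exact .or _ _ _ (List.mem_map_of_mem h) (ih τ)
  | all A Γ h _ ih =>
    refine .all _ _ (List.mem_map_of_mem h) ?_
    have e : (Γ.map (Fml.subst τ)).map Fml.shift = (Γ.map Fml.shift).map (Fml.subst (up τ)) := by
      simp only [List.map_map, Function.comp_def, Fml.shift_subst_up]
    rw [e]
    exact ih (up τ)
  | ex A t Γ h _ ih =>
    refine .ex _ (t.subst τ) _ (List.mem_map_of_mem h) ?_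
    rw [← Fml.inst_subst]
    exact ih τ
  | cut A Γ _ _ ih1 ih2 =>
    refine .cut (A.subst τ) _ (ih1 τ) ?_
    rw [← Fml.subst_neg]
    exact ih2 τ

/-- Generalization over a fresh variable. -/
theorem of_fresh {Γ : List (Fml P)} {A : Fml P} {k : ℕ} (hΓ : ∀ B ∈ Γ, B.Below k)
    (hA : (Fml.all A).Below k) (h : Deriv T (A.inst (.var k) :: Γ)) : Deriv T (.all A :: Γ) := by
  refine .all A _ (List.mem_cons_self) ?_
  -- `ρ` renames the fresh variable `k` to `0` and shifts all others. On formulas below `k` it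
  -- coincides with `shift`, and it turns `A(k)` back into `A`, which is the premise required by the
  -- rule for `∀`.
  let ρ : ℕ → Tm := fun i => if i = k then .var 0 else .var (i + 1)
  have h1 := h.subst ρ
  have e1 : (A.inst (.var k)).subst ρ = A := by
    conv_rhs => rw [← A.subst_var]
    rw [Fml.inst, Fml.subst_subst]
    refine Fml.subst_congr A hA (fun i hi => ?_)
    cases i with
    | zero => simp [scons, Tm.subst, ρ]
    | succ i => simp [scons, Tm.subst, ρ]; omega
  refine h1.weaken ?_
  rw [List.map_cons, e1]
  refine List.cons_subset_cons _ (fun B hB => ?_)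
  obtain ⟨C, hC, rfl⟩ := List.mem_map.1 hB
  refine List.mem_cons_of_mem _ (List.mem_map.2 ⟨C, hC, ?_⟩)
  refine Fml.subst_congr C (hΓ C hC) (fun i hi => ?_)
  simp [ρ, hi.ne]

end Deriv

/-! ## Semantics -/

/-- Structures for the language with predicate constants from `P`. -/
structure Mod (P : Type) where
  Carrier : Type
  fn : {k : ℕ} → ElemFun k → (Fin k → Carrier) → Carrier
  lt : Carrier → Carrier → Prop
  rel : P → Carrier → Prop

/-- The assignment `0 ↦ x`, `i + 1 ↦ e i`. -/
def vcons {α : Type} (x : α) (e : ℕ → α) : ℕ → α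
  | 0 => x
  | i + 1 => e i

@[simp] theorem vcons_zero {α : Type} (x : α) (e : ℕ → α) : vcons x e 0 = x := rfl
@[simp] theorem vcons_one {α : Type} (x : α) (e : ℕ → α) : vcons x e 1 = e 0 := rfl
@[simp] theorem vcons_ofNat {α : Type} (x : α) (e : ℕ → α) (i : ℕ) [i.AtLeastTwo] :
    vcons x e (ofNat(i) : ℕ) = e (i - 1) := by
  obtain ⟨j, rfl⟩ : ∃ j, i = j + 1 := ⟨i - 1, by have := Nat.AtLeastTwo.one_lt (n := i); omega⟩
  rfl
@[simp] theorem vcons_succ {α : Type} (x : α) (e : ℕ → α) (i : ℕ) : vcons x e (i + 1) = e i := rfl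

variable {P : Type} {M : Mod P}

def Tm.val (M : Mod P) (e : ℕ → M.Carrier) : Tm → M.Carrier
  | .var i => e i
  | .fn f ts => M.fn f (fun i => (ts i).val M e)

def Fml.Sat (M : Mod P) : (ℕ → M.Carrier) → Fml P → Prop
  | e, .eq s t => s.val M e = t.val M e
  | e, .ne s t => s.val M e ≠ t.val M e
  | e, .lt s t => M.lt (s.val M e) (t.val M e)
  | e, .nlt s t => ¬ M.lt (s.val M e) (t.val M e)
  | e, .rel p t => M.rel p (t.val M e)
  | e, .nrel p t => ¬ M.rel p (t.val M e)
  | e, .and A B => A.Sat M e ∧ B.Sat M e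
  | e, .or A B => A.Sat M e ∨ B.Sat M e
  | e, .all A => ∀ m, A.Sat M (vcons m e)
  | e, .ex A => ∃ m, A.Sat M (vcons m e)

theorem Tm.val_subst (e : ℕ → M.Carrier) (σ : ℕ → Tm) (t : Tm) :
    (t.subst σ).val M e = t.val M (fun i => (σ i).val M e) := by
  induction t with
  | var i => rfl
  | fn f ts ih => simp only [subst, val, ih]

theorem val_up (e : ℕ → M.Carrier) (σ : ℕ → Tm) (m : M.Carrier) :
    (fun i => (up σ i).val M (vcons m e)) = vcons m (fun i => (σ i).val M e) := by
  funext i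
  cases i with
  | zero => rfl
  | succ i => simp only [up, scons, Tm.shift, Tm.val_subst]; rfl

theorem val_scons (e : ℕ → M.Carrier) (σ : ℕ → Tm) (t : Tm) :
    (fun i => (scons t σ i).val M e) = vcons (t.val M e) (fun i => (σ i).val M e) := by
  funext i
  cases i <;> rfl

namespace Fml

theorem sat_subst (A : Fml P) (e : ℕ → M.Carrier) (σ : ℕ → Tm) :
    (A.subst σ).Sat M e ↔ A.Sat M (fun i => (σ i).val M e) := by
  induction A generalizing e σ <;>
    simp_all only [subst, Sat, Tm.val_subst, val_up]

theorem sat_neg (A : Fml P) (e : ℕ → M.Carrier) : A.neg.Sat M e ↔ ¬ A.Sat M e := by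
  induction A generalizing e with
  | and A B ihA ihB => simp only [neg, Sat, ihA, ihB]; tauto
  | or A B ihA ihB => simp only [neg, Sat, ihA, ihB]; tauto
  | all A ih => simp only [neg, Sat, ih, not_forall]
  | ex A ih => simp only [neg, Sat, ih, not_exists]
  | _ => simp [neg, Sat]

theorem sat_imp (A B : Fml P) (e : ℕ → M.Carrier) :
    (A.imp B).Sat M e ↔ (A.Sat M e → B.Sat M e) := by
  simp only [imp, Sat, sat_neg]; tauto

end Fml

/-! ## Countability of the language -/

section Countable

/-- Finite trees with nodes labelled by natural numbers. -/
abbrev LTree : Type := WType (fun a : ℕ × ℕ => Fin a.2)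

def LTree.node (l : ℕ) {k : ℕ} (cs : Fin k → LTree) : LTree := WType.mk (l, k) cs

theorem LTree.node_inj {l l' k : ℕ} {cs cs' : Fin k → LTree} :
    LTree.node l cs = LTree.node l' cs' ↔ l = l' ∧ cs = cs' := by
  constructor
  · intro h
    simp only [LTree.node] at h
    injection h with h1 h2
    simp only [Prod.mk.injEq, and_true] at h1
    subst h1
    exact ⟨rfl, h2⟩
  · rintro ⟨rfl, rfl⟩; rfl

/-- Trees built from different constructors are told apart by their labels; the number of children
recovers the inner arity of a composition. -/
theorem LTree.node_label {l l' k k' : ℕ} {cs : Fin k → LTree} {cs' : Fin k' → LTree}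
    (h : LTree.node l cs = LTree.node l' cs') : l = l' ∧ k = k' := by
  simp only [LTree.node] at h
  injection h with h1 h2
  simpa using h1

/-- The Henkin construction enumerates all formulas, so the language has to be countable. Symbols,
terms and formulas are embedded into the countable type of finite labelled trees. The arity `n` need
not be recorded, since injectivity is required only for fixed `n`. -/
def ElemFun.tree : {n : ℕ} → ElemFun n → LTree
  | _, .zero => .node 0 ![]
  | _, .succ => .node 1 ![]
  | _, .add => .node 2 ![]
  | _, .sub => .node 3 ![]
  | _, .mul => .node 4 ![]
  | _, .exp => .node 5 ![]
  | _, .proj i => .node 6 ![.node i ![]]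
  | _, .comp f g => .node 7 (Matrix.vecCons f.tree (fun i => (g i).tree))
  | _, .brec g h b => .node 8 ![g.tree, h.tree, b.tree]

theorem ElemFun.tree_injective {n : ℕ} : Function.Injective (ElemFun.tree (n := n)) := by
  intro f
  induction f with
  | proj i =>
    intro f' h
    cases f' with
    | proj j => simp [tree, LTree.node_inj] at h; rw [Fin.ext h]
    | _ => exact absurd (LTree.node_label h).1 (by decide)
  | comp f g ihf ihg =>
    intro f' h
    cases f' with
    | comp f' g' =>
      obtain rfl := Nat.succ_injective (LTree.node_label h).2
      simp only [tree, LTree.node_inj, true_and] at h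
      have h1 := congrFun h 0
      simp only [Matrix.cons_val_zero] at h1
      rw [ihf h1]
      congr 1
      funext i
      have h2 := congrFun h i.succ
      simp only [Matrix.cons_val_succ] at h2
      exact ihg i h2
    | _ => exact absurd (LTree.node_label h).1 (by decide)
  | brec g h b ihg ihh ihb =>
    intro f' h
    cases f' with
    | brec g' h' b' =>
      simp [tree, LTree.node_inj] at h
      rw [ihg h.1, ihh h.2.1, ihb h.2.2]
    | _ => exact absurd (LTree.node_label h).1 (by decide)
  | _ =>
    intro f' h
    cases f' <;> first | rfl | exact absurd (LTree.node_label h).1 (by decide)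

def Tm.tree : Tm → LTree
  | .var i => .node 0 ![.node i ![]]
  | .fn f ts => .node 1 (Matrix.vecCons f.tree (fun i => (ts i).tree))

theorem Tm.tree_injective : Function.Injective Tm.tree := by
  intro t
  induction t with
  | var i =>
    intro t' h
    cases t' with
    | var j => simp [tree, LTree.node_inj] at h; rw [h]
    | fn f ts => exact absurd (LTree.node_label h).1 (by decide)
  | fn f ts ih =>
    intro t' h
    cases t' with
    | var j => exact absurd (LTree.node_label h).1 (by decide)
    | fn f' ts' =>
      obtain rfl := Nat.succ_injective (LTree.node_label h).2
      simp only [tree, LTree.node_inj, true_and] at h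
      have h1 := congrFun h 0
      simp only [Matrix.cons_val_zero] at h1
      rw [ElemFun.tree_injective h1]
      congr 1
      funext i
      have h2 := congrFun h i.succ
      simp only [Matrix.cons_val_succ] at h2
      exact ih i h2

def Fml.tree (code : P → ℕ) : Fml P → LTree
  | .eq s t => .node 0 ![s.tree, t.tree]
  | .ne s t => .node 1 ![s.tree, t.tree]
  | .lt s t => .node 2 ![s.tree, t.tree]
  | .nlt s t => .node 3 ![s.tree, t.tree]
  | .rel p t => .node 4 ![.node (code p) ![], t.tree]
  | .nrel p t => .node 5 ![.node (code p) ![], t.tree]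
  | .and A B => .node 6 ![A.tree code, B.tree code]
  | .or A B => .node 7 ![A.tree code, B.tree code]
  | .all A => .node 8 ![A.tree code]
  | .ex A => .node 9 ![A.tree code]

theorem Fml.tree_injective {code : P → ℕ} (hc : Function.Injective code) :
    Function.Injective (Fml.tree code) := by
  intro A
  induction A <;> intro B h <;> cases B <;>
    first
    | (exfalso; revert h; simp [Fml.tree, LTree.node]; done)
    | (simp only [Fml.tree, LTree.node_inj, Matrix.vecCons_inj, true_and, and_true,
          Tm.tree_injective.eq_iff, hc.eq_iff] at h
       grind)

instance : Countable Tm := Tm.tree_injective.countable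

instance [Countable P] : Countable (Fml P) :=
  (Fml.tree_injective (exists_injective_nat P).choose_spec).countable

instance : Countable AccOp :=
  Function.Injective.countable (f := fun φ : AccOp => (φ.θ, φ.t)) (by
    rintro ⟨θ, t, _, _, _⟩ ⟨θ', t', _, _, _⟩ h
    simp only [Prod.mk.injEq] at h
    obtain ⟨rfl, rfl⟩ := h
    rfl)

end Countable

end WeakID

namespace WeakID

variable {P : Type} {T : Set (Fml P)}

/-! ## Completeness -/

section Henkin

theorem exists_below_list (Γ : List (Fml P)) : ∃ k, ∀ B ∈ Γ, B.Below k := by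
  induction Γ with
  | nil => exact ⟨0, by simp⟩
  | cons A Γ ih =>
    obtain ⟨k, hk⟩ := ih
    obtain ⟨l, hl⟩ := A.exists_below
    refine ⟨max k l, fun B hB => ?_⟩
    rcases List.mem_cons.1 hB with rfl | hB
    · exact hl.mono (le_max_right _ _)
    · exact (hk B hB).mono (le_max_left _ _)

/-- One step of the construction of a complete Henkin set of false formulas. -/
theorem henkin_step (A : Fml P) (Γ : List (Fml P)) (h : ¬ Deriv T Γ) :
    ∃ Δ : List (Fml P), ¬ Deriv T Δ ∧ Γ ⊆ Δ ∧ (A ∈ Δ ∨ A.neg ∈ Δ) ∧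
      ∀ B, A = .all B → A ∈ Δ → ∃ k, B.inst (.var k) ∈ Δ := by
  by_cases hA : Deriv T (A :: Γ)
  -- Underivability of the new sequent is the cut rule. The witness condition is vacuous here: if
  -- `A` occurred in the new sequent, weakening `hA` would derive it.
  · refine ⟨A.neg :: Γ, fun h' => h (.cut A Γ hA h'), List.subset_cons_self _ _,
      .inr List.mem_cons_self, fun B _ hm => absurd (hA.weaken ?_) (fun h' => h (.cut A Γ hA h'))⟩
    exact List.cons_subset.2 ⟨hm, List.subset_cons_self _ _⟩
  · by_cases hB : ∃ B, A = .all B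
    · obtain ⟨B, rfl⟩ := hB
      -- A false universal formula needs a false instance; a variable beyond all those in the
      -- sequent supplies it.
      obtain ⟨k, hk⟩ := exists_below_list (Fml.all B :: Γ)
      refine ⟨B.inst (.var k) :: .all B :: Γ, fun h' => hA ?_, ?_, ?_, ?_⟩
      · refine (Deriv.of_fresh (k := k) hk (hk _ List.mem_cons_self) h').weaken ?_
        exact List.cons_subset.2 ⟨List.mem_cons_self, List.Subset.refl _⟩
      · exact fun x hx => List.mem_cons_of_mem _ (List.mem_cons_of_mem _ hx)
      · exact .inl (List.mem_cons_of_mem _ List.mem_cons_self)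
      · rintro B' h1 -
        cases h1
        exact ⟨k, List.mem_cons_self⟩
    · exact ⟨A :: Γ, hA, List.subset_cons_self _ _, .inl List.mem_cons_self,
        fun B h1 => absurd ⟨B, h1⟩ hB⟩

/-- Complete Henkin sets of false formulas. -/
structure IsHenkin (T : Set (Fml P)) (S : Set (Fml P)) : Prop where
  con : ∀ Γ : List (Fml P), (∀ A ∈ Γ, A ∈ S) → ¬ Deriv T Γ
  mem_or : ∀ A : Fml P, A ∈ S ∨ A.neg ∈ S
  wit : ∀ B : Fml P, .all B ∈ S → ∃ k, B.inst (.var k) ∈ S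

/-- The set is the union of a chain of underivable sequents that starts with `[A]` and treats the
`n`-th formula at stage `n`. A finite list from the union is contained in a single stage, hence is
underivable by weakening. -/
theorem exists_henkin [Countable P] (A : Fml P) (h : ¬ Provable T A) :
    ∃ S, IsHenkin T S ∧ A ∈ S := by
  have : Nonempty (Fml P) := ⟨A⟩
  obtain ⟨en, hen⟩ := exists_surjective_nat (Fml P)
  choose next h1 h2 h3 h4 using fun (B : Fml P) (Γ : {Γ : List (Fml P) // ¬ Deriv T Γ}) =>
    henkin_step B Γ.1 Γ.2
  let G : ℕ → {Γ : List (Fml P) // ¬ Deriv T Γ} :=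
    fun n => Nat.rec ⟨[A], h⟩ (fun n Γ => ⟨next (en n) Γ, h1 (en n) Γ⟩) n
  have hstep : ∀ n, (G n).1 ⊆ (G (n + 1)).1 := fun n => h2 (en n) (G n)
  have hmono : ∀ m n, m ≤ n → (G m).1 ⊆ (G n).1 := by
    intro m n hmn
    induction hmn with
    | refl => exact List.Subset.refl _
    | step _ ih => exact List.Subset.trans ih (hstep _)
  have hfin : ∀ Γ : List (Fml P), (∀ B ∈ Γ, ∃ n, B ∈ (G n).1) → ∃ n, Γ ⊆ (G n).1 := by
    intro Γ
    induction Γ with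
    | nil => exact fun _ => ⟨0, List.nil_subset _⟩
    | cons B Γ ih =>
      intro hB
      obtain ⟨m, hm⟩ := ih (fun C hC => hB C (List.mem_cons_of_mem _ hC))
      obtain ⟨n, hn⟩ := hB B List.mem_cons_self
      exact ⟨max m n, List.cons_subset.2 ⟨hmono _ _ (le_max_right _ _) hn,
        List.Subset.trans hm (hmono _ _ (le_max_left _ _))⟩⟩
  have hcon : ∀ Γ : List (Fml P), (∀ B ∈ Γ, ∃ n, B ∈ (G n).1) → ¬ Deriv T Γ := by
    intro Γ hΓ hd
    obtain ⟨n, hn⟩ := hfin Γ hΓ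
    exact (G n).2 (hd.weaken hn)
  refine ⟨{B | ∃ n, B ∈ (G n).1}, ⟨hcon, fun B => ?_, fun B ⟨n, hB⟩ => ?_⟩, 0, List.mem_singleton.2 rfl⟩
  · obtain ⟨n, rfl⟩ := hen B
    exact (h3 (en n) (G n)).imp (fun h => ⟨n + 1, h⟩) (fun h => ⟨n + 1, h⟩)
  · obtain ⟨m, hm⟩ := hen (.all B)
    rcases h3 (en m) (G m) with h5 | h5
    · obtain ⟨k, hk⟩ := h4 (en m) (G m) B hm h5
      exact ⟨k, m + 1, hk⟩
    · exfalso
      refine hcon [.all B, (Fml.all B).neg] ?_ (.init (.all B) _ (by simp) (by simp))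
      simp only [List.mem_cons, List.not_mem_nil, or_false, forall_eq_or_imp, forall_eq]
      exact ⟨⟨n, hB⟩, m + 1, hm ▸ h5⟩

/-! ### Truth conditions in Henkin sets and the term model -/

namespace IsHenkin

variable {S : Set (Fml P)} (hS : IsHenkin T S)
include hS

theorem neg_mem (A : Fml P) : A.neg ∈ S ↔ A ∉ S := by
  constructor
  · intro h1 h2
    exact hS.con [A, A.neg] (by simp [h1, h2]) (.init A _ (by simp) (by simp))
  · exact fun h => (hS.mem_or A).resolve_left h

theorem and_mem (A B : Fml P) : .and A B ∈ S ↔ A ∈ S ∨ B ∈ S := by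
  constructor
  · intro h
    by_contra! h1
    rw [← hS.neg_mem, ← hS.neg_mem] at h1
    refine hS.con [.and A B, A.neg, B.neg] (by simp [h, h1]) (.and A B _ (by simp) ?_ ?_)
    · exact .init A _ (by simp) (by simp)
    · exact .init B _ (by simp) (by simp)
  · intro h
    by_contra h1
    rw [← hS.neg_mem, Fml.neg] at h1
    rcases h with h | h
    · exact hS.con [A, .or A.neg B.neg] (by simpa [h] using h1)
        (.or A.neg B.neg _ (by simp) (.init A _ (by simp) (by simp)))
    · exact hS.con [B, .or A.neg B.neg] (by simpa [h] using h1)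
        (.or A.neg B.neg _ (by simp) (.init B _ (by simp) (by simp)))

theorem or_mem (A B : Fml P) : .or A B ∈ S ↔ A ∈ S ∧ B ∈ S := by
  have h := hS.and_mem A.neg B.neg
  rw [hS.neg_mem, hS.neg_mem, ← not_and_or, ← not_iff_not, not_not, ← hS.neg_mem] at h
  simpa only [Fml.neg, Fml.neg_neg] using h

/-- Members of `S` are read as false. From right to left: if `∃` were not in `S`, the dual universal
formula would be, and its witness would be an instance of `A` outside `S`. -/
theorem ex_mem (A : Fml P) : .ex A ∈ S ↔ ∀ t, A.inst t ∈ S := by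
  constructor
  · intro h t
    by_contra h1
    rw [← hS.neg_mem] at h1
    exact hS.con [.ex A, (A.inst t).neg] (by simp [h, h1])
      (.ex A t _ (by simp) (.init (A.inst t) _ (by simp) (by simp)))
  · intro h
    by_contra h1
    rw [← hS.neg_mem] at h1
    obtain ⟨k, hk⟩ := hS.wit _ h1
    rw [Fml.inst, Fml.subst_neg, hS.neg_mem] at hk
    exact hk (h _)

theorem all_mem (A : Fml P) : .all A ∈ S ↔ ∃ t, A.inst t ∈ S := by
  have h := hS.ex_mem A.neg
  simp only [Fml.inst, Fml.subst_neg, hS.neg_mem] at h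
  rw [← not_iff_not, ← hS.neg_mem]
  simpa [Fml.neg, Fml.inst] using h

theorem ax_notMem {A : Fml P} (hA : A ∈ T) (σ : ℕ → Tm) : A.subst σ ∉ S :=
  fun h => hS.con [A.subst σ] (by simp [h]) (.ax A σ _ hA (by simp))

theorem imp_notMem {A B : Fml P} (h : A.imp B ∉ S) (hA : A ∉ S) : B ∉ S := by
  rw [Fml.imp, hS.or_mem, hS.neg_mem] at h
  exact fun hB => h ⟨hA, hB⟩

variable (hT : ∀ A, EqAx A → A ∈ T)
include hT

theorem leibniz {s t : Tm} (A : Fml P) (h : .eq s t ∉ S) (hA : A.inst s ∉ S) : A.inst t ∉ S := by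
  have h1 := hS.ax_notMem (hT _ (.leibniz s t A)) .var
  rw [Fml.subst_var] at h1
  exact hS.imp_notMem (hS.imp_notMem h1 h) hA

theorem eq_refl (s : Tm) : .eq s s ∉ S := hS.ax_notMem (hT _ .refl) (fun _ => s)

theorem eq_symm {s t : Tm} (h : .eq s t ∉ S) : .eq t s ∉ S := by
  have h1 := hS.leibniz hT (.eq (.var 0) s.shift) h
  simp only [Fml.inst, Fml.subst, Tm.shift, Tm.subst_subst, Tm.subst, scons, Tm.subst_var] at h1
  exact h1 (hS.eq_refl hT s)

theorem eq_trans {s t u : Tm} (h : .eq s t ∉ S) (h' : .eq t u ∉ S) : .eq s u ∉ S := by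
  have h1 := hS.leibniz hT (.eq s.shift (.var 0)) h'
  simp only [Fml.inst, Fml.subst, Tm.shift, Tm.subst_subst, Tm.subst, scons, Tm.subst_var] at h1
  exact h1 h

def setoid : Setoid Tm where
  r s t := .eq s t ∉ S
  iseqv := ⟨hS.eq_refl hT, hS.eq_symm hT, hS.eq_trans hT⟩

theorem eq_update {k : ℕ} (f : ElemFun k) (ts : Fin k → Tm) (i : Fin k) {t : Tm}
    (h : .eq (ts i) t ∉ S) : .eq (.fn f ts) (.fn f (Function.update ts i t)) ∉ S := by
  have h1 := hS.leibniz hT (.eq (Tm.fn f ts).shift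
    (.fn f (Function.update (fun j => (ts j).shift) i (.var 0)))) h
  have e : ∀ u : Tm, (Fml.eq (P := P) (Tm.fn f ts).shift
      (.fn f (Function.update (fun j => (ts j).shift) i (.var 0)))).inst u =
      .eq (.fn f ts) (.fn f (Function.update ts i u)) := by
    intro u
    simp only [Fml.inst, Fml.subst, Tm.shift, Tm.subst_subst, Tm.subst, scons, Tm.subst_var]
    congr 2
    funext j
    by_cases hj : j = i
    · subst hj; simp [Tm.subst, scons]
    · simp [hj, Tm.subst_subst, Tm.subst, scons, Tm.subst_var]
  rw [e, e] at h1
  refine h1 ?_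
  rw [Function.update_eq_self]
  exact hS.eq_refl hT _

/-- The Leibniz axioms change one argument at a time; the induction is on the set of positions
already changed. -/
theorem eq_fn {k : ℕ} (f : ElemFun k) (ts us : Fin k → Tm) (h : ∀ i, .eq (ts i) (us i) ∉ S) :
    .eq (.fn f ts) (.fn f us) ∉ S := by
  suffices ∀ s : Finset (Fin k), .eq (.fn f ts) (.fn f (s.piecewise us ts)) ∉ S by
    simpa using this Finset.univ
  intro s
  induction s using Finset.induction_on with
  | empty => simpa using hS.eq_refl hT _
  | insert i s hi ih =>
    refine hS.eq_trans hT ih ?_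
    rw [Finset.piecewise_insert]
    refine hS.eq_update hT _ _ _ ?_
    simpa [hi] using h i

/-- The term model. -/
noncomputable def model : Mod P where
  Carrier := Quotient (hS.setoid hT)
  fn f xs := Quotient.mk _ (.fn f (fun i => (xs i).out))
  lt x y := .lt x.out y.out ∉ S
  rel p x := .rel p x.out ∉ S

/-- The element of the term model denoted by a term. -/
def cls (t : Tm) : (hS.model hT).Carrier := Quotient.mk (hS.setoid hT) t

theorem cls_eq {s t : Tm} : hS.cls hT s = hS.cls hT t ↔ .eq s t ∉ S :=
  Quotient.eq (r := hS.setoid hT)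

theorem exists_cls (m : (hS.model hT).Carrier) : ∃ t, hS.cls hT t = m := Quotient.exists_rep m

theorem vcons_cls (t : Tm) (σ : ℕ → Tm) : vcons (hS.cls hT t) (fun i => hS.cls hT (σ i)) =
    fun i => hS.cls hT (scons t σ i) := by
  funext i; cases i <;> rfl

theorem val_model (σ : ℕ → Tm) (t : Tm) :
    t.val (hS.model hT) (fun i => hS.cls hT (σ i)) = hS.cls hT (t.subst σ) := by
  induction t with
  | var i => rfl
  | fn f ts ih =>
    simp only [Tm.val, ih, Tm.subst]
    refine Quotient.sound (hS.eq_fn hT f _ _ (fun i => ?_))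
    exact Quotient.mk_out (s := hS.setoid hT) _

theorem rel_congr {s t : Tm} (h : .eq s t ∉ S) (p : P) : .rel p s ∉ S ↔ .rel p t ∉ S :=
  ⟨hS.leibniz hT (.rel p (.var 0)) h, hS.leibniz hT (.rel p (.var 0)) (hS.eq_symm hT h)⟩

theorem lt_congr {s t s' t' : Tm} (h : .eq s t ∉ S) (h' : .eq s' t' ∉ S) :
    .lt s s' ∉ S ↔ .lt t t' ∉ S := by
  have key : ∀ {s t s' t' : Tm}, .eq s t ∉ S → .eq s' t' ∉ S → .lt s s' ∉ S → .lt t t' ∉ S := by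
    intro s t s' t' h h' h1
    have h2 := hS.leibniz hT (.lt (.var 0) s'.shift) h
    have h3 := hS.leibniz hT (.lt t.shift (.var 0)) h'
    simp only [Fml.inst, Fml.subst, Tm.shift, Tm.subst_subst, Tm.subst, scons,
      Tm.subst_var] at h2 h3
    exact h3 (h2 h1)
  exact ⟨key h h', key (hS.eq_symm hT h) (hS.eq_symm hT h')⟩

/-- The truth lemma: truth is non-membership in `S`. Every element is the class of a term, so
assignments can be given as substitutions, and a quantifier over elements becomes one over
instances. -/
theorem sat_model (A : Fml P) (σ : ℕ → Tm) :
    A.Sat (hS.model hT) (fun i => hS.cls hT (σ i)) ↔ A.subst σ ∉ S := by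
  have hl : ∀ s t : Tm, ((hS.model hT).lt (hS.cls hT s) (hS.cls hT t) ↔ .lt s t ∉ S) :=
    fun s t => hS.lt_congr hT (Quotient.mk_out (s := hS.setoid hT) s)
      (Quotient.mk_out (s := hS.setoid hT) t)
  have hr : ∀ p t, ((hS.model hT).rel p (hS.cls hT t) ↔ .rel p t ∉ S) :=
    fun p t => hS.rel_congr hT (Quotient.mk_out (s := hS.setoid hT) t) p
  induction A generalizing σ with
  | eq s t => simp only [Fml.Sat, val_model, cls_eq, Fml.subst]
  | ne s t => simp only [Fml.Sat, val_model, ne_eq, cls_eq, Fml.subst, ← hS.neg_mem]; rfl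
  | lt s t => simp only [Fml.Sat, val_model, hl, Fml.subst]
  | nlt s t => simp only [Fml.Sat, val_model, hl, Fml.subst, ← hS.neg_mem]; rfl
  | rel p t => simp only [Fml.Sat, val_model, hr, Fml.subst]
  | nrel p t => simp only [Fml.Sat, val_model, hr, Fml.subst, ← hS.neg_mem]; rfl
  | and A B ihA ihB => simp only [Fml.Sat, ihA, ihB, Fml.subst, hS.and_mem, not_or]
  | or A B ihA ihB => simp only [Fml.Sat, ihA, ihB, Fml.subst, hS.or_mem, not_and_or]
  | all A ih =>
    simp only [Fml.Sat, Fml.subst, hS.all_mem, not_exists]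
    refine ⟨fun h t => ?_, fun h m => ?_⟩
    · rw [Fml.subst_scons_subst]
      refine (ih _).1 ?_
      rw [← hS.vcons_cls hT]
      exact h _
    · obtain ⟨t, rfl⟩ := hS.exists_cls hT m
      rw [hS.vcons_cls hT]
      refine (ih _).2 ?_
      rw [← Fml.subst_scons_subst]
      exact h t
  | ex A ih =>
    simp only [Fml.Sat, Fml.subst, hS.ex_mem, not_forall]
    refine ⟨fun ⟨m, h⟩ => ?_, fun ⟨t, h⟩ => ⟨hS.cls hT t, ?_⟩⟩
    · obtain ⟨t, rfl⟩ := hS.exists_cls hT m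
      rw [hS.vcons_cls hT] at h
      refine ⟨t, ?_⟩
      rw [Fml.subst_scons_subst]
      exact (ih _).1 h
    · rw [hS.vcons_cls hT]
      refine (ih _).2 ?_
      rw [← Fml.subst_scons_subst]
      exact h

end IsHenkin

/-- Completeness theorem for theories containing the equality axioms, with equality interpreted
as identity. -/
theorem provable_of_sat [Countable P] (hT : ∀ A, EqAx A → A ∈ T) (A : Fml P)
    (h : ∀ M : Mod P, (∀ B ∈ T, ∀ e, B.Sat M e) → ∀ e, A.Sat M e) : Provable T A := by
  by_contra hA
  obtain ⟨S, hS, hAS⟩ := exists_henkin A hA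
  have h1 := h (hS.model hT) (fun B hB e => by
    have he : e = fun i => hS.cls hT (e i).out :=
      funext fun i => (Quotient.out_eq (e i)).symm
    rw [he, hS.sat_model hT]
    exact hS.ax_notMem hB _) (fun i => hS.cls hT (.var i))
  rw [hS.sat_model hT, Fml.subst_var] at h1
  exact h1 hAS

end Henkin

end WeakID

namespace WeakID

/-! ## Arithmetic in models of `EA` -/

/-- Models of `EA`, possibly with further predicates. -/
structure ArithModel (P : Type) extends Mod P where
  ea : ∀ A : Fml P, EAAx A → ∀ e, A.Sat toMod e

namespace ArithModel

open Tm Fml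

variable {P : Type} (M : ArithModel P)

theorem val_vecCons (N : Mod P) {k : ℕ} (e : ℕ → N.Carrier) (t : Tm) (ts : Fin k → Tm) :
    (fun i => (Matrix.vecCons t ts i).val N e) =
      Matrix.vecCons (t.val N e) (fun i => (ts i).val N e) := by
  funext i
  refine Fin.cases ?_ (fun i => ?_) i <;> simp

theorem val_vecEmpty (N : Mod P) (e : ℕ → N.Carrier) :
    (fun i => (Matrix.vecEmpty (α := Tm) i).val N e) = ![] := Subsingleton.elim _ _

instance : Zero M.Carrier := ⟨M.fn .zero ![]⟩
instance : Add M.Carrier := ⟨fun x y => M.fn .add ![x, y]⟩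
instance : Sub M.Carrier := ⟨fun x y => M.fn .sub ![x, y]⟩
instance : Mul M.Carrier := ⟨fun x y => M.fn .mul ![x, y]⟩
instance : LT M.Carrier := ⟨M.lt⟩
instance : Inhabited M.Carrier := ⟨0⟩

variable {M}

def sc (x : M.Carrier) : M.Carrier := M.fn .succ ![x]
/-- The exponential function with base two. -/
def pow2 (x : M.Carrier) : M.Carrier := M.fn .exp ![x]

section
variable (e : ℕ → M.Carrier) (s t : Tm)
@[simp] theorem val_zero : Tm.zero.val M.toMod e = 0 := by
  simp only [Tm.zero, Tm.val, val_vecEmpty]; rfl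
@[simp] theorem val_succ : (Tm.succ s).val M.toMod e = sc (s.val M.toMod e) := by
  simp only [Tm.succ, Tm.val, val_vecCons, val_vecEmpty]; rfl
@[simp] theorem val_add : (Tm.add s t).val M.toMod e = s.val M.toMod e + t.val M.toMod e := by
  simp only [Tm.add, Tm.val, val_vecCons, val_vecEmpty]; rfl
@[simp] theorem val_sub : (Tm.sub s t).val M.toMod e = s.val M.toMod e - t.val M.toMod e := by
  simp only [Tm.sub, Tm.val, val_vecCons, val_vecEmpty]; rfl
@[simp] theorem val_mul : (Tm.mul s t).val M.toMod e = s.val M.toMod e * t.val M.toMod e := by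
  simp only [Tm.mul, Tm.val, val_vecCons, val_vecEmpty]; rfl
@[simp] theorem val_exp : (Tm.exp s).val M.toMod e = pow2 (s.val M.toMod e) := by
  simp only [Tm.exp, Tm.val, val_vecCons, val_vecEmpty]; rfl
@[simp] theorem val_var (i : ℕ) : (Tm.var i).val M.toMod e = e i := rfl
@[simp] theorem val_shift (x : M.Carrier) : s.shift.val M.toMod (vcons x e) = s.val M.toMod e := by
  rw [Tm.shift, Tm.val_subst]; rfl
@[simp] theorem sat_eq : (Fml.eq s t : Fml P).Sat M.toMod e ↔ s.val M.toMod e = t.val M.toMod e :=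
  Iff.rfl
@[simp] theorem sat_ne : (Fml.ne s t : Fml P).Sat M.toMod e ↔ s.val M.toMod e ≠ t.val M.toMod e :=
  Iff.rfl
@[simp] theorem sat_lt : (Fml.lt s t : Fml P).Sat M.toMod e ↔ s.val M.toMod e < t.val M.toMod e :=
  Iff.rfl
@[simp] theorem sat_nlt :
    (Fml.nlt s t : Fml P).Sat M.toMod e ↔ ¬ s.val M.toMod e < t.val M.toMod e := Iff.rfl
@[simp] theorem sat_rel (p : P) :
    (Fml.rel p t : Fml P).Sat M.toMod e ↔ M.rel p (t.val M.toMod e) := Iff.rfl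
variable (A B : Fml P)
@[simp] theorem sat_and : (Fml.and A B).Sat M.toMod e ↔ A.Sat M.toMod e ∧ B.Sat M.toMod e := Iff.rfl
@[simp] theorem sat_or : (Fml.or A B).Sat M.toMod e ↔ A.Sat M.toMod e ∨ B.Sat M.toMod e := Iff.rfl
@[simp] theorem sat_all : (Fml.all A).Sat M.toMod e ↔ ∀ x, A.Sat M.toMod (vcons x e) := Iff.rfl
@[simp] theorem sat_ex : (Fml.ex A).Sat M.toMod e ↔ ∃ x, A.Sat M.toMod (vcons x e) := Iff.rfl
end

attribute [simp] Fml.sat_imp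

theorem sat_inst (A : Fml P) (e : ℕ → M.Carrier) (t : Tm) :
    (A.inst t).Sat M.toMod e ↔ A.Sat M.toMod (vcons (t.val M.toMod e) e) := by
  rw [Fml.inst, Fml.sat_subst, val_scons]; rfl

theorem sat_indAx (A : Fml P) (e : ℕ → M.Carrier) : (indAx A).Sat M.toMod e ↔
    (A.Sat M.toMod (vcons 0 e) → (∀ x, A.Sat M.toMod (vcons x e) → A.Sat M.toMod (vcons (sc x) e)) →
      ∀ x, A.Sat M.toMod (vcons x e)) := by
  simp only [indAx, sat_imp, sat_and, sat_inst, sat_all, Fml.sat_subst, val_scons, val_zero,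
    val_succ, val_var, and_imp, vcons_zero, vcons_succ]

/-- Induction for bounded arithmetical formulas. -/
theorem ind (θ : Fml Empty) (hθ : θ.IsBounded) (e : ℕ → M.Carrier)
    (h0 : (ofArith θ : Fml P).Sat M.toMod (vcons 0 e))
    (h1 : ∀ x, (ofArith θ : Fml P).Sat M.toMod (vcons x e) →
      (ofArith θ : Fml P).Sat M.toMod (vcons (sc x) e)) (x : M.Carrier) :
    (ofArith θ : Fml P).Sat M.toMod (vcons x e) :=
  (sat_indAx _ _).1 (M.ea _ (.ind θ hθ) e) h0 h1 x

local notation "env" "[" x "]" => vcons x (fun _ => default)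

attribute [local simp] ofArith

/-! ### Elementary arithmetic from bounded induction -/

section Peano

theorem sc_ne_zero (x : M.Carrier) : sc x ≠ 0 := by
  simpa using M.ea _ (.ofFun _ .succ_ne_zero) (env[x])
protected theorem add_zero' (x : M.Carrier) : x + 0 = x := by
  simpa using M.ea _ (.ofFun _ .add_zero) (env[x])
theorem add_sc (x y : M.Carrier) : x + sc y = sc (x + y) := by
  simpa using M.ea _ (.ofFun _ .add_succ) (vcons x (env[y]))
protected theorem sub_zero' (x : M.Carrier) : x - 0 = x := by
  simpa using M.ea _ (.ofFun _ .sub_zero) (env[x])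
protected theorem zero_sub' (x : M.Carrier) : 0 - x = 0 := by
  simpa using M.ea _ (.ofFun _ .zero_sub) (env[x])
theorem sc_sub_sc (x y : M.Carrier) : sc x - sc y = x - y := by
  simpa using M.ea _ (.ofFun _ .succ_sub) (vcons x (env[y]))
protected theorem mul_zero' (x : M.Carrier) : x * 0 = 0 := by
  simpa using M.ea _ (.ofFun _ .mul_zero) (env[x])
theorem mul_sc (x y : M.Carrier) : x * sc y = x * y + x := by
  simpa using M.ea _ (.ofFun _ .mul_succ) (vcons x (env[y]))
theorem pow2_zero' : pow2 (0 : M.Carrier) = sc 0 := by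
  simpa using M.ea _ (.ofFun _ .exp_zero) (fun _ => default)
theorem pow2_sc (x : M.Carrier) : pow2 (sc x) = pow2 x + pow2 x := by
  simpa using M.ea _ (.ofFun _ .exp_succ) (env[x])
protected theorem not_lt_zero' (x : M.Carrier) : ¬ x < 0 := by
  simpa using M.ea _ (.ofLt _ .not_lt_zero) (env[x])
theorem lt_sc {x y : M.Carrier} : x < sc y ↔ x < y ∨ x = y := by
  have h1 := M.ea _ (.ofLt _ .lt_succ) (vcons x (env[y]))
  have h2 := M.ea _ (.ofLt _ .lt_succ_of) (vcons x (env[y]))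
  simp only [sat_imp, sat_lt, sat_or, sat_eq, val_var, val_succ, vcons_zero, vcons_one] at h1 h2
  exact ⟨h1, h2⟩

protected theorem zero_add' (x : M.Carrier) : 0 + x = x := by
  have := ind (.eq (.add .zero (.var 0)) (.var 0)) (.eq _ _) (fun _ => (default : M.Carrier))
  simp at this
  exact this (ArithModel.add_zero' 0) (fun x h => by rw [add_sc, h]) x

theorem sc_add (x y : M.Carrier) : sc x + y = sc (x + y) := by
  have := ind (.eq (.add (.succ (.var 1)) (.var 0)) (.succ (.add (.var 1) (.var 0))))
    (.eq _ _) (env[x])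
  simp at this
  exact this (by rw [ArithModel.add_zero', ArithModel.add_zero'])
    (fun y h => by rw [add_sc, h, add_sc]) y

protected theorem add_comm' (x y : M.Carrier) : x + y = y + x := by
  have := ind (.eq (.add (.var 1) (.var 0)) (.add (.var 0) (.var 1))) (.eq _ _) (env[x])
  simp at this
  exact this (by rw [ArithModel.add_zero', ArithModel.zero_add'])
    (fun y h => by rw [add_sc, h, sc_add]) y

protected theorem add_assoc' (x y z : M.Carrier) : x + y + z = x + (y + z) := by
  have := ind (.eq (.add (.add (.var 1) (.var 2)) (.var 0))
    (.add (.var 1) (.add (.var 2) (.var 0)))) (.eq _ _) (vcons x (env[y]))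
  simp at this
  exact this (by simp only [ArithModel.add_zero'])
    (fun y h => by simp only [add_sc, h]) z

protected theorem zero_mul' (x : M.Carrier) : 0 * x = 0 := by
  have := ind (.eq (.mul .zero (.var 0)) .zero) (.eq _ _) (fun _ => (default : M.Carrier))
  simp at this
  exact this (ArithModel.mul_zero' 0) (fun x h => by rw [mul_sc, h, ArithModel.add_zero']) x

theorem sc_mul (x y : M.Carrier) : sc x * y = x * y + y := by
  have := ind (.eq (.mul (.succ (.var 1)) (.var 0)) (.add (.mul (.var 1) (.var 0)) (.var 0)))
    (.eq _ _) (env[x])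
  simp at this
  refine this (by simp only [ArithModel.mul_zero', ArithModel.add_zero']) (fun y h => ?_) y
  rw [mul_sc, mul_sc, h, add_sc, add_sc, ArithModel.add_assoc', ArithModel.add_comm' y x,
    ← ArithModel.add_assoc']

protected theorem mul_comm' (x y : M.Carrier) : x * y = y * x := by
  have := ind (.eq (.mul (.var 1) (.var 0)) (.mul (.var 0) (.var 1))) (.eq _ _) (env[x])
  simp at this
  exact this (by rw [ArithModel.mul_zero', ArithModel.zero_mul'])
    (fun y h => by rw [mul_sc, h, sc_mul]) y

protected theorem mul_add' (x y z : M.Carrier) : x * (y + z) = x * y + x * z := by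
  have := ind (.eq (.mul (.var 1) (.add (.var 2) (.var 0)))
    (.add (.mul (.var 1) (.var 2)) (.mul (.var 1) (.var 0)))) (.eq _ _) (vcons x (env[y]))
  simp at this
  exact this (by simp only [ArithModel.add_zero', ArithModel.mul_zero'])
    (fun y h => by simp only [add_sc, mul_sc, h, ArithModel.add_assoc']) z

protected theorem mul_assoc' (x y z : M.Carrier) : x * y * z = x * (y * z) := by
  have := ind (.eq (.mul (.mul (.var 1) (.var 2)) (.var 0))
    (.mul (.var 1) (.mul (.var 2) (.var 0)))) (.eq _ _) (vcons x (env[y]))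
  simp at this
  exact this (by simp only [ArithModel.mul_zero'])
    (fun y h => by simp only [mul_sc, h, ArithModel.mul_add']) z

protected theorem lt_trans' {x y z : M.Carrier} (h : x < y) (h' : y < z) : x < z := by
  have := ind (imp (.lt (.var 2) (.var 0)) (.lt (.var 1) (.var 0)))
    (.or (.nlt _ _) (.lt _ _)) (vcons x (env[y]))
  simp [imp, Fml.neg, ← imp_iff_not_or] at this
  refine this (fun h => absurd h (ArithModel.not_lt_zero' _)) (fun z ih h2 => ?_) z h'
  rcases lt_sc.1 h2 with h2 | rfl
  · exact lt_sc.2 (.inl (ih h2))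
  · exact lt_sc.2 (.inl h)

theorem lt_sc_self (x : M.Carrier) : x < sc x := lt_sc.2 (.inr rfl)

protected theorem lt_irrefl' (x : M.Carrier) : ¬ x < x := by
  have := ind (.nlt (.var 0) (.var 0)) (.nlt _ _) (fun _ => (default : M.Carrier))
  simp at this
  refine this (ArithModel.not_lt_zero' 0) (fun x ih h => ?_) x
  rcases lt_sc.1 h with h | h
  · exact ih (ArithModel.lt_trans' (lt_sc_self x) h)
  · have := lt_sc_self x
    rw [h] at this
    exact ih this

theorem sc_lt_sc {x y : M.Carrier} (h : x < y) : sc x < sc y := by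
  have := ind (imp (.lt (.var 1) (.var 0)) (.lt (.succ (.var 1)) (.succ (.var 0))))
    (.or (.nlt _ _) (.lt _ _)) (env[x])
  simp [imp, Fml.neg, ← imp_iff_not_or] at this
  refine this (fun h => absurd h (ArithModel.not_lt_zero' _)) (fun z ih h2 => ?_) y h
  rcases lt_sc.1 h2 with h2 | rfl
  · exact lt_sc.2 (.inl (ih h2))
  · exact lt_sc_self _

protected theorem zero_lt_or_eq (x : M.Carrier) : 0 < x ∨ 0 = x := by
  have := ind (.or (.lt .zero (.var 0)) (.eq .zero (.var 0)))
    (.or (.lt _ _) (.eq _ _)) (fun _ => (default : M.Carrier))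
  simp at this
  exact this (fun x ih => .inl (lt_sc.2 ih)) x

protected theorem lt_trichotomy' (x y : M.Carrier) : x < y ∨ x = y ∨ y < x := by
  have := ind (.or (.lt (.var 0) (.var 1)) (.or (.eq (.var 0) (.var 1)) (.lt (.var 1) (.var 0))))
    (.or (.lt _ _) (.or (.eq _ _) (.lt _ _))) (env[y])
  simp at this
  refine this ((ArithModel.zero_lt_or_eq y).imp id .inl) (fun x ih => ?_) x
  rcases ih with h | rfl | h
  · exact (lt_sc.1 (sc_lt_sc h)).imp id .inl
  · exact .inr (.inr (lt_sc_self _))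
  · exact .inr (.inr (lt_sc.2 (.inl h)))

/-- The difference is sought below `sc y`, so that the induction formula is bounded. The premise `x
< sc y` stands for `x ≤ y`, which is not a symbol of the language. -/
protected theorem exists_add_of_lt_sc {x y : M.Carrier} (h : x < sc y) : ∃ d, x + d = y := by
  have := ind (.ex (.and (.lt (.var 0) (Tm.succ (.var 0)).shift)
      (imp (.lt (.var 2) (.succ (.var 1))) (.eq (.add (.var 2) (.var 0)) (.var 1)))))
    (.bex _ (.or (.nlt _ _) (.eq _ _))) (env[x])
  simp [imp, Fml.neg, ← imp_iff_not_or] at this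
  have h2 := this 0 (lt_sc_self _) ?_ (fun y d hd ih => ?_) y
  · obtain ⟨d, -, hd⟩ := h2
    exact ⟨d, hd h⟩
  · intro h
    rcases lt_sc.1 h with h | h
    · exact absurd h (ArithModel.not_lt_zero' _)
    · rw [h, ArithModel.add_zero']
  · by_cases h2 : x < sc y
    · exact ⟨sc d, sc_lt_sc hd, fun _ => by rw [add_sc, ih h2]⟩
    · refine ⟨0, lt_sc.2 (ArithModel.zero_lt_or_eq _), fun h => ?_⟩
      rw [ArithModel.add_zero']
      exact (lt_sc.1 h).resolve_left h2

protected theorem add_sub_cancel'' (x d : M.Carrier) : x + d - x = d := by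
  have := ind (.eq (.sub (.add (.var 0) (.var 1)) (.var 0)) (.var 1)) (.eq _ _) (env[d])
  simp at this
  exact this (by rw [ArithModel.zero_add', ArithModel.sub_zero'])
    (fun x ih => by rw [sc_add, sc_sub_sc, ih]) x

protected theorem sub_add_self' (x d : M.Carrier) : x - (x + d) = 0 := by
  have := ind (.eq (.sub (.var 0) (.add (.var 0) (.var 1))) .zero) (.eq _ _) (env[d])
  simp at this
  exact this (by rw [ArithModel.zero_sub'])
    (fun x ih => by rw [sc_add, sc_sub_sc, ih]) x

theorem add_lt_add_right'' {x y : M.Carrier} (h : x < y) (z : M.Carrier) : x + z < y + z := by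
  have := ind (.lt (.add (.var 1) (.var 0)) (.add (.var 2) (.var 0))) (.lt _ _) (vcons x (env[y]))
  simp at this
  exact this (by simpa only [ArithModel.add_zero'] using h)
    (fun z ih => by simpa only [add_sc] using sc_lt_sc ih) z

end Peano

end ArithModel

end WeakID

namespace WeakID
namespace ArithModel

open Tm Fml

variable {P : Type} {M : ArithModel P}

/-! ### The ordered semiring structure -/

instance : One M.Carrier := ⟨sc 0⟩

theorem sc_eq (x : M.Carrier) : sc x = x + 1 := by
  change sc x = x + sc 0
  rw [add_sc, ArithModel.add_zero']

instance : CommSemiring M.Carrier where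
  add_assoc := ArithModel.add_assoc'
  zero_add := ArithModel.zero_add'
  add_zero := ArithModel.add_zero'
  add_comm := ArithModel.add_comm'
  left_distrib := ArithModel.mul_add'
  right_distrib x y z := by
    simp only [ArithModel.mul_comm' _ z, ArithModel.mul_add']
  zero_mul := ArithModel.zero_mul'
  mul_zero := ArithModel.mul_zero'
  mul_assoc := ArithModel.mul_assoc'
  one_mul x := by
    change sc 0 * x = x
    rw [sc_mul, ArithModel.zero_mul', ArithModel.zero_add']
  mul_one x := by
    change x * sc 0 = x
    rw [mul_sc, ArithModel.mul_zero', ArithModel.zero_add']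
  mul_comm := ArithModel.mul_comm'
  nsmul := nsmulRec

theorem lt_add_one_iff' {x y : M.Carrier} : x < y + 1 ↔ x < y ∨ x = y := by
  rw [← sc_eq, lt_sc]

noncomputable instance : LinearOrder M.Carrier where
  le x y := x < y ∨ x = y
  le_refl x := .inr rfl
  le_trans x y z := by
    rintro (h | rfl) (h' | rfl)
    · exact .inl (ArithModel.lt_trans' h h')
    · exact .inl h
    · exact .inl h'
    · exact .inr rfl
  lt_iff_le_not_ge x y := by
    constructor
    · refine fun h => ⟨.inl h, ?_⟩
      rintro (h' | rfl)
      · exact ArithModel.lt_irrefl' _ (ArithModel.lt_trans' h h')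
      · exact ArithModel.lt_irrefl' _ h
    · rintro ⟨h | rfl, h'⟩
      · exact h
      · exact absurd (.inr rfl) h'
  le_antisymm x y := by
    rintro (h | rfl) (h' | h')
    · exact absurd (ArithModel.lt_trans' h h') (ArithModel.lt_irrefl' _)
    · exact h'.symm
    · rfl
    · rfl
  le_total x y := by
    rcases ArithModel.lt_trichotomy' x y with h | h | h
    · exact .inl (.inl h)
    · exact .inl (.inr h)
    · exact .inr (.inl h)
  toDecidableLE := Classical.decRel _

theorem lt_add_one_iff {x y : M.Carrier} : x < y + 1 ↔ x ≤ y := lt_add_one_iff'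

instance : ExistsAddOfLE M.Carrier where
  exists_add_of_le {x y} h := by
    obtain ⟨d, hd⟩ := ArithModel.exists_add_of_lt_sc (lt_sc.2 h)
    exact ⟨d, hd.symm⟩

theorem zero_le' (x : M.Carrier) : 0 ≤ x := ArithModel.zero_lt_or_eq x

theorem add_le_add_right'' {x y : M.Carrier} (h : x ≤ y) (z : M.Carrier) : x + z ≤ y + z := by
  rcases h with h | rfl
  · exact (add_lt_add_right'' h z).le
  · exact le_rfl

instance : CanonicallyOrderedAdd M.Carrier where
  le_add_self x y := by simpa using add_le_add_right'' (zero_le' y) x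
  le_self_add x y := by
    rw [add_comm]; simpa using add_le_add_right'' (zero_le' y) x

instance : IsOrderedCancelAddMonoid M.Carrier where
  add_le_add_left x y h z := add_le_add_right'' h z
  le_of_add_le_add_left x y z h := by
    by_contra! h'
    have := add_lt_add_right'' h' x
    rw [add_comm y, add_comm z] at this
    exact absurd h this.not_ge

theorem mul_pos' {x y : M.Carrier} (hx : 0 < x) (hy : 0 < y) : 0 < x * y := by
  obtain ⟨z, rfl⟩ := exists_add_of_le (show 1 ≤ y by rw [← lt_add_one_iff]; simpa using hy)
  rw [mul_add, mul_one]
  exact hx.trans_le le_self_add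

theorem mul_lt_mul_left'' {x y z : M.Carrier} (h : x < y) (hz : 0 < z) : z * x < z * y := by
  obtain ⟨d, rfl⟩ := exists_add_of_le h.le
  rw [mul_add]
  refine lt_add_of_pos_right _ (mul_pos' hz (pos_of_lt_add_right h))

instance : IsStrictOrderedRing M.Carrier where
  zero_le_one := zero_le' 1
  exists_pair_ne := ⟨0, 1, fun h => sc_ne_zero _ h.symm⟩
  mul_lt_mul_of_pos_left z hz x y h := mul_lt_mul_left'' h hz
  mul_lt_mul_of_pos_right z hz x y h := by
    simpa only [mul_comm _ z] using mul_lt_mul_left'' h hz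

/-- The function symbol for cut-off subtraction is thereby the subtraction of a canonically ordered
semiring, so the general `tsub` lemmas apply in every model. -/
instance : OrderedSub M.Carrier where
  tsub_le_iff_right x y z := by
    rcases le_total x y with h | h
    · obtain ⟨d, rfl⟩ := exists_add_of_le h
      rw [ArithModel.sub_add_self']
      exact ⟨fun _ => h.trans le_add_self, fun _ => zero_le' z⟩
    · obtain ⟨d, rfl⟩ := exists_add_of_le h
      rw [ArithModel.add_sub_cancel'', add_comm y, add_le_add_iff_right]

theorem lt_iff_add_one_le {x y : M.Carrier} : x < y ↔ x + 1 ≤ y := by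
  rw [← lt_add_one_iff, add_lt_add_iff_right]

theorem one_le_iff {x : M.Carrier} : 1 ≤ x ↔ x ≠ 0 := by
  rw [← zero_add (1 : M.Carrier), ← lt_iff_add_one_le, pos_iff_ne_zero]

theorem sub_ne_zero {x y : M.Carrier} : x - y ≠ 0 ↔ y < x := by
  rw [ne_eq, tsub_eq_zero_iff_le, not_le]

@[simp] theorem pow2_zero : pow2 (0 : M.Carrier) = 1 := pow2_zero'
theorem pow2_add_one (x : M.Carrier) : pow2 (x + 1) = 2 * pow2 x := by
  rw [← sc_eq, pow2_sc, two_mul]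

attribute [local simp] ofArith

local notation "env" "[" x "]" => vcons x (fun _ => default)

theorem pow2_add (x y : M.Carrier) : pow2 (x + y) = pow2 x * pow2 y := by
  have := ind (.eq (.exp (.add (.var 1) (.var 0))) (.mul (.exp (.var 1)) (.exp (.var 0))))
    (.eq _ _) (env[x])
  simp at this
  exact this (fun y ih => by rw [sc_eq, ← add_assoc, pow2_add_one, ih, pow2_add_one]; ring) y

theorem pow2_pos (x : M.Carrier) : 0 < pow2 x := by
  have := ind (.lt .zero (.exp (.var 0))) (.lt _ _) (fun _ => (default : M.Carrier))
  simp at this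
  exact this (fun y ih => by rw [sc_eq, pow2_add_one, two_mul]; exact add_pos ih ih) x

theorem val_min (e : ℕ → M.Carrier) (s t : Tm) :
    (Tm.min s t).val M.toMod e = min (s.val M.toMod e) (t.val M.toMod e) := by
  simp only [Tm.min, val_sub]
  generalize s.val M.toMod e = x
  generalize t.val M.toMod e = y
  rcases le_total x y with h | h
  · rw [tsub_eq_zero_of_le h, tsub_zero, min_eq_left h]
  · rw [tsub_tsub_cancel_of_le h, min_eq_right h]

/-! ### Defining equations of the function symbols -/

/-- A vector as an assignment. -/
def asg {n : ℕ} (x : Fin n → M.Carrier) : ℕ → M.Carrier := fun i => if h : i < n then x ⟨i, h⟩ else 0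

theorem asg_fin {n : ℕ} (x : Fin n → M.Carrier) (i : Fin n) : asg x i = x i := by
  simp [asg]

theorem val_fn {n : ℕ} (f : ElemFun n) (ts : Fin n → Tm) (e : ℕ → M.Carrier) :
    (Tm.fn f ts).val M.toMod e = M.fn f (fun i => (ts i).val M.toMod e) := rfl

variable {n : ℕ} (x : Fin n → M.Carrier)

@[simp] theorem fn_proj (i : Fin n) : M.fn (.proj i) x = x i := by
  simpa [val_fn, asg_fin] using M.ea _ (.ofFun _ (.proj i)) (asg x)

theorem fn_comp {m : ℕ} (f : ElemFun m) (g : Fin m → ElemFun n) :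
    M.fn (.comp f g) x = M.fn f (fun i => M.fn (g i) x) := by
  simpa [val_fn, asg_fin] using M.ea _ (.ofFun _ (.comp f g)) (asg x)

theorem fn_brec_zero (g : ElemFun n) (h : ElemFun (n + 2)) (b : ElemFun (n + 1)) :
    M.fn (.brec g h b) (Matrix.vecCons 0 x) = min (M.fn g x) (M.fn b (Matrix.vecCons 0 x)) := by
  have := M.ea _ (.ofFun _ (.brec_zero g h b)) (asg x)
  simpa [val_fn, asg_fin, val_min, val_vecCons] using this

theorem fn_brec_succ (g : ElemFun n) (h : ElemFun (n + 2)) (b : ElemFun (n + 1)) (y : M.Carrier) :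
    M.fn (.brec g h b) (Matrix.vecCons (y + 1) x) =
      min (M.fn h (Matrix.vecCons y (Matrix.vecCons (M.fn (.brec g h b) (Matrix.vecCons y x)) x)))
        (M.fn b (Matrix.vecCons (y + 1) x)) := by
  have := M.ea _ (.ofFun _ (.brec_succ g h b)) (vcons y (asg x))
  simpa [val_fn, asg_fin, val_min, val_vecCons, sc_eq] using this

@[simp] theorem fn_zero (x : Fin 0 → M.Carrier) : M.fn .zero x = 0 := by
  rw [Subsingleton.elim x ![]]; rfl
@[simp] theorem fn_succ (x : Fin 1 → M.Carrier) : M.fn .succ x = x 0 + 1 := by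
  rw [← sc_eq, sc]; congr; funext i; fin_cases i; rfl
@[simp] theorem fn_add (x : Fin 2 → M.Carrier) : M.fn .add x = x 0 + x 1 := by
  change _ = M.fn .add ![x 0, x 1]; congr; funext i; fin_cases i <;> rfl
@[simp] theorem fn_sub (x : Fin 2 → M.Carrier) : M.fn .sub x = x 0 - x 1 := by
  change _ = M.fn .sub ![x 0, x 1]; congr; funext i; fin_cases i <;> rfl
@[simp] theorem fn_mul (x : Fin 2 → M.Carrier) : M.fn .mul x = x 0 * x 1 := by
  change _ = M.fn .mul ![x 0, x 1]; congr; funext i; fin_cases i <;> rfl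
@[simp] theorem fn_exp (x : Fin 1 → M.Carrier) : M.fn .exp x = pow2 (x 0) := by
  change _ = M.fn .exp ![x 0]; congr; funext i; fin_cases i; rfl

/-! ### Truth of elementary predicates -/

open ElemFun (cst two_pow wk bex ball bex2 bex3 bit tab cov)

/-- Truth in the model. -/
def Tr (M : ArithModel P) (a : ElemFun n) (x : Fin n → M.Carrier) : Prop := M.fn a x ≠ 0

theorem fn_comp_cons {m : ℕ} (f : ElemFun (m + 1)) (g : ElemFun n) (gs : Fin m → ElemFun n) :
    M.fn (.comp f (Matrix.vecCons g gs)) x =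
      M.fn f (Matrix.vecCons (M.fn g x) (fun i => M.fn (gs i) x)) := by
  rw [fn_comp]
  congr 1
  funext i
  refine Fin.cases ?_ (fun i => ?_) i <;> simp

theorem fn_vecEmpty : (fun i => M.fn (Matrix.vecEmpty (α := ElemFun n) i) x) = ![] :=
  Subsingleton.elim _ _

section
variable (a b c : ElemFun n)

@[simp] theorem fn_cst (k : ℕ) : M.fn (cst n k) x = k := by
  induction k with
  | zero => simp [cst, fn_comp]
  | succ k ih => simp [cst, fn_comp, ih]
@[simp] theorem fn_hadd : M.fn (a + b) x = M.fn a x + M.fn b x := by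
  change M.fn (.comp .add ![a, b]) x = _; simp [fn_comp]
@[simp] theorem fn_hsub : M.fn (a - b) x = M.fn a x - M.fn b x := by
  change M.fn (.comp .sub ![a, b]) x = _; simp [fn_comp]
@[simp] theorem fn_hmul : M.fn (a * b) x = M.fn a x * M.fn b x := by
  change M.fn (.comp .mul ![a, b]) x = _; simp [fn_comp]
@[simp] theorem fn_two_pow : M.fn (two_pow a) x = pow2 (M.fn a x) := by
  simp [two_pow, fn_comp]
@[simp] theorem fn_wk (i : M.Carrier) : M.fn (wk a) (Matrix.vecCons i x) = M.fn a x := by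
  simp [wk, fn_comp]
@[simp] theorem tr_not : M.Tr (.not a) x ↔ ¬ M.Tr a x := by
  simp only [Tr, ElemFun.not, fn_hsub, fn_cst, Nat.cast_one, sub_ne_zero]
  rw [← not_le, one_le_iff]
@[simp] theorem tr_and : M.Tr (.and a b) x ↔ M.Tr a x ∧ M.Tr b x := by
  simp [Tr, ElemFun.and]
@[simp] theorem tr_or : M.Tr (.or a b) x ↔ M.Tr a x ∨ M.Tr b x := by
  simp [Tr, ElemFun.or]; tauto
@[simp] theorem tr_eq : M.Tr (.eq a b) x ↔ M.fn a x = M.fn b x := by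
  have : M.Tr (.eq a b) x ↔ ¬ M.Tr ((a - b) + (b - a)) x := tr_not _ _
  rw [this]
  simp only [Tr, fn_hadd, fn_hsub, ne_eq, not_not, add_eq_zero, tsub_eq_zero_iff_le]
  exact le_antisymm_iff.symm
@[simp] theorem tr_lt : M.Tr (.lt a b) x ↔ M.fn a x < M.fn b x := by
  simp [Tr, ElemFun.lt, tsub_eq_zero_iff_le]
end

/-- Induction for elementary predicates. -/
theorem tr_induction (P : ElemFun (n + 1)) (h0 : M.Tr P (Matrix.vecCons 0 x))
    (h1 : ∀ y, M.Tr P (Matrix.vecCons y x) → M.Tr P (Matrix.vecCons (y + 1) x)) (y : M.Carrier) :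
    M.Tr P (Matrix.vecCons y x) := by
  have := ind (.ne (.fn P (fun i => .var i)) .zero) (.ne _ _) (asg x)
  have e : ∀ y : M.Carrier, (fun i : Fin (n + 1) => vcons y (asg x) i) = Matrix.vecCons y x := by
    intro y; funext i
    refine Fin.cases ?_ (fun i => ?_) i
    · rfl
    · simp [asg_fin]
  simp [val_fn, e, sc_eq] at this
  exact this h0 h1 y

section
variable (a b c : ElemFun n)

@[simp] theorem tr_bex (P : ElemFun (n + 1)) :
    M.Tr (bex a P) x ↔ ∃ i ≤ M.fn a x, M.Tr P (Matrix.vecCons i x) := by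
  -- `B(y)` searches for a solution `i ≤ y` by limited recursion with bound `1`. Cutting off at `1`
  -- does not affect whether a value is zero (`hm`).
  set B := ElemFun.brec (.comp P (Matrix.vecCons (cst n 0) .proj))
      (.or (.proj 1)
        (.comp P (Matrix.vecCons (.proj 0 + cst (n + 2) 1) (fun i => .proj i.succ.succ))))
      (cst (n + 1) 1) with hB
  have hm : ∀ u : M.Carrier, min u 1 ≠ 0 ↔ u ≠ 0 := by
    intro u
    rw [← one_le_iff, ← one_le_iff, le_min_iff]; simp
  have h0 : M.Tr B (Matrix.vecCons 0 x) ↔ M.Tr P (Matrix.vecCons 0 x) := by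
    rw [Tr, hB, fn_brec_zero]
    simp only [fn_cst, Nat.cast_one]
    rw [hm]
    simp [fn_comp_cons, Tr]
  have h1 : ∀ k, M.Tr B (Matrix.vecCons (k + 1) x) ↔
      M.Tr B (Matrix.vecCons k x) ∨ M.Tr P (Matrix.vecCons (k + 1) x) := by
    intro k
    rw [Tr, hB, fn_brec_succ, ← hB]
    simp only [fn_cst, Nat.cast_one]
    rw [hm, ← Tr, tr_or]
    simp [Tr, fn_comp_cons]
  have h2 : M.Tr (bex a P) x ↔ M.Tr B (Matrix.vecCons (M.fn a x) x) := by
    rw [Tr, bex, fn_comp_cons]; simp only [fn_proj]; rfl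
  rw [h2]
  generalize M.fn a x = k
  constructor
  · intro h
    by_contra! h3
    -- Induction on `y` for the elementary predicate `B(y) → k < y`, with `k` as a parameter; at `y
    -- = k` it contradicts `B(k)`.
    have h4 := tr_induction (M := M) (Matrix.vecCons k x)
      (.not (.and (.comp B (Matrix.vecCons (.proj 0) (fun i => .proj i.succ.succ)))
        (.not (.lt (.proj 1) (.proj 0)))))
    simp only [tr_not, tr_and, tr_lt, fn_proj, Matrix.cons_val_zero, Matrix.cons_val_one,
      not_lt, not_and, not_le] at h4
    simp only [Tr, fn_comp_cons, fn_proj, Matrix.cons_val_zero, Matrix.cons_val_succ] at h4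
    simp only [← Tr.eq_def] at h4
    refine absurd (h4 (fun h5 => absurd (h0.1 h5) (h3 0 (zero_le' _))) (fun y ih h5 => ?_) k h)
      (lt_irrefl _)
    rcases (h1 y).1 h5 with h5 | h5
    · exact (ih h5).trans (lt_add_one_iff.2 le_rfl)
    · by_contra h6
      exact h3 _ (not_lt.1 h6) h5
  · rintro ⟨i, hi, h⟩
    obtain ⟨d, rfl⟩ := exists_add_of_le hi
    -- Once the search has succeeded at `i` it stays successful: induction on `d` for `B(i + d)`.
    have h4 := tr_induction (M := M) (Matrix.vecCons i x)
      (.comp B (Matrix.vecCons (.proj 1 + .proj 0) (fun i => .proj i.succ.succ)))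
    simp only [Tr, fn_comp_cons, fn_proj, fn_hadd, Matrix.cons_val_zero, Matrix.cons_val_one,
      Matrix.cons_val_succ, add_zero] at h4
    refine h4 ?_ (fun y ih => ?_) d
    · rcases eq_or_ne i 0 with rfl | hi0
      · exact h0.2 h
      · obtain ⟨j, rfl⟩ := exists_add_of_le (one_le_iff.2 hi0)
        rw [add_comm 1 j] at h ⊢
        exact (h1 j).2 (.inr h)
    · rw [← add_assoc]
      exact (h1 _).2 (.inl ih)

@[simp] theorem tr_ball (P : ElemFun (n + 1)) :
    M.Tr (ball a P) x ↔ ∀ i ≤ M.fn a x, M.Tr P (Matrix.vecCons i x) := by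
  simp [ball]
@[simp] theorem tr_bex2 (P : ElemFun (n + 2)) : M.Tr (bex2 a P) x ↔
    ∃ i ≤ M.fn a x, ∃ j ≤ M.fn a x, M.Tr P (Matrix.vecCons j (Matrix.vecCons i x)) := by
  simp [bex2]
@[simp] theorem tr_bex3 (P : ElemFun (n + 3)) : M.Tr (bex3 a P) x ↔
    ∃ i ≤ M.fn a x, ∃ j ≤ M.fn a x, ∃ k ≤ M.fn a x,
      M.Tr P (Matrix.vecCons k (Matrix.vecCons j (Matrix.vecCons i x))) := by
  simp [bex3]
end

end ArithModel
end WeakID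

namespace WeakID
namespace ArithModel

open Tm Fml
open ElemFun (cst two_pow wk bex ball bex2 bex3 bit tab cov)

variable {P : Type} {M : ArithModel P} {n : ℕ}

/-! ### Binary digits and course-of-values recursion -/

/-- The digit of `2 ^ k` in the binary representation of `t` is `1`. -/
def Bit (t k : M.Carrier) : Prop := ∃ q r, r < pow2 k ∧ t = (q + q + 1) * pow2 k + r

@[simp] theorem tr_bit (a b : ElemFun n) (x : Fin n → M.Carrier) :
    M.Tr (bit a b) x ↔ Bit (M.fn a x) (M.fn b x) := by
  simp only [bit, tr_bex2, tr_and, tr_lt, tr_eq, fn_wk, fn_two_pow, fn_hadd, fn_hmul,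
    fn_proj, fn_cst, Matrix.cons_val_zero, Matrix.cons_val_one, Nat.cast_one, Bit]
  constructor
  · rintro ⟨q, -, r, -, h⟩
    exact ⟨q, r, h⟩
  · rintro ⟨q, r, h1, h2⟩
    refine ⟨q, ?_, r, ?_, h1, h2⟩
    · rw [h2]
      have h3 : 1 ≤ pow2 (M.fn b x) := one_le_iff.2 (pow2_pos _).ne'
      calc q ≤ q + (q + 1) := le_self_add
        _ = (q + q + 1) * 1 := by ring
        _ ≤ (q + q + 1) * pow2 (M.fn b x) := by gcongr
        _ ≤ _ := le_self_add
    · rw [h2]; exact le_add_self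

theorem bit_add_pow2 {t y i : M.Carrier} (hi : i < y) :
    Bit (t + pow2 y) i ↔ Bit t i := by
  obtain ⟨d, rfl⟩ := exists_add_of_le (lt_iff_add_one_le.1 hi)
  have e : pow2 (i + 1 + d) = 2 * pow2 d * pow2 i := by
    rw [pow2_add, pow2_add_one]; ring
  rw [e]
  generalize pow2 d = u
  simp only [Bit]
  generalize pow2 i = p
  constructor
  · rintro ⟨q, r, hr, h⟩
    -- Subtraction being truncated, `q - u` has to be justified: if `q < u`, then comparing both
    -- representations gives `r ≥ p`.
    have hu : u ≤ q := by
      by_contra! h1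
      obtain ⟨v, rfl⟩ := exists_add_of_le (lt_iff_add_one_le.1 h1)
      have h2 : t + 2 * v * p + p = r := by
        apply add_right_cancel (b := (q + q + 1) * p)
        linear_combination (exp := 1) h
      rw [← h2] at hr
      exact absurd hr (not_lt.2 le_add_self)
    obtain ⟨v, rfl⟩ := exists_add_of_le hu
    refine ⟨v, r, hr, ?_⟩
    apply add_right_cancel (b := 2 * u * p)
    linear_combination (exp := 1) h
  · rintro ⟨q, r, hr, rfl⟩
    exact ⟨q + u, r, hr, by ring⟩

theorem bit_add_pow2_self {t y : M.Carrier} (h : t < pow2 y) : Bit (t + pow2 y) y :=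
  ⟨0, t, h, by ring⟩

theorem not_bit_of_lt {t y : M.Carrier} (h : t < pow2 y) : ¬ Bit t y := by
  rintro ⟨q, r, -, rfl⟩
  refine absurd h (not_lt.2 ?_)
  have : (q + q + 1) * pow2 y + r = pow2 y + ((q + q) * pow2 y + r) := by ring
  rw [this]
  exact le_self_add

section
variable (x : Fin n → M.Carrier) (h : ElemFun (n + 2)) (y : M.Carrier)

theorem tr_cov_iff : M.Tr (cov h) (Matrix.vecCons y x) ↔
    M.Tr h (Matrix.vecCons y (Matrix.vecCons (M.fn (tab h) (Matrix.vecCons y x)) x)) := by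
  have e : (fun i => M.fn (Matrix.vecCons (tab h) (fun i => ElemFun.proj i.succ) i)
      (Matrix.vecCons y x)) = Matrix.vecCons (M.fn (tab h) (Matrix.vecCons y x)) x := by
    funext i
    refine Fin.cases ?_ (fun i => ?_) i <;> simp
  rw [Tr, cov, fn_comp_cons, e]
  simp [Tr]

theorem fn_tab_zero : M.fn (tab h) (Matrix.vecCons 0 x) = 0 := by
  rw [tab, fn_brec_zero]
  simp

-- The bound `2^(y+1)` of the limited recursion is never active when the table at `y` is below
-- `2^y`. The double negation in `tab` normalizes the truth value to `0` or `1`.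
open Classical in
theorem fn_tab_succ (ht : M.fn (tab h) (Matrix.vecCons y x) < pow2 y) :
    M.fn (tab h) (Matrix.vecCons (y + 1) x) = M.fn (tab h) (Matrix.vecCons y x) +
        (if M.Tr (cov h) (Matrix.vecCons y x) then pow2 y else 0) := by
  rw [tr_cov_iff]
  conv_lhs => rw [tab, fn_brec_succ, ← tab]
  have e : ∀ u : M.Carrier, 1 - (1 - u) = if u ≠ 0 then 1 else 0 := by
    intro u
    split_ifs with h
    · rw [tsub_eq_zero_of_le (one_le_iff.2 h), tsub_zero]
    · rw [not_not.1 h]; simp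
  simp only [fn_hadd, fn_proj, fn_hmul, fn_two_pow, ElemFun.not, fn_hsub, fn_cst,
    Matrix.cons_val_zero, Matrix.cons_val_one, Nat.cast_one, e, Tr, pow2_add_one, two_mul]
  rw [min_eq_left]
  · split_ifs with h1 <;> simp [h1]
  · split_ifs
    · rw [mul_one]; exact add_le_add_left ht.le _
    · rw [mul_zero, add_zero]; exact ht.le.trans le_self_add

/-- Size and digits are proved by one simultaneous induction: the size bound ensures that the new
digit at `y` does not interfere with an old one, and that the recursion is not cut off. -/
theorem tab_spec : M.fn (tab h) (Matrix.vecCons y x) < pow2 y ∧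
    ∀ i < y, (Bit (M.fn (tab h) (Matrix.vecCons y x)) i ↔ M.Tr (cov h) (Matrix.vecCons i x)) := by
  have key := tr_induction (M := M) x
    (.and (.lt (tab h) (two_pow (.proj 0))) (ball (.proj 0) (.or (.not (.lt (.proj 0) (.proj 1)))
      (.eq (.not (bit (wk (tab h)) (.proj 0)))
        (.not (.comp (cov h) (Matrix.vecCons (.proj 0) (fun i => .proj i.succ.succ))))))))
  -- Negated truth values are `0` or `1`, so an equivalence can be expressed as an equation between
  -- them; this makes the induction predicate elementary.
  have e : ∀ a b : ElemFun (n + 2), ∀ z : Fin (n + 2) → M.Carrier,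
      M.Tr (.eq (.not a) (.not b)) z ↔ (M.Tr a z ↔ M.Tr b z) := by
    intro a b z
    have h1 : ∀ a : ElemFun (n + 2), (M.Tr a z → M.fn (.not a) z = 0) ∧
        (¬ M.Tr a z → M.fn (.not a) z = 1) := by
      intro a
      simp only [ElemFun.not, fn_hsub, fn_cst, Nat.cast_one, Tr, not_not]
      exact ⟨fun h => tsub_eq_zero_of_le (one_le_iff.2 h), fun h => by rw [h, tsub_zero]⟩
    have h2 := h1 a
    have h3 := h1 b
    rw [tr_eq]
    by_cases ha : M.Tr a z <;> by_cases hb : M.Tr b z <;> simp_all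
  have e2 : ∀ i y : M.Carrier, M.Tr (.comp (cov h) (Matrix.vecCons (.proj 0)
      (fun i => .proj i.succ.succ))) (Matrix.vecCons i (Matrix.vecCons y x)) ↔
      M.Tr (cov h) (Matrix.vecCons i x) := by
    intro i y; simp [Tr, fn_comp_cons]
  simp only [tr_and, tr_lt, tr_ball, tr_or, tr_not, e, e2, tr_bit, fn_wk, fn_proj,
    Matrix.cons_val_zero, Matrix.cons_val_one, fn_two_pow, not_lt] at key
  have h0 := key ⟨by rw [fn_tab_zero]; exact pow2_pos _, fun i _ => .inl (zero_le' _)⟩ ?_ y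
  · exact ⟨h0.1, fun i hi => (h0.2 i hi.le).resolve_left hi.not_ge⟩
  · rintro y ⟨ih1, ih2⟩
    rw [fn_tab_succ x h y ih1]
    constructor
    · rw [pow2_add_one, two_mul]
      split_ifs
      · exact add_lt_add_left ih1 _
      · rw [add_zero]; exact ih1.trans_le le_self_add
    · intro i _
      rw [or_iff_not_imp_left, not_le, lt_add_one_iff]
      intro hi
      rcases hi.lt_or_eq with hi | rfl
      · have := (ih2 i hi.le).resolve_left hi.not_ge
        split_ifs
        · rw [bit_add_pow2 hi, this]
        · rw [add_zero, this]
      · split_ifs with h1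
        · exact iff_of_true (bit_add_pow2_self ih1) h1
        · rw [add_zero]
          exact iff_of_false (not_bit_of_lt ih1) h1

/-- One unfolding of a course-of-values recursion. Only the digits of the table below `y` matter, so
the table itself may remain anonymous. -/
theorem tr_cov : ∃ t : M.Carrier, (∀ i < y, (Bit t i ↔ M.Tr (cov h) (Matrix.vecCons i x))) ∧
      (M.Tr (cov h) (Matrix.vecCons y x) ↔ M.Tr h (Matrix.vecCons y (Matrix.vecCons t x))) :=
  ⟨_, (tab_spec x h y).2, tr_cov_iff x h y⟩

end

/-! ### Codes of terms -/

def pair (a b : M.Carrier) : M.Carrier := (a + b) * (a + b) + a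
def thc (a r : M.Carrier) : M.Carrier := 2 * pair a r + 1
def omc (a b c : M.Carrier) : M.Carrier := 2 * pair a (pair b c) + 2

theorem le_mul_self (a : M.Carrier) : a ≤ a * a := by
  rcases eq_or_ne a 0 with rfl | h
  · simp
  · calc a = a * 1 := (mul_one a).symm
      _ ≤ a * a := by gcongr; exact one_le_iff.2 h

theorem le_pair_left (a b : M.Carrier) : a ≤ pair a b := le_add_self
theorem le_pair_right (a b : M.Carrier) : b ≤ pair a b :=
  (le_add_self.trans (le_mul_self _)).trans le_self_add
theorem pair_le {a b a' b' : M.Carrier} (h : a ≤ a') (h' : b ≤ b') : pair a b ≤ pair a' b' := by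
  unfold pair; gcongr
-- With `s = a + b`, the value `pair a b` lies between `s²` and `s² + s`. By this inequality such
-- intervals are disjoint for different `s`, which gives injectivity and monotonicity of `pair`.
theorem mul_self_lt {a b : M.Carrier} (h : a < b) : a * a + a < b * b := by
  obtain ⟨d, rfl⟩ := exists_add_of_le (lt_iff_add_one_le.1 h)
  rw [lt_iff_add_one_le]
  have : (a + 1 + d) * (a + 1 + d) = a * a + a + 1 + (a + 2 * d + 2 * a * d + d * d) := by ring
  rw [this]
  exact le_self_add
theorem pair_lt {a b a' b' : M.Carrier} (h : a ≤ a') (h' : b ≤ b') (h2 : a < a' ∨ b < b') :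
    pair a b < pair a' b' := by
  have h3 : a + b < a' + b' := by
    rcases h2 with h2 | h2
    · exact add_lt_add_of_lt_of_le h2 h'
    · exact add_lt_add_of_le_of_lt h h2
  calc pair a b ≤ (a + b) * (a + b) + (a + b) := add_le_add_right le_self_add _
    _ < (a' + b') * (a' + b') := mul_self_lt h3
    _ ≤ _ := le_self_add
@[simp] theorem pair_inj {a b a' b' : M.Carrier} : pair a b = pair a' b' ↔ a = a' ∧ b = b' := by
  refine ⟨fun h => ?_, by rintro ⟨rfl, rfl⟩; rfl⟩
  have key : ∀ {a b a' b' : M.Carrier}, a + b < a' + b' → pair a b < pair a' b' := by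
    intro a b a' b' h
    calc pair a b ≤ (a + b) * (a + b) + (a + b) := add_le_add_right le_self_add _
      _ < (a' + b') * (a' + b') := mul_self_lt h
      _ ≤ _ := le_self_add
  have h1 : a + b = a' + b' := by
    rcases lt_trichotomy (a + b) (a' + b') with h1 | h1 | h1
    · exact absurd h (key h1).ne
    · exact h1
    · exact absurd h (key h1).ne'
  unfold pair at h
  rw [h1] at h
  obtain rfl := add_left_cancel h
  exact ⟨rfl, add_left_cancel h1⟩

theorem two_mul_inj {a b : M.Carrier} : 2 * a = 2 * b ↔ a = b :=
  mul_right_inj' two_ne_zero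

/-- Parity separates codes of countable sums (odd) from codes of terms with an exponent (even). -/
theorem two_mul_ne (a b : M.Carrier) : 2 * a ≠ 2 * b + 1 := by
  intro h
  rcases le_or_gt a b with h1 | h1
  · have : 2 * a < 2 * b + 1 := lt_add_one_iff.2 (by gcongr)
    exact this.ne h
  · have : 2 * b + 1 < 2 * a := by
      obtain ⟨d, rfl⟩ := exists_add_of_le (lt_iff_add_one_le.1 h1)
      rw [lt_iff_add_one_le]
      have : 2 * (b + 1 + d) = 2 * b + 1 + 1 + 2 * d := by ring
      rw [this]
      exact le_self_add
    exact this.ne' h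

@[simp] theorem thc_inj {a r a' r' : M.Carrier} : thc a r = thc a' r' ↔ a = a' ∧ r = r' := by
  simp only [thc, add_left_inj, two_mul_inj, pair_inj]
@[simp] theorem omc_inj {a b c a' b' c' : M.Carrier} :
    omc a b c = omc a' b' c' ↔ a = a' ∧ b = b' ∧ c = c' := by
  simp only [omc, add_left_inj, two_mul_inj, pair_inj]
@[simp] theorem thc_ne_omc (a r a' b' c' : M.Carrier) : thc a r ≠ omc a' b' c' := by
  intro h
  have e : omc a' b' c' = 2 * pair a' (pair b' c') + 1 + 1 := by unfold omc; ring
  rw [e, thc, add_left_inj] at h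
  exact two_mul_ne _ _ h
@[simp] theorem omc_ne_thc (a r a' b' c' : M.Carrier) : omc a' b' c' ≠ thc a r :=
  (thc_ne_omc _ _ _ _ _).symm
@[simp] theorem thc_ne_zero (a r : M.Carrier) : thc a r ≠ 0 :=
  (lt_add_of_le_of_pos (zero_le' _) one_pos).ne'
@[simp] theorem omc_ne_zero (a b c : M.Carrier) : omc a b c ≠ 0 :=
  (lt_add_of_le_of_pos (zero_le' _) two_pos).ne'
@[simp] theorem zero_ne_thc (a r : M.Carrier) : 0 ≠ thc a r := (thc_ne_zero _ _).symm
@[simp] theorem zero_ne_omc (a b c : M.Carrier) : 0 ≠ omc a b c := (omc_ne_zero _ _ _).symm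

theorem lt_two_mul_add_one (a : M.Carrier) : a < 2 * a + 1 := by
  rw [lt_add_one_iff, two_mul]; exact le_self_add
theorem lt_thc_left (a r : M.Carrier) : a < thc a r :=
  (le_pair_left a r).trans_lt (lt_two_mul_add_one _)
theorem lt_thc_right (a r : M.Carrier) : r < thc a r :=
  (le_pair_right a r).trans_lt (lt_two_mul_add_one _)
theorem pair_lt_omc (a b c : M.Carrier) : pair a (pair b c) < omc a b c :=
  (lt_two_mul_add_one _).trans (by rw [omc]; gcongr; exact one_lt_two)
theorem lt_omc_one (a b c : M.Carrier) : a < omc a b c :=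
  (le_pair_left _ _).trans_lt (pair_lt_omc a b c)
theorem lt_omc_two (a b c : M.Carrier) : b < omc a b c :=
  ((le_pair_left _ _).trans (le_pair_right _ _)).trans_lt (pair_lt_omc a b c)
theorem lt_omc_three (a b c : M.Carrier) : c < omc a b c :=
  ((le_pair_right _ _).trans (le_pair_right _ _)).trans_lt (pair_lt_omc a b c)
theorem thc_zero_le (a r : M.Carrier) : thc a 0 ≤ thc a r := by
  have := pair_le (le_refl a) (zero_le' r)
  unfold thc; gcongr

/-- Bounded search for the immediate subterms of a term. -/
theorem ex_thc {s : M.Carrier} {Q : M.Carrier → M.Carrier → Prop} :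
    (∃ a ≤ s, ∃ r ≤ s, s = thc a r ∧ Q a r) ↔ ∃ a r, s = thc a r ∧ Q a r := by
  constructor
  · rintro ⟨a, -, r, -, h⟩
    exact ⟨a, r, h⟩
  · rintro ⟨a, r, rfl, h⟩
    exact ⟨a, (lt_thc_left a r).le, r, (lt_thc_right a r).le, rfl, h⟩
theorem ex_omc {s : M.Carrier} {Q : M.Carrier → M.Carrier → M.Carrier → Prop} :
    (∃ a ≤ s, ∃ b ≤ s, ∃ c ≤ s, s = omc a b c ∧ Q a b c) ↔ ∃ a b c, s = omc a b c ∧ Q a b c := by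
  constructor
  · rintro ⟨a, -, b, -, c, -, h⟩
    exact ⟨a, b, c, h⟩
  · rintro ⟨a, b, c, rfl, h⟩
    exact ⟨a, (lt_omc_one a b c).le, b, (lt_omc_two a b c).le, c, (lt_omc_three a b c).le, rfl, h⟩
theorem ex_omc_iff {s : M.Carrier} :
    (∃ a ≤ s, ∃ b ≤ s, ∃ c ≤ s, s = omc a b c) ↔ ∃ a b c, s = omc a b c := by
  simpa using ex_omc (s := s) (Q := fun _ _ _ => True)
theorem ex_thc_iff {s : M.Carrier} :
    (∃ a ≤ s, ∃ r ≤ s, s = thc a r) ↔ ∃ a r, s = thc a r := by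
  simpa using ex_thc (s := s) (Q := fun _ _ => True)

section
variable (a b c : ElemFun n) (x : Fin n → M.Carrier)
@[simp] theorem fn_pr : M.fn (.pr a b) x = pair (M.fn a x) (M.fn b x) := by
  simp [ElemFun.pr, pair]
@[simp] theorem fn_th : M.fn (.th a b) x = thc (M.fn a x) (M.fn b x) := by
  simp [ElemFun.th, thc]
@[simp] theorem fn_om : M.fn (.om a b c) x = omc (M.fn a x) (M.fn b x) (M.fn c x) := by
  simp [ElemFun.om, omc]
end

end ArithModel
end WeakID

namespace WeakID
namespace ArithModel

open Tm Fml
open ElemFun (cst two_pow wk bex ball bex2 bex3 bit tab cov)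

variable {P : Type} {M : ArithModel P} {n : ℕ}

/-! ### Recursive equations for the relations on codes -/

def Ctbl (x : M.Carrier) : Prop := x = 0 ∨ ∃ a r, x = thc a r

/-- `g ∈ K x`. -/
def MemK (g x : M.Carrier) : Prop := M.Tr ElemFun.inK ![x, g]

/-- The ordering on codes of terms, not necessarily in normal form. -/
def TLt (x y : M.Carrier) : Prop := M.Tr ElemFun.ltPr ![pair x y]

def IsNF (x : M.Carrier) : Prop := M.Tr ElemFun.isNF ![x]

/-- The ordering of `OT'(ϑ)`. -/
def OLt (y x : M.Carrier) : Prop := M.Tr ElemFun.otLt ![y, x]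

@[simp] theorem tr_isCtbl (c : ElemFun n) (x : Fin n → M.Carrier) :
    M.Tr (.isCtbl c) x ↔ Ctbl (M.fn c x) := by
  simp [ElemFun.isCtbl, Ctbl, ex_thc_iff]

@[simp] theorem tr_comp_one (f : ElemFun 1) (a : ElemFun n) (x : Fin n → M.Carrier) :
    M.Tr (.comp f ![a]) x ↔ M.Tr f ![M.fn a x] := by
  rw [Tr, fn_comp_cons, fn_vecEmpty, Tr]

@[simp] theorem tr_comp_two (f : ElemFun 2) (a b : ElemFun n) (x : Fin n → M.Carrier) :
    M.Tr (.comp f ![a, b]) x ↔ M.Tr f ![M.fn a x, M.fn b x] := by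
  rw [Tr, fn_comp_cons, Tr]
  congr! 3
  funext i; fin_cases i; rfl

@[simp] theorem tr_ltTerm (a b : ElemFun n) (x : Fin n → M.Carrier) :
    M.Tr (.ltTerm a b) x ↔ TLt (M.fn a x) (M.fn b x) := by
  simp [ElemFun.ltTerm, TLt]

/-- The recursion consults its table only at `r`, `a` and `c`, which are smaller than `x`, where it
agrees with `MemK`. The equation holds for all elements of the model, whether or not they code
standard terms. -/
theorem memK_iff (g x : M.Carrier) : MemK g x ↔
    (∃ a r, x = thc a r ∧ (g = thc a 0 ∨ MemK g r)) ∨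
    (∃ a b c, x = omc a b c ∧ ((MemK g a ∨ g = b) ∨ (c ≠ 0 ∧ Ctbl c ∧ g = c) ∨
      (¬ Ctbl c ∧ MemK g c))) := by
  obtain ⟨t, ht, h⟩ := tr_cov ![g] ElemFun.inKStep x
  rw [MemK, ElemFun.inK, h]
  simp only [ElemFun.inKStep, tr_or, tr_bex2, tr_bex3, tr_and, tr_eq, tr_bit, tr_not, tr_isCtbl,
    fn_proj, fn_th, fn_om, fn_cst, Matrix.cons_val, Nat.cast_zero, ex_thc, ex_omc]
  refine or_congr ?_ ?_
  · refine exists_congr fun a => exists_congr fun r => and_congr_right ?_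
    rintro rfl
    rw [ht r (lt_thc_right a r)]; rfl
  · refine exists_congr fun a => exists_congr fun b => exists_congr fun c => and_congr_right ?_
    rintro rfl
    rw [ht a (lt_omc_one a b c), ht c (lt_omc_three a b c)]; rfl

theorem not_memK_zero (g : M.Carrier) : ¬ MemK g 0 := by
  rw [memK_iff]; simp
theorem memK_thc {g a r : M.Carrier} : MemK g (thc a r) ↔ g = thc a 0 ∨ MemK g r := by
  rw [memK_iff]; simp
theorem memK_omc {g a b c : M.Carrier} : MemK g (omc a b c) ↔
    (MemK g a ∨ g = b) ∨ (c ≠ 0 ∧ Ctbl c ∧ g = c) ∨ (¬ Ctbl c ∧ MemK g c) := by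
  rw [memK_iff]; simp

/-- Strong induction for elementary predicates. -/
theorem tr_strong_induction (x : Fin n → M.Carrier) (Q : ElemFun (n + 1))
    (h : ∀ y, (∀ z < y, M.Tr Q (Matrix.vecCons z x)) → M.Tr Q (Matrix.vecCons y x))
    (y : M.Carrier) : M.Tr Q (Matrix.vecCons y x) := by
  have key := tr_induction (M := M) x
    (ball (.proj 0) (.or (.not (.lt (.proj 0) (.proj 1)))
      (.comp Q (Matrix.vecCons (.proj 0) (fun i => .proj i.succ.succ)))))
  have e : ∀ i y : M.Carrier, M.Tr (.comp Q (Matrix.vecCons (.proj 0)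
      (fun i => .proj i.succ.succ))) (Matrix.vecCons i (Matrix.vecCons y x)) ↔
      M.Tr Q (Matrix.vecCons i x) := by
    intro i y; simp [Tr, fn_comp_cons]
  simp only [tr_ball, tr_or, tr_not, tr_lt, fn_proj, Matrix.cons_val_zero, Matrix.cons_val_one,
    e, not_lt] at key
  refine h y fun z hz => (key ?_ ?_ y z hz.le).resolve_left hz.not_ge
  · exact fun i _ => .inl (zero_le' i)
  · intro y ih i _
    rw [or_iff_not_imp_left, not_le, lt_add_one_iff]
    exact fun hi => h i fun z hz =>
      (ih z (hz.le.trans hi)).resolve_left (hz.trans_le hi).not_ge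

/-- Makes the bounded quantifiers over `K` in the definition of the ordering equivalent to unbounded
ones; later it is what makes induction on codes applicable to the members of `K(b)`. -/
theorem le_of_memK {g x : M.Carrier} (h : MemK g x) : g ≤ x := by
  have key := tr_strong_induction (M := M) ![g]
    (.or (.not ElemFun.inK) (.not (.lt (.proj 0) (.proj 1))))
  simp only [tr_or, tr_not, tr_lt, fn_proj, Matrix.cons_val, not_lt,
    ← imp_iff_not_or] at key
  refine key (fun y ih h => ?_) x h
  rcases (memK_iff g y).1 h with ⟨a, r, rfl, rfl | h⟩ | ⟨a, b, c, rfl, (h | rfl) | ⟨-, -, rfl⟩ | ⟨-, h⟩⟩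
  · exact thc_zero_le a r
  · exact (ih r (lt_thc_right a r) h).trans (lt_thc_right a r).le
  · exact (ih a (lt_omc_one a b c) h).trans (lt_omc_one a b c).le
  · exact (lt_omc_two _ _ _).le
  · exact (lt_omc_three _ _ _).le
  · exact (ih c (lt_omc_three a b c) h).trans (lt_omc_three a b c).le

/-- `ϑ(a) < ϑ(a')`. -/
def ThLt (a a' : M.Carrier) : Prop :=
  (TLt a a' ∧ ∀ g, MemK g a → TLt g (thc a' 0)) ∨
    ∃ d, MemK d a' ∧ (thc a 0 = d ∨ TLt (thc a 0) d)

theorem tLt_iff (x y : M.Carrier) : TLt x y ↔ (x = 0 ∧ y ≠ 0) ∨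
    (∃ a r, x = thc a r ∧ ((∃ a' r', y = thc a' r' ∧ (ThLt a a' ∨ a = a' ∧ TLt r r')) ∨
      ∃ a' b' c', y = omc a' b' c')) ∨
    (∃ a b c, x = omc a b c ∧ ∃ a' b' c', y = omc a' b' c' ∧
      (TLt a a' ∨ a = a' ∧ (TLt b b' ∨ b = b' ∧ TLt c c'))) := by
  obtain ⟨T, hT, h⟩ := tr_cov ![] ElemFun.ltStep (pair x y)
  rw [TLt, ElemFun.ltPr, h]
  -- The recursion runs on the code of the pair, and `pair` is strictly monotone; so it may be
  -- called when one component decreases and the other does not increase.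
  have key : ∀ u v, u ≤ x → v ≤ y → (u < x ∨ v < y) → (Bit T (pair u v) ↔ TLt u v) :=
    fun u v h1 h2 h3 => hT _ (pair_lt h1 h2 h3)
  have e : ∀ Q : M.Carrier → M.Carrier → Prop,
      (∃ i ≤ pair x y, ∃ j ≤ pair x y, pair x y = pair i j ∧ Q i j) ↔ Q x y := by
    intro Q
    constructor
    · rintro ⟨i, -, j, -, h1, h2⟩
      rw [pair_inj] at h1
      obtain ⟨rfl, rfl⟩ := h1
      exact h2
    · exact fun h1 => ⟨x, le_pair_left _ _, y, le_pair_right _ _, rfl, h1⟩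
  simp only [ElemFun.ltStep, tr_bex2, tr_and, tr_eq, fn_proj, fn_pr, Matrix.cons_val, e, tr_or,
    tr_bex3, fn_th, fn_om, tr_not, fn_cst, Nat.cast_zero, ex_thc, ex_omc, ex_omc_iff, tr_bit,
    ElemFun.thLt, tr_ball, tr_bex, fn_wk, tr_comp_two]
  refine or_congr Iff.rfl (or_congr ?_ ?_)
  · refine exists_congr fun a => exists_congr fun r => and_congr_right ?_
    rintro rfl
    refine or_congr ?_ Iff.rfl
    refine exists_congr fun a' => exists_congr fun r' => and_congr_right ?_
    rintro rfl
    rw [key a a' (lt_thc_left a r).le (lt_thc_left a' r').le (.inl (lt_thc_left a r)),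
      key r r' (lt_thc_right a r).le (lt_thc_right a' r').le (.inl (lt_thc_right a r))]
    refine or_congr (or_congr (and_congr Iff.rfl ?_) ?_) Iff.rfl
    · refine forall_congr' fun g => ⟨fun h hg => ?_, fun h hg => ?_⟩
      · have hle := le_of_memK hg
        rw [← key g _ (hle.trans (lt_thc_left a r).le) (thc_zero_le a' r')
          (.inl (hle.trans_lt (lt_thc_left a r)))]
        exact (h hle).resolve_left (not_not.2 hg)
      · rw [key g _ (hg.trans (lt_thc_left a r).le) (thc_zero_le a' r')
          (.inl (hg.trans_lt (lt_thc_left a r)))]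
        exact or_iff_not_imp_left.2 fun h' => h (not_not.1 h')
    · refine exists_congr fun d => ⟨fun ⟨hd, h1, h2⟩ => ⟨h1, ?_⟩, fun ⟨h1, h2⟩ => ?_⟩
      · rwa [key _ d (thc_zero_le a r) (hd.trans (lt_thc_left a' r').le)
          (.inr (hd.trans_lt (lt_thc_left a' r')))] at h2
      · have hle := le_of_memK h1
        refine ⟨hle, h1, ?_⟩
        rwa [key _ d (thc_zero_le a r) (hle.trans (lt_thc_left a' r').le)
          (.inr (hle.trans_lt (lt_thc_left a' r')))]
  · refine exists_congr fun a => exists_congr fun b => exists_congr fun c => and_congr_right ?_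
    rintro rfl
    refine exists_congr fun a' => exists_congr fun b' => exists_congr fun c' => and_congr_right ?_
    rintro rfl
    rw [key a a' (lt_omc_one a b c).le (lt_omc_one a' b' c').le (.inl (lt_omc_one a b c)),
      key b b' (lt_omc_two a b c).le (lt_omc_two a' b' c').le (.inl (lt_omc_two a b c)),
      key c c' (lt_omc_three a b c).le (lt_omc_three a' b' c').le (.inl (lt_omc_three a b c))]

theorem not_tLt_zero (x : M.Carrier) : ¬ TLt x 0 := by
  rw [tLt_iff]; simp
theorem zero_tLt {x : M.Carrier} (h : x ≠ 0) : TLt 0 x := by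
  rw [tLt_iff]; simp [h]
theorem thc_tLt_thc {a r a' r' : M.Carrier} :
    TLt (thc a r) (thc a' r') ↔ ThLt a a' ∨ a = a' ∧ TLt r r' := by
  rw [tLt_iff]; simp
theorem not_omc_tLt_thc (a b c a' r' : M.Carrier) : ¬ TLt (omc a b c) (thc a' r') := by
  rw [tLt_iff]; simp
theorem omc_tLt_omc {a b c a' b' c' : M.Carrier} : TLt (omc a b c) (omc a' b' c') ↔
    TLt a a' ∨ a = a' ∧ (TLt b b' ∨ b = b' ∧ TLt c c') := by
  rw [tLt_iff]; simp

theorem isNF_iff (x : M.Carrier) : IsNF x ↔ x = 0 ∨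
    (∃ a r, x = thc a r ∧ (IsNF a ∧ IsNF r) ∧
      (r = 0 ∨ ∃ b s, r = thc b s ∧ (b = a ∨ TLt (thc b 0) (thc a 0)))) ∨
    (∃ a b c, x = omc a b c ∧ (IsNF a ∧ IsNF b ∧ IsNF c) ∧ (a ≠ 0 ∧ b ≠ 0) ∧ Ctbl b ∧
      (Ctbl c ∨ ∃ a' b' c', c = omc a' b' c' ∧ TLt a' a)) := by
  obtain ⟨t, ht, h⟩ := tr_cov ![] ElemFun.isNFStep x
  rw [IsNF, ElemFun.isNF, h]
  simp only [ElemFun.isNFStep, tr_bex2, tr_and, tr_eq, fn_proj, Matrix.cons_val, tr_or,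
    tr_bex3, fn_th, fn_om, tr_not, fn_cst, Nat.cast_zero, ex_thc, ex_omc, tr_bit, tr_isCtbl,
    tr_ltTerm]
  refine or_congr Iff.rfl (or_congr ?_ ?_)
  · refine exists_congr fun a => exists_congr fun r => and_congr_right ?_
    rintro rfl
    rw [ht a (lt_thc_left a r), ht r (lt_thc_right a r)]; rfl
  · refine exists_congr fun a => exists_congr fun b => exists_congr fun c => and_congr_right ?_
    rintro rfl
    rw [ht a (lt_omc_one a b c), ht b (lt_omc_two a b c), ht c (lt_omc_three a b c)]; rfl

theorem isNF_zero : IsNF (0 : M.Carrier) := (isNF_iff _).2 (.inl rfl)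
theorem isNF_thc {a r : M.Carrier} : IsNF (thc a r) ↔ (IsNF a ∧ IsNF r) ∧
      (r = 0 ∨ ∃ b s, r = thc b s ∧ (b = a ∨ TLt (thc b 0) (thc a 0))) := by
  rw [isNF_iff]; simp
theorem isNF_omc {a b c : M.Carrier} : IsNF (omc a b c) ↔
    (IsNF a ∧ IsNF b ∧ IsNF c) ∧ (a ≠ 0 ∧ b ≠ 0) ∧ Ctbl b ∧
      (Ctbl c ∨ ∃ a' b' c', c = omc a' b' c' ∧ TLt a' a) := by
  rw [isNF_iff]; simp

theorem oLt_iff {y x : M.Carrier} : OLt y x ↔ (IsNF y ∧ IsNF x) ∧ TLt y x := by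
  simp [OLt, ElemFun.otLt, IsNF]

@[simp] theorem ctbl_zero : Ctbl (0 : M.Carrier) := .inl rfl
@[simp] theorem ctbl_thc (a r : M.Carrier) : Ctbl (thc a r) := .inr ⟨a, r, rfl⟩
@[simp] theorem not_ctbl_omc (a b c : M.Carrier) : ¬ Ctbl (omc a b c) := by
  simp [Ctbl]

end ArithModel
end WeakID

namespace WeakID

/-! ## Models of the theory of accessibility inductive definitions -/

namespace Fml

variable {P : Type}

theorem IsNeg.subst {A : Fml P} (h : A.IsNeg) (σ : ℕ → Tm) : (A.subst σ).IsNeg := by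
  induction A generalizing σ with
  | rel p t => exact h
  | and A B ihA ihB => exact ⟨ihA h.1 σ, ihB h.2 σ⟩
  | or A B ihA ihB => exact ⟨ihA h.1 σ, ihB h.2 σ⟩
  | all A ih => exact ih h _
  | ex A ih => exact ih h _
  | _ => trivial

theorem IsPos.subst {A : Fml P} (h : A.IsPos) (σ : ℕ → Tm) : (A.subst σ).IsPos := by
  induction A generalizing σ with
  | nrel p t => exact h
  | and A B ihA ihB => exact ⟨ihA h.1 σ, ihB h.2 σ⟩
  | or A B ihA ihB => exact ⟨ihA h.1 σ, ihB h.2 σ⟩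
  | all A ih => exact ih h _
  | ex A ih => exact ih h _
  | _ => trivial

theorem IsPos.neg {A : Fml P} (h : A.IsPos) : A.neg.IsNeg := by
  induction A with
  | nrel p t => exact h
  | and A B ihA ihB => exact ⟨ihA h.1, ihB h.2⟩
  | or A B ihA ihB => exact ⟨ihA h.1, ihB h.2⟩
  | all A ih => exact ih h
  | ex A ih => exact ih h
  | _ => trivial

end Fml

/-- The operator of accessibility for pairs compared by their first components. -/
def pairAcc : AccOp where
  θ := .ne (.fn (.bex2 (.proj 1) (.bex2 (.proj 2)
      (.and (.and (.eq (.proj 5) (.pr (.proj 3) (.proj 2))) (.eq (.proj 4) (.pr (.proj 1) (.proj 0))))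
        (.comp ElemFun.otLt ![.proj 1, .proj 3]))) : ElemFun 2) ![.var 0, .var 1]) .zero
  t := .var 0
  bounded := .ne _ _
  θ_below := by
    refine ⟨fun i => ?_, fun i => i.elim0⟩
    fin_cases i
    · exact Nat.zero_lt_two
    · exact Nat.one_lt_two
  t_below := Nat.zero_lt_two

namespace ArithModel

open Tm Fml

variable {M : ArithModel AccOp}

/-! ### Terms for the code functions -/

section
variable {P : Type} {M : ArithModel P} (e : ℕ → M.Carrier)

def pairT (s t : Tm) : Tm := .fn (.pr (.proj 0) (.proj 1) : ElemFun 2) ![s, t]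
def thT (s t : Tm) : Tm := .fn (.th (.proj 0) (.proj 1) : ElemFun 2) ![s, t]
def omT (s t u : Tm) : Tm := .fn (.om (.proj 0) (.proj 1) (.proj 2) : ElemFun 3) ![s, t, u]

@[simp] theorem val_pairT (s t : Tm) :
    (pairT s t).val M.toMod e = pair (s.val M.toMod e) (t.val M.toMod e) := by
  simp [pairT, val_fn]
@[simp] theorem val_thT (s t : Tm) :
    (thT s t).val M.toMod e = thc (s.val M.toMod e) (t.val M.toMod e) := by
  simp [thT, val_fn]
@[simp] theorem val_omT (s t u : Tm) : (omT s t u).val M.toMod e =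
    omc (s.val M.toMod e) (t.val M.toMod e) (u.val M.toMod e) := by
  simp [omT, val_fn]

theorem fn_ne_zero_one (f : ElemFun 1) (s : Tm) :
    (Tm.fn f ![s]).val M.toMod e ≠ 0 ↔ M.Tr f ![s.val M.toMod e] := by
  rw [val_fn, val_vecCons, val_vecEmpty]; rfl
theorem fn_ne_zero_two (f : ElemFun 2) (s t : Tm) :
    (Tm.fn f ![s, t]).val M.toMod e ≠ 0 ↔ M.Tr f ![s.val M.toMod e, t.val M.toMod e] := by
  rw [val_fn, val_vecCons, val_vecCons, val_vecEmpty]; rfl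

end

/-! ### The axioms -/

variable (M) in
def IsIDModel : Prop := ∀ A ∈ accIDTheory, ∀ e, A.Sat M.toMod e

theorem sat_app (φ : AccOp) (σ : IDFml) (x : M.Carrier) (e : ℕ → M.Carrier) :
    (φ.app σ).Sat M.toMod (vcons x e) ↔
      ∀ y, (ofArith φ.θ : IDFml).Sat M.toMod (vcons y (vcons x e)) →
        σ.Sat M.toMod (vcons (φ.t.val M.toMod (vcons y (vcons x e))) e) := by
  simp only [AccOp.app, sat_all, sat_imp, sat_subst, val_scons]
  rfl

theorem sat_closed (φ : AccOp) (σ : IDFml) (e : ℕ → M.Carrier) :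
    (φ.closed σ).Sat M.toMod e ↔ ∀ x, (∀ y, (ofArith φ.θ : IDFml).Sat M.toMod (vcons y (vcons x e)) →
        σ.Sat M.toMod (vcons (φ.t.val M.toMod (vcons y (vcons x e))) e)) →
        σ.Sat M.toMod (vcons x e) := by
  simp only [AccOp.closed, sat_all, sat_imp, sat_app]

theorem sat_otAcc (y x : M.Carrier) (e : ℕ → M.Carrier) :
    (ofArith otAcc.θ : IDFml).Sat M.toMod (vcons y (vcons x e)) ↔ OLt y x := by
  simp only [otAcc, ofArith, sat_ne, val_zero, fn_ne_zero_two]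
  rfl

theorem sat_pairAcc (v u : M.Carrier) (e : ℕ → M.Carrier) :
    (ofArith pairAcc.θ : IDFml).Sat M.toMod (vcons v (vcons u e)) ↔
      ∃ x y x' y', u = pair x y ∧ v = pair x' y' ∧ OLt x' x := by
  simp only [pairAcc, ofArith, sat_ne, val_zero, fn_ne_zero_two, tr_bex2, tr_and, tr_eq, fn_proj,
    fn_pr, tr_comp_two, Matrix.cons_val, val_var, vcons_zero, vcons_one]
  constructor
  · rintro ⟨x, -, y, -, x', -, y', -, ⟨h1, h2⟩, h3⟩
    exact ⟨x, y, x', y', h1, h2, h3⟩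
  · rintro ⟨x, y, x', y', rfl, rfl, h⟩
    exact ⟨x, le_pair_left _ _, y, le_pair_right _ _, x', le_pair_left _ _, y', le_pair_right _ _,
      ⟨rfl, rfl⟩, h⟩

/-- The accessible part. -/
def W (x : M.Carrier) : Prop := M.rel otAcc x

/-! ### Induction principles for accessible parts -/

namespace IsIDModel

variable (hM : M.IsIDModel)
include hM

/-- The induction axiom in semantic form. The syntactic shape `D ∨ C` enters only through `hX`, so
applications may use any equivalent predicate `X`; parameters are carried by `e`. -/
theorem least (φ : AccOp) {D C : IDFml} (hD : D.IsNeg) (hC : C.IsPos) (e : ℕ → M.Carrier)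
    (X : M.Carrier → Prop)
    (hX : ∀ x, X x ↔ D.Sat M.toMod (vcons x e) ∨ C.Sat M.toMod (vcons x e))
    (hp : ∀ x, (∀ y, (ofArith φ.θ : IDFml).Sat M.toMod (vcons y (vcons x e)) →
      X (φ.t.val M.toMod (vcons y (vcons x e)))) → X x) (u : M.Carrier) (hu : M.rel φ u) : X u := by
  have h := hM _ (.least φ (.or D C) ⟨D, C, hD, hC, rfl⟩) e u
  simp only [sat_imp, sat_rel, val_var, vcons_zero] at h
  rw [Fml.shift, sat_subst] at h
  rw [hX]
  refine h hu ?_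
  change (φ.closed (.or D C)).Sat M.toMod e
  rw [sat_closed]
  simpa only [sat_or, ← hX] using hp

theorem w_intro {x : M.Carrier} (h : ∀ y, OLt y x → W y) : W x := by
  have h1 := hM _ (.fix otAcc) (fun _ => default)
  rw [sat_closed] at h1
  refine h1 x (fun y hy => h y ?_)
  rwa [sat_otAcc] at hy

theorem w_ind {D C : IDFml} (hD : D.IsNeg) (hC : C.IsPos) (e : ℕ → M.Carrier)
    (X : M.Carrier → Prop)
    (hX : ∀ x, X x ↔ D.Sat M.toMod (vcons x e) ∨ C.Sat M.toMod (vcons x e))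
    (hp : ∀ x, (∀ y, OLt y x → X y) → X x) {u : M.Carrier} (hu : W u) : X u :=
  hM.least otAcc hD hC e X hX (fun x h => hp x fun y hy => h y ((sat_otAcc y x e).2 hy)) u hu

/-- Induction on the accessible part for positive formulas. -/
theorem w_ind_pos {C : IDFml} (hC : C.IsPos) (e : ℕ → M.Carrier) (X : M.Carrier → Prop)
    (hX : ∀ x, X x ↔ C.Sat M.toMod (vcons x e))
    (hp : ∀ x, (∀ y, OLt y x → X y) → X x) {u : M.Carrier} (hu : W u) : X u :=
  -- The negative disjunct `0 ≠ 0` is false and contributes nothing.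
  hM.w_ind (D := .ne .zero .zero) trivial hC e X (by simpa using hX) hp hu

/-- The predecessors of `(x, y)` are all `(x', y')` with `x' < x` and `y'` arbitrary, so the
predicate with `∀ y` inside is progressive. It is positive, hence induction on `W` is available for
it. -/
theorem pairAcc_of_w {x : M.Carrier} (hx : W x) : ∀ y, M.rel pairAcc (pair x y) := by
  refine hM.w_ind_pos (C := .all (.rel pairAcc (pairT (.var 1) (.var 0)))) trivial
    (fun _ => default) (fun x => ∀ y, M.rel pairAcc (pair x y)) (by simp) (fun x ih y => ?_) hx
  have h1 := hM _ (.fix pairAcc) (fun _ => default)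
  rw [sat_closed] at h1
  refine h1 (pair x y) (fun v hv => ?_)
  obtain ⟨x', y', x'', y'', h2, rfl, h3⟩ := (sat_pairAcc _ _ _).1 hv
  rw [pair_inj] at h2
  obtain ⟨rfl, rfl⟩ := h2
  exact ih x'' h3 y''

/-- Complete induction for membership in the accessible part. -/
theorem w_strong_induction {u : M.Carrier}
    (h : ∀ z, OLt z u → (∀ y < z, OLt y u → W y) → W z) : ∀ z, OLt z u → W z := by
  -- The formula is `∀ z (z < y ∧ z ≺ u → z ∈ W)`, where `≺` is the ordering of notations and `y` is
  -- the induction variable. As the bound on codes is strict, `z` itself is reached at `y = z + 1`.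
  have key := hM _ (.ind _ ⟨.and (.lt (.var 0) (.var 1))
    (.ne (.fn ElemFun.otLt ![.var 0, .var 2]) .zero), .var 0, otAcc, .and (.lt _ _) (.ne _ _), rfl⟩)
    (vcons u fun _ => default)
  rw [sat_indAx] at key
  simp only [sat_all, sat_imp, ofArith, sat_and, sat_lt, sat_ne, fn_ne_zero_two, val_var, val_zero,
    vcons_zero, vcons_one, vcons_ofNat, sat_rel, sc_eq, lt_add_one_iff, and_imp] at key
  have h1 := key (fun y hy => absurd hy (zero_le' y).not_gt) (fun x ih y hy hu => ?_)
  · exact fun z hz => h1 (z + 1) z (lt_add_one_iff.2 le_rfl) hz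
  · exact h y hu fun v hv hvu => ih v (hv.trans_le hy) hvu

end IsIDModel

/-! ### Universal closures of disjunctions of negative and positive formulas -/

/-- Predicates definable by `∀ y (D(x, y) ∨ C(x, y))` with `D` negative and `C` positive. -/
def AllNP (X : M.Carrier → Prop) : Prop :=
  ∃ (D C : IDFml) (e : ℕ → M.Carrier), D.IsNeg ∧ C.IsPos ∧ ∀ x, X x ↔
    ∀ y, D.Sat M.toMod (vcons x (vcons y e)) ∨ C.Sat M.toMod (vcons x (vcons y e))

/-- The substitution mapping `0`, `1`, `i + 2` to `s`, `t`, `i + k`. -/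
def subst2 (s t : Tm) (k : ℕ) : ℕ → Tm := scons s (scons t (fun i => .var (i + k)))

theorem sat_subst2 (A : IDFml) (s t : Tm) (k : ℕ) (e : ℕ → M.Carrier) :
    (A.subst (subst2 s t k)).Sat M.toMod e ↔
      A.Sat M.toMod (vcons (s.val M.toMod e) (vcons (t.val M.toMod e) (fun i => e (i + k)))) := by
  rw [sat_subst, subst2, val_scons, val_scons]; rfl

/-- The universal quantifier is traded for accessibility of pairs. Progressivity of `∀ y (D ∨ C)`
along `W` makes the matrix progressive along pairs: all predecessors of `(x, y)` satisfy the matrix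
only if `X` holds below `x`, hence `X` holds at `x`, and the matrix holds at `(x, y)`. The matrix is
of the form `N ∨ P`. -/
theorem AllNP.w_ind (hM : M.IsIDModel) {X : M.Carrier → Prop} (hX : AllNP X)
    (hp : ∀ x, (∀ y, OLt y x → X y) → X x) {u : M.Carrier} (hu : W u) : X u := by
  obtain ⟨D, C, e, hD, hC, hX⟩ := hX
  let isP : IDFml := .eq (.var 2) (pairT (.var 1) (.var 0))
  -- Decoding a pair by existential quantifiers preserves both polarities. Components are unique, so
  -- this agrees with universal decoding once non-pairs are admitted separately by a predicate-free
  -- negative disjunct.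
  let σ : IDFml → IDFml := fun A => .ex (.ex (.and isP (A.subst (subst2 (.var 1) (.var 0) 3))))
  let Y : M.Carrier → Prop := fun w => ∀ x y, w = pair x y →
    D.Sat M.toMod (vcons x (vcons y e)) ∨ C.Sat M.toMod (vcons x (vcons y e))
  have hσ : ∀ (A : IDFml) (w : M.Carrier), (σ A).Sat M.toMod (vcons w e) ↔
      ∃ x y, w = pair x y ∧ A.Sat M.toMod (vcons x (vcons y e)) := by
    intro A w
    simp only [σ, isP, sat_ex, sat_and, sat_eq, sat_subst2, val_pairT, val_var, vcons_zero,
      vcons_one, vcons_ofNat]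
    rfl
  have key : ∀ w, M.rel pairAcc w → Y w := by
    refine hM.least pairAcc (D := .or (.all (.all isP.neg)) (σ D)) (C := σ C)
      ⟨trivial, trivial, hD.subst _⟩ ⟨trivial, hC.subst _⟩ e Y (fun w => ?_) (fun w ih => ?_)
    · rw [sat_or, hσ, hσ]
      simp only [Y, isP, Fml.neg, sat_all, sat_ne, val_var, val_pairT, vcons_zero, vcons_one,
        vcons_ofNat]
      constructor
      · intro h
        by_cases h1 : ∃ x y, w = pair x y
        · obtain ⟨x, y, rfl⟩ := h1
          exact (h x y rfl).imp (fun h => .inr ⟨x, y, rfl, h⟩) (fun h => ⟨x, y, rfl, h⟩)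
        · exact .inl (.inl fun x y h2 => h1 ⟨x, y, h2⟩)
      · rintro ((h | ⟨x', y', rfl, h⟩) | ⟨x', y', rfl, h⟩) x y h1
        · exact absurd h1 (h x y)
        · obtain ⟨rfl, rfl⟩ := pair_inj.1 h1
          exact .inl h
        · obtain ⟨rfl, rfl⟩ := pair_inj.1 h1
          exact .inr h
    · rintro x y rfl
      refine (hX x).1 (hp x fun x' hx' => (hX x').2 fun y' => ?_) y
      exact ih (pair x' y') ((sat_pairAcc _ _ _).2 ⟨x, y, x', y', rfl, rfl, hx'⟩) x' y' rfl
  exact (hX u).2 fun y => key _ (hM.pairAcc_of_w hu y) u y rfl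

/-- The negation of a positive guard is negative and is absorbed into `D`. Relativization to `S k`
is thus free of charge. -/
theorem AllNP.guard {X G : M.Carrier → Prop} (hX : AllNP X) (A : IDFml) (hA : A.IsPos)
    (hG : ∀ x e, A.Sat M.toMod (vcons x e) ↔ G x) : AllNP (fun x => G x → X x) := by
  obtain ⟨D, C, e, hD, hC, hX⟩ := hX
  refine ⟨.or A.neg D, C, e, ⟨hA.neg, hD⟩, hC, fun x => ?_⟩
  simp only [hX, sat_or, sat_neg, hG]
  by_cases h : G x <;> simp [h]

theorem AllNP.comp_omc {X : M.Carrier → Prop} (hX : AllNP X) (a b : M.Carrier) :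
    AllNP (fun c => X (omc a b c)) := by
  obtain ⟨D, C, e, hD, hC, hX⟩ := hX
  let s : Tm := omT (.var 2) (.var 3) (.var 0)
  refine ⟨D.subst (subst2 s (.var 1) 4), C.subst (subst2 s (.var 1) 4), vcons a (vcons b e),
    hD.subst _, hC.subst _, fun c => ?_⟩
  simp only [hX, sat_subst2, s, val_omT, val_var, vcons_zero, vcons_one, vcons_ofNat]
  rfl

/-- The quantifier over tails `c` and the quantifier already present are contracted into one over
pairs `w = (c, y)`; values `w` that are not pairs satisfy the negative disjunct. -/
theorem AllNP.forall_omc {X : M.Carrier → Prop} (hX : AllNP X) (a : M.Carrier) :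
    AllNP (fun b => ∀ c, X (omc a b c)) := by
  obtain ⟨D, C, e, hD, hC, hX⟩ := hX
  let isP : IDFml := .eq (.var 3) (pairT (.var 1) (.var 0))
  let σ : IDFml → IDFml := fun A => .ex (.ex (.and isP
    (A.subst (subst2 (omT (.var 4) (.var 2) (.var 1)) (.var 0) 5))))
  have hσ : ∀ (A : IDFml) (b w : M.Carrier),
      (σ A).Sat M.toMod (vcons b (vcons w (vcons a e))) ↔
      ∃ c y, w = pair c y ∧ A.Sat M.toMod (vcons (omc a b c) (vcons y e)) := by
    intro A b w
    simp only [σ, isP, sat_ex, sat_and, sat_eq, sat_subst2, val_pairT, val_omT, val_var,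
      vcons_zero, vcons_one, vcons_ofNat]
    rfl
  refine ⟨.or (.all (.all isP.neg)) (σ D), σ C, vcons a e, ⟨trivial, trivial, hD.subst _⟩,
    ⟨trivial, hC.subst _⟩, fun b => ?_⟩
  simp only [sat_or, hσ, hX]
  simp only [isP, Fml.neg, sat_all, sat_ne, val_var, val_pairT, vcons_zero, vcons_one,
    vcons_ofNat]
  constructor
  · intro h w
    by_cases h1 : ∃ c y, w = pair c y
    · obtain ⟨c, y, rfl⟩ := h1
      exact (h c y).imp (fun h => .inr ⟨c, y, rfl, h⟩) (fun h => ⟨c, y, rfl, h⟩)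
    · exact .inl (.inl fun x y h2 => h1 ⟨x, y, h2⟩)
  · intro h c y
    rcases h (pair c y) with (h | ⟨c', y', h1, h⟩) | ⟨c', y', h1, h⟩
    · exact absurd rfl (h c y)
    · obtain ⟨rfl, rfl⟩ := pair_inj.1 h1
      exact .inl h
    · obtain ⟨rfl, rfl⟩ := pair_inj.1 h1
      exact .inr h

end ArithModel
end WeakID

namespace WeakID
namespace ArithModel

open Tm Fml

variable {M : ArithModel AccOp}

/-! ### Finite ordinals -/

/-- The codes of the finite ordinals. -/
def num : ℕ → M.Carrier
  | 0 => 0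
  | k + 1 => thc 0 (num k)

theorem not_thLt_zero (a : M.Carrier) : ¬ ThLt a 0 := by
  rintro (⟨h, -⟩ | ⟨d, h, -⟩)
  · exact not_tLt_zero _ h
  · exact not_memK_zero _ h

theorem num_inj {i j : ℕ} (h : num i = (num j : M.Carrier)) : i = j := by
  induction i generalizing j with
  | zero =>
    cases j with
    | zero => rfl
    | succ j => exact absurd h (zero_ne_thc _ _)
  | succ i ih =>
    cases j with
    | zero => exact absurd h (thc_ne_zero _ _)
    | succ j => rw [ih (thc_inj.1 h).2]

/-- Nothing is below `ϑ(0)` except `0`, so comparison with a finite ordinal only strips leading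
summands `ϑ(0)`. Even in a nonstandard model, exponents below a standard one are therefore standard.
-/
theorem exists_num_of_tLt {a : M.Carrier} {j : ℕ} (h : TLt a (num j)) : ∃ i < j, a = num i := by
  induction j generalizing a with
  | zero => exact absurd h (not_tLt_zero a)
  | succ j ih =>
    rw [num] at h
    rcases (tLt_iff _ _).1 h with ⟨rfl, -⟩ | ⟨b, s, rfl, -⟩ | ⟨b, s, t, rfl, -⟩
    · exact ⟨0, Nat.succ_pos j, by rw [num]⟩
    · rcases thc_tLt_thc.1 h with h | h
      · exact absurd h (not_thLt_zero b)
      · obtain ⟨i, hi, h1⟩ := ih h.2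
        exact ⟨i + 1, Nat.succ_lt_succ hi, by rw [h.1, h1, num]⟩
    · exact absurd h (not_omc_tLt_thc _ _ _ _ _)

theorem not_num_tLt_num {i j : ℕ} (h : j ≤ i) : ¬ TLt (num i : M.Carrier) (num j) := by
  intro h1
  obtain ⟨k, hk, h2⟩ := exists_num_of_tLt h1
  rw [num_inj h2] at h
  exact absurd hk h.not_gt

theorem ctbl_num (k : ℕ) : Ctbl (num k : M.Carrier) := by
  cases k with
  | zero => exact ctbl_zero
  | succ k => exact ctbl_thc _ _

theorem isNF_num (k : ℕ) : IsNF (num k : M.Carrier) := by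
  induction k with
  | zero => exact isNF_zero
  | succ k ih =>
    refine isNF_thc.2 ⟨⟨isNF_zero, ih⟩, ?_⟩
    cases k with
    | zero => exact .inl rfl
    | succ k => exact .inr ⟨_, _, rfl, .inl rfl⟩

theorem eq_of_memK_num {g : M.Carrier} {k : ℕ} (h : MemK g (num k)) : g = thc 0 0 := by
  induction k with
  | zero => exact absurd h (not_memK_zero g)
  | succ k ih => exact (memK_thc.1 h).elim id ih

/-! ### Normal forms -/

theorem isNF_theta {a : M.Carrier} (h : IsNF a) : IsNF (thc a 0) :=
  isNF_thc.2 ⟨⟨h, isNF_zero⟩, .inl rfl⟩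

theorem isNF_of_memK {g x : M.Carrier} (hx : IsNF x) (h : MemK g x) : IsNF g := by
  have key := tr_strong_induction (M := M) ![g]
    (.or (.not (.comp ElemFun.isNF ![.proj 0])) (.or (.not ElemFun.inK)
      (.comp ElemFun.isNF ![.proj 1])))
  simp only [tr_or, tr_not, tr_comp_one, fn_proj, Matrix.cons_val, ← imp_iff_not_or] at key
  refine key (fun y ih hy h => ?_) x hx h
  rcases (memK_iff g y).1 h with ⟨a, r, rfl, h1⟩ | ⟨a, b, c, rfl, h1⟩
  · obtain ⟨⟨ha, hr⟩, -⟩ := isNF_thc.1 hy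
    rcases h1 with rfl | h
    · exact isNF_theta ha
    · exact ih r (lt_thc_right a r) hr h
  · obtain ⟨⟨ha, hb, hc⟩, -⟩ := isNF_omc.1 hy
    rcases h1 with (h | rfl) | ⟨-, -, rfl⟩ | ⟨-, h⟩
    · exact ih a (lt_omc_one a b c) ha h
    · exact hb
    · exact hc
    · exact ih c (lt_omc_three a b c) hc h

theorem thLt_of_theta_tLt {a b : M.Carrier} (h : TLt (thc a 0) (thc b 0)) : ThLt a b :=
  (thc_tLt_thc.1 h).resolve_right fun h => not_tLt_zero _ h.2

theorem ctbl_tail {a r : M.Carrier} (h : IsNF (thc a r)) : Ctbl r := by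
  rcases (isNF_thc.1 h).2 with rfl | ⟨b, s, rfl, -⟩
  · exact ctbl_zero
  · exact ctbl_thc _ _

/-- If `r` has the same leading summand, the comparison passes to its tail, which explains the
induction on `r` with `a` fixed. Otherwise the leading summand of `r` is smaller. -/
theorem tail_tLt {a r : M.Carrier} (h : IsNF (thc a r)) : TLt r (thc a r) := by
  have key := tr_strong_induction (M := M) ![a]
    (.or (.not (.comp ElemFun.isNF ![.th (.proj 1) (.proj 0)]))
      (.ltTerm (.proj 0) (.th (.proj 1) (.proj 0))))
  simp only [tr_or, tr_not, tr_comp_one, tr_ltTerm, fn_th, fn_proj, Matrix.cons_val,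
    ← imp_iff_not_or] at key
  refine key (fun r ih h => ?_) r h
  obtain ⟨⟨ha, hr⟩, rfl | ⟨b, s, rfl, rfl | h1⟩⟩ := isNF_thc.1 h
  · exact zero_tLt (thc_ne_zero _ _)
  · exact thc_tLt_thc.2 (.inr ⟨rfl, ih s (lt_thc_right _ _) hr⟩)
  · exact thc_tLt_thc.2 (.inl (thLt_of_theta_tLt h1))

/-! ### Terms below `Ω ^ (k + 1)` with coefficients in the accessible part -/

/-- The recursion on `k` takes place in the metatheory, so that each `S k` is defined by one
positive formula (`sFml`). Normality in the clause for `k + 1` excludes zero coefficients; a missing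
power is covered by the first disjunct. -/
def S : ℕ → M.Carrier → Prop
  | 0, c => Ctbl c ∧ IsNF c ∧ W c
  | k + 1, c => S k c ∨ ∃ b c', c = omc (num (k + 1)) b c' ∧ IsNF c ∧ W b ∧ S k c'

section

def numT : ℕ → Tm
  | 0 => .zero
  | k + 1 => thT .zero (numT k)

@[simp] theorem val_numT (k : ℕ) (e : ℕ → M.Carrier) : (numT k).val M.toMod e = num k := by
  induction k with
  | zero => simp [numT, num]
  | succ k ih => simp [numT, num, ih]

def isNFFml (t : Tm) : IDFml := .ne (.fn ElemFun.isNF ![t]) .zero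

@[simp] theorem sat_isNFFml (t : Tm) (e : ℕ → M.Carrier) :
    (isNFFml t).Sat M.toMod e ↔ IsNF (t.val M.toMod e) := by
  simp only [isNFFml, sat_ne, val_zero, fn_ne_zero_one]; rfl

def ctblFml (t : Tm) : IDFml := .ne (.fn (ElemFun.isCtbl (.proj 0) : ElemFun 1) ![t]) .zero

@[simp] theorem sat_ctblFml (t : Tm) (e : ℕ → M.Carrier) :
    (ctblFml t).Sat M.toMod e ↔ Ctbl (t.val M.toMod e) := by
  simp only [ctblFml, sat_ne, val_zero, fn_ne_zero_one]; simp

def sFml : ℕ → IDFml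
  | 0 => .and (ctblFml (.var 0)) (.and (isNFFml (.var 0)) (.rel otAcc (.var 0)))
  | k + 1 => .or (sFml k) (.ex (.ex (.and (.eq (.var 2) (omT (numT (k + 1)) (.var 1) (.var 0)))
      (.and (isNFFml (.var 2)) (.and (.rel otAcc (.var 1)) (sFml k))))))

theorem isPos_sFml (k : ℕ) : (sFml k).IsPos := by
  induction k with
  | zero => exact ⟨trivial, trivial, trivial⟩
  | succ k ih => exact ⟨ih, trivial, trivial, trivial, ih⟩

theorem sat_sFml (k : ℕ) (c : M.Carrier) (e : ℕ → M.Carrier) :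
    (sFml k).Sat M.toMod (vcons c e) ↔ S k c := by
  induction k generalizing c e with
  | zero => simp [sFml, S, W]
  | succ k ih => simp [sFml, S, W, ih]

end

theorem S.isNF {k : ℕ} {c : M.Carrier} (h : S k c) : IsNF c := by
  induction k generalizing c with
  | zero => exact h.2.1
  | succ k ih =>
    rcases h with h | ⟨b, c', -, h, -⟩
    · exact ih h
    · exact h

theorem S.of_zero {c : M.Carrier} (h : S 0 c) (k : ℕ) : S k c := by
  induction k with
  | zero => exact h
  | succ k ih => exact .inl ih

theorem S.w_of_ctbl {k : ℕ} {c : M.Carrier} (h : S k c) (hc : Ctbl c) : W c := by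
  induction k with
  | zero => exact h.2.2
  | succ k ih =>
    rcases h with h | ⟨b, c', rfl, -⟩
    · exact ih h
    · exact absurd hc (not_ctbl_omc _ _ _)

theorem S.exponent {k : ℕ} {a b c : M.Carrier} (h : S k (omc a b c)) : ∃ j ≤ k, a = num j := by
  induction k with
  | zero => exact absurd h.1 (not_ctbl_omc _ _ _)
  | succ k ih =>
    rcases h with h | ⟨b', c', h, -⟩
    · obtain ⟨j, hj, rfl⟩ := ih h
      exact ⟨j, hj.trans (Nat.le_succ k), rfl⟩
    · exact ⟨k + 1, le_rfl, (omc_inj.1 h).1⟩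

/-- A smaller term has a leading exponent at most that of `x`, and below a standard finite exponent
there are only standard finite ones. -/
theorem S.exponent_of_tLt {k : ℕ} {x a b c : M.Carrier} (h : S k x) (hx : TLt (omc a b c) x) :
    ∃ j ≤ k, a = num j := by
  rcases (tLt_iff _ _).1 hx with ⟨h1, -⟩ | ⟨_, _, h1, -⟩ | ⟨a, b, c, h1, a', b', c', rfl, h2⟩
  · exact absurd h1 (omc_ne_zero _ _ _)
  · exact absurd h1 (omc_ne_thc _ _ _ _ _)
  · obtain ⟨rfl, -, -⟩ := omc_inj.1 h1
    obtain ⟨j, hj, rfl⟩ := h.exponent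
    rcases h2 with h2 | ⟨rfl, -⟩
    · obtain ⟨i, hi, rfl⟩ := exists_num_of_tLt h2
      exact ⟨i, hi.le.trans hj, rfl⟩
    · exact ⟨j, hj, rfl⟩

/-- Recovers membership in `S k` from the leading exponent and from `K(x)`. Countable `x` are
treated apart, because `K(x)` then contains the summands of `x` and not the coefficient `x` itself.
The hypothesis on `0` is needed because a tail `0` does not appear in `K`. -/
theorem S.of_coeff {k : ℕ} {x : M.Carrier} (hx : IsNF x)
    (he : ∀ a b c, x = omc a b c → ∃ j ≤ k, a = num j) (hw0 : W (0 : M.Carrier))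
    (hw : Ctbl x → W x) (hK : ¬ Ctbl x → ∀ g, MemK g x → W g) : S k x := by
  have exp : ∀ {k : ℕ} {b c : M.Carrier}, IsNF (omc (num k) b c) →
      ∀ a' b' c', c = omc a' b' c' → ∃ j < k, a' = num j := by
    rintro k b c h a' b' c' rfl
    obtain ⟨-, -, -, h | ⟨a'', b'', c'', h1, h⟩⟩ := isNF_omc.1 h
    · exact absurd h (not_ctbl_omc _ _ _)
    · obtain ⟨rfl, -, -⟩ := omc_inj.1 h1
      exact exists_num_of_tLt h
  induction k generalizing x with
  | zero =>
    by_cases h : Ctbl x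
    · exact ⟨h, hx, hw h⟩
    · rcases (isNF_iff x).1 hx with rfl | ⟨a, r, rfl, -⟩ | ⟨a, b, c, rfl, -, ⟨h1, -⟩, -⟩
      · exact absurd ctbl_zero h
      · exact absurd (ctbl_thc _ _) h
      · obtain ⟨j, hj, rfl⟩ := he a b c rfl
        obtain rfl := Nat.le_zero.1 hj
        exact absurd rfl h1
  | succ k ih =>
    by_cases h : ∃ b c, x = omc (num (k + 1)) b c
    · obtain ⟨b, c, rfl⟩ := h
      have hK := hK (not_ctbl_omc _ _ _)
      refine .inr ⟨b, c, rfl, hx, hK b (memK_omc.2 (.inl (.inr rfl))), ih ?_ ?_ ?_ ?_⟩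
      · exact (isNF_omc.1 hx).1.2.2
      · intro a' b' c' h
        obtain ⟨j, hj, rfl⟩ := exp hx a' b' c' h
        exact ⟨j, Nat.lt_succ_iff.1 hj, rfl⟩
      · intro hc
        by_cases h0 : c = 0
        · rw [h0]; exact hw0
        · exact hK c (memK_omc.2 (.inr (.inl ⟨h0, hc, rfl⟩)))
      · exact fun hc g hg => hK g (memK_omc.2 (.inr (.inr ⟨hc, hg⟩)))
    · refine .inl (ih hx (fun a b c h1 => ?_) hw hK)
      obtain ⟨j, hj, rfl⟩ := he a b c h1
      rcases hj.lt_or_eq with hj | rfl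
      · exact ⟨j, Nat.lt_succ_iff.1 hj, rfl⟩
      · exact absurd ⟨b, c, h1⟩ h

/-- Transfinite induction below `Ω ^ (k + 1)`. -/
theorem S.induction (hM : M.IsIDModel) (k : ℕ) {X : M.Carrier → Prop} (hX : AllNP X)
    (hp : ∀ c, S k c → (∀ c', S k c' → TLt c' c → X c') → X c) : ∀ c, S k c → X c := by
  induction k generalizing X with
  | zero =>
    -- Progressivity is known on `S 0` only, whereas induction along `W` also meets other elements;
    -- the guard makes the step vacuous for them.
    have hX' := hX.guard (sFml 0) (isPos_sFml 0) (sat_sFml 0)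
    intro c hc
    refine hX'.w_ind hM (fun c ih hc => hp c hc fun c' hc' hlt => ?_) hc.2.2 hc
    exact ih c' (oLt_iff.2 ⟨⟨hc'.isNF, hc.isNF⟩, hlt⟩) hc'
  | succ k ih =>
    have hX' := hX.guard (sFml (k + 1)) (isPos_sFml _) (sat_sFml _)
    -- Progressivity restricts to `S k`: below an element of `S k` there is no element of `S (k +
    -- 1)` with leading exponent `k + 1`.
    have h1 : ∀ c, S k c → X c := by
      refine ih hX fun c hc h => hp c (.inl hc) fun c' hc' hlt => ?_
      rcases hc' with hc' | ⟨b, c', rfl, -⟩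
      · exact h c' hc' hlt
      · obtain ⟨j, hj, h2⟩ := hc.exponent_of_tLt hlt
        exact absurd hj (num_inj h2 ▸ Nat.not_succ_le_self k)
    -- The outer induction is on the leading coefficient. All tails are quantified, since lowering
    -- the coefficient permits an arbitrary tail.
    have h2 : ∀ b, W b → ∀ c, S (k + 1) (omc (num (k + 1)) b c) →
        X (omc (num (k + 1)) b c) := by
      intro b hb
      refine (hX'.forall_omc (num (k + 1))).w_ind hM (fun b ihb c hd => ?_) hb
      have hc : S k c := by
        rcases hd with h | ⟨b', c', h, -, -, h'⟩
        · obtain ⟨j, hj, h2⟩ := h.exponent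
          exact absurd hj (num_inj h2 ▸ Nat.not_succ_le_self k)
        · rwa [(omc_inj.1 h).2.2]
      -- The inner induction is on the tail, along `S k`, with `b` fixed.
      refine ih (hX'.comp_omc (num (k + 1)) b) (fun c hc ihc hd => ?_) c hc hd
      refine hp _ hd fun d' hd' hlt => ?_
      rcases hd' with hd' | ⟨b', c', rfl, h3, h4, h5⟩
      · exact h1 d' hd'
      · have hd'' : S (k + 1) (omc (num (k + 1)) b' c') := .inr ⟨b', c', rfl, h3, h4, h5⟩
        rcases omc_tLt_omc.1 hlt with h | ⟨-, h | ⟨rfl, h⟩⟩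
        · exact absurd h (not_num_tLt_num le_rfl)
        · exact ihb b' (oLt_iff.2 ⟨⟨(isNF_omc.1 h3).1.2.1, (isNF_omc.1 hd.isNF).1.2.1⟩, h⟩) c' hd''
        · exact ihc c' h5 h hd''
    rintro c (hc | ⟨b, c, rfl, h3, h4, h5⟩)
    · exact h1 c hc
    · exact h2 b h4 c (.inr ⟨b, c, rfl, h3, h4, h5⟩)

/-! ### Closure properties of the accessible part -/

namespace IsIDModel

variable (hM : M.IsIDModel)
include hM

theorem w_zero : W (0 : M.Carrier) :=
  hM.w_intro fun _ h => absurd (oLt_iff.1 h).2 (not_tLt_zero _)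

/-- Induction on `W` for the positive predicate "all predecessors are in `W`"; this avoids any
appeal to transitivity of the ordering. -/
theorem w_down {x y : M.Carrier} (hx : W x) (h : OLt y x) : W y := by
  refine hM.w_ind_pos (C := .all (imp (.ne (.fn ElemFun.otLt ![.var 0, .var 1]) .zero)
    (.rel otAcc (.var 0)))) ⟨trivial, trivial⟩ (fun _ => default) (fun x => ∀ y, OLt y x → W y)
    (fun x => ?_) (fun x ih y hy => hM.w_intro (ih y hy)) hx y h
  simp only [sat_all, sat_imp, sat_ne, val_zero, fn_ne_zero_two]
  rfl

theorem w_one : W (thc 0 0 : M.Carrier) := by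
  refine hM.w_intro fun z hz => ?_
  obtain ⟨i, hi, rfl⟩ := exists_num_of_tLt (j := 1) (oLt_iff.1 hz).2
  obtain rfl : i = 0 := by omega
  exact hM.w_zero

/-- Closure under sums. -/
theorem w_thc {a r : M.Carrier} (ha : W (thc a 0)) (hr : W r) (h : IsNF (thc a r)) :
    W (thc a r) := by
  refine hM.w_ind (D := (isNFFml (thT (.var 1) (.var 0))).neg)
    (C := .rel otAcc (thT (.var 1) (.var 0))) trivial trivial (vcons a fun _ => default)
    (fun r => IsNF (thc a r) → W (thc a r)) (fun r => ?_) (fun r ih h => ?_) hr h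
  · rw [sat_neg, sat_isNFFml, ← imp_iff_not_or]
    simp [W]
  · refine hM.w_intro fun z hz => ?_
    obtain ⟨⟨hz1, -⟩, hz2⟩ := oLt_iff.1 hz
    -- A nonzero predecessor of `ϑ(a) + r` either has a smaller leading summand, and then is already
    -- below `ϑ(a)`, or has the same one with a smaller tail.
    rcases (isNF_iff z).1 hz1 with rfl | ⟨b, s, rfl, -⟩ | ⟨b, c, d, rfl, -⟩
    · exact hM.w_zero
    · rcases thc_tLt_thc.1 hz2 with h1 | ⟨rfl, h1⟩
      · exact hM.w_down ha (oLt_iff.2 ⟨⟨hz1, isNF_theta (isNF_thc.1 h).1.1⟩,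
          thc_tLt_thc.2 (.inl h1)⟩)
      · exact ih s (oLt_iff.2 ⟨⟨(isNF_thc.1 hz1).1.2, (isNF_thc.1 h).1.2⟩, h1⟩) hz1
    · exact absurd hz2 (not_omc_tLt_thc _ _ _ _ _)

/-- The first summand is at most `c`, and the others belong to the tail, which is smaller than `c`.
The conjunct `W c` is carried along in the induction because the step must know that `c` itself is
in `W`. -/
theorem w_of_memK_ctbl {c : M.Carrier} (hw : W c) (hc : Ctbl c) (hn : IsNF c) {g : M.Carrier}
    (hg : MemK g c) : W g := by
  refine (hM.w_ind_pos (C := .and (.rel otAcc (.var 0)) (imp (ctblFml (.var 0))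
    (imp (isNFFml (.var 0)) (.all (imp (.ne (.fn ElemFun.inK ![.var 1, .var 0]) .zero)
      (.rel otAcc (.var 0))))))) ⟨trivial, trivial, trivial, trivial, trivial⟩ (fun _ => default)
    (fun c => W c ∧ (Ctbl c → IsNF c → ∀ g, MemK g c → W g)) (fun c => ?_)
    (fun c ih => ?_) hw).2 hc hn g hg
  · simp only [sat_and, sat_imp, sat_ctblFml, sat_isNFFml, sat_all, sat_ne, val_zero,
      fn_ne_zero_two]
    rfl
  · have hw : W c := hM.w_intro fun y hy => (ih y hy).1
    refine ⟨hw, fun hc hn g hg => ?_⟩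
    rcases hc with rfl | ⟨a, r, rfl⟩
    · exact absurd hg (not_memK_zero g)
    · obtain ⟨⟨ha, hr⟩, -⟩ := isNF_thc.1 hn
      rcases memK_thc.1 hg with rfl | hg
      · by_cases h0 : r = 0
        · rwa [h0] at hw
        · exact hM.w_down hw (oLt_iff.2 ⟨⟨isNF_theta ha, hn⟩,
            thc_tLt_thc.2 (.inr ⟨rfl, zero_tLt h0⟩)⟩)
      · exact (ih r (oLt_iff.2 ⟨⟨hr, hn⟩, tail_tLt hn⟩)).2 (ctbl_tail hn) hr g hg

/-- Coefficients are in `W` by definition of `S k`; the finite exponents contribute at most `ϑ(0)`.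
-/
theorem w_of_memK {k : ℕ} {x : M.Carrier} (hx : S k x) {g : M.Carrier} (hg : MemK g x) :
    W g := by
  induction k generalizing x with
  | zero => exact hM.w_of_memK_ctbl hx.2.2 hx.1 hx.2.1 hg
  | succ k ih =>
    rcases hx with hx | ⟨b, c, rfl, hn, hb, hc⟩
    · exact ih hx hg
    · rcases memK_omc.1 hg with (h | rfl) | ⟨-, h, rfl⟩ | ⟨-, h⟩
      · rw [eq_of_memK_num h]; exact hM.w_one
      · exact hb
      · exact hc.w_of_ctbl h
      · exact ih hc h

/-- Progressivity of `ϑ(α) ∈ W` on the terms below `Ω ^ (k + 1)`. -/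
theorem w_theta_of_forall {k : ℕ} {x : M.Carrier} (hx : S k x)
    (ih : ∀ y, S k y → TLt y x → W (thc y 0)) : W (thc x 0) := by
  refine hM.w_intro (hM.w_strong_induction fun z hz ihz => ?_)
  obtain ⟨⟨hz1, hz2⟩, hz3⟩ := oLt_iff.1 hz
  rcases (isNF_iff z).1 hz1 with rfl | ⟨b, r, rfl, ⟨hb, hr⟩, hbr⟩ | ⟨b, c, d, rfl, -⟩
  · exact hM.w_zero
  · have hlt : ThLt b x := (thc_tLt_thc.1 hz3).resolve_right fun h => not_tLt_zero _ h.2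
    have hwb : W (thc b 0) := by
      -- The two clauses of `ϑ(b) < ϑ(x)`: in the first, `b` is shown to be in `S k` and `ih`
      -- applies; in the second, `ϑ(b)` is at most some `d` in `K(x) ⊆ W`.
      rcases hlt with ⟨hbx, hKb⟩ | ⟨d, hd, rfl | hd'⟩
      · have hK : ∀ g, MemK g b → g < thc b r ∧ OLt g (thc x 0) := fun g hg =>
          ⟨(le_of_memK hg).trans_lt (lt_thc_left b r),
            oLt_iff.2 ⟨⟨isNF_of_memK hb hg, hz2⟩, hKb g hg⟩⟩
        refine ih b (S.of_coeff hb (fun a' b' c' h => ?_) hM.w_zero (fun hc => ?_) (fun _ g hg => ?_))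
          hbx
        · exact hx.exponent_of_tLt (h ▸ hbx)
        -- A countable `b` must itself be in `W`, not only its summands. Its leading summand belongs
        -- to `K(b)` and so is below `ϑ(x)`; hence `b < ϑ(x)`, and `b` has a smaller code than `z`.
        · rcases hc with rfl | ⟨a', s, rfl⟩
          · exact hM.w_zero
          · refine ihz _ (lt_thc_left _ r) (oLt_iff.2 ⟨⟨hb, hz2⟩, thc_tLt_thc.2 (.inl ?_)⟩)
            exact thLt_of_theta_tLt (hKb _ (memK_thc.2 (.inl rfl)))
        · exact ihz g (hK g hg).1 (hK g hg).2
      · exact hM.w_of_memK hx hd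
      · exact hM.w_down (hM.w_of_memK hx hd)
          (oLt_iff.2 ⟨⟨isNF_theta hb, isNF_of_memK hx.isNF hd⟩, hd'⟩)
    refine hM.w_thc hwb ?_ hz1
    -- The tail is `0`; or it starts again with `ϑ(b)` and is below `ϑ(x)` with a smaller code; or
    -- it is below `ϑ(b)`, which is already in `W`.
    rcases hbr with rfl | ⟨b', s, rfl, rfl | h⟩
    · exact hM.w_zero
    · exact ihz _ (lt_thc_right _ _) (oLt_iff.2 ⟨⟨hr, hz2⟩, thc_tLt_thc.2 (.inl hlt)⟩)
    · exact hM.w_down hwb (oLt_iff.2 ⟨⟨hr, isNF_theta hb⟩,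
        thc_tLt_thc.2 (.inl (thLt_of_theta_tLt h))⟩)
  · exact absurd hz3 (not_omc_tLt_thc _ _ _ _ _)

/-- The predicate `ϑ(x) ∈ W` is positive, hence in `AllNP` with a dummy quantifier and a false
negative part. -/
theorem w_theta {k : ℕ} {x : M.Carrier} (hx : S k x) : W (thc x 0) := by
  refine S.induction hM k (X := fun x => W (thc x 0)) ?_ (fun c hc h => hM.w_theta_of_forall hc h)
    x hx
  refine ⟨.ne .zero .zero, .rel otAcc (thT (.var 0) .zero), fun _ => default, trivial, trivial,
    fun x => ?_⟩
  simp [W]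

end IsIDModel

/-! ### Codes of standard terms -/

theorem val_numeral (k : ℕ) (e : ℕ → M.Carrier) :
    (Tm.numeral k).val M.toMod e = (k : M.Carrier) := by
  induction k with
  | zero => simp [Tm.numeral]
  | succ k ih => simp [Tm.numeral, sc_eq, ih]

theorem cast_pr (a b : ℕ) : ((OTerm.pr a b : ℕ) : M.Carrier) = pair (a : M.Carrier) b := by
  simp [OTerm.pr, pair]

theorem cast_code_th (a r : OTerm) :
    (((OTerm.th a r).code : ℕ) : M.Carrier) = thc (a.code : M.Carrier) r.code := by
  simp [OTerm.code, thc, cast_pr]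

theorem cast_code_om (a b c : OTerm) :
    (((OTerm.om a b c).code : ℕ) : M.Carrier) = omc (a.code : M.Carrier) b.code c.code := by
  simp [OTerm.code, omc, cast_pr]

theorem cast_code_ofNat (k : ℕ) : (((OTerm.ofNat k).code : ℕ) : M.Carrier) = num k := by
  induction k with
  | zero => simp [OTerm.ofNat, OTerm.code, num]
  | succ k ih => rw [OTerm.ofNat, cast_code_th, ih]; simp [OTerm.code, num]

/-- For `l > 0` the only coefficient is `1` and the tail is `0`, both in `W`. The case `l = 0` is
separate because `Ω^0` is the countable term `1`. -/
theorem IsIDModel.s_omegaPow (hM : M.IsIDModel) (l : ℕ) :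
    S l (((OTerm.omegaPow l).code : ℕ) : M.Carrier) := by
  have h1 : W (num 1 : M.Carrier) := hM.w_one
  cases l with
  | zero =>
    rw [OTerm.omegaPow, cast_code_ofNat]
    exact ⟨ctbl_num 1, isNF_num 1, h1⟩
  | succ l =>
    rw [OTerm.omegaPow, cast_code_om, cast_code_ofNat, cast_code_ofNat]
    simp only [OTerm.code, Nat.cast_zero]
    refine .inr ⟨num 1, 0, rfl, isNF_omc.2 ⟨⟨isNF_num _, isNF_num _, isNF_zero⟩,
      ⟨thc_ne_zero _ _, thc_ne_zero _ _⟩, ctbl_num 1, .inl ctbl_zero⟩, h1, ?_⟩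
    exact S.of_zero ⟨ctbl_zero, isNF_zero, hM.w_zero⟩ l

end ArithModel

end WeakID

theorem lemma2p3 (l : ℕ) :
    WeakID.Provable WeakID.accIDTheory
      (WeakID.inW (WeakID.OTerm.theta (WeakID.OTerm.omegaPow l))) := by
  refine WeakID.provable_of_sat (fun A hA => .ea A (.ofEq A hA)) _ fun N hN e => ?_
  -- A model of the full theory is in particular a model of `EA`, which provides the ordered
  -- semiring and the coded notation system.
  let M : WeakID.ArithModel WeakID.AccOp := ⟨N, fun A hA e => hN A (.ea A hA) e⟩
  have hM : M.IsIDModel := hN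
  have h := hM.w_theta (hM.s_omegaPow l)
  change M.rel WeakID.otAcc _
  rw [WeakID.ArithModel.val_numeral (M := M), WeakID.OTerm.theta,
    WeakID.ArithModel.cast_code_th]
  simpa [WeakID.OTerm.code, WeakID.ArithModel.W] using h
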